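/- **Theorem.** Let $c,\Omega,g,R>0$, let $N\ge 0$ be an integer, and let $\boldsymbol{x}_1,\dots,\boldsymbol{x}_N\in\mathbb{R}^3$ be distinct points. Put $r_{j\ell}=|\boldsymbol{x}_j-\boldsymbol{x}_\ell|$, $f(k,r)=4\pi\frac{\sin(kr)}{kr}$ (with $f=4\pi$ when $kr=0$) and $\gamma=\frac{g^2}{(2\pi)^3}$. Define the $N\times N$ matrix functions $$\Gamma_{j\ell}(s)=\frac1{ic}\int_0^\infty\frac{k^2e^{-k^2R^2}f(k,r_{j\ell})}{\frac{s}{ic}+k}\,dk\quad(s\in\mathbb{C}\setminus(-i)[0,\infty)),\qquad E_{j\ell}(y)=\gamma\int_0^\infty\frac{k^2e^{-k^2R^2}f(k,r_{j\ell})}{y+ck}\,dk\quad(y\in\mathbb{C}\setminus(-\infty,0)).$$ 1. The matrix function $y\mapsto(y+\Omega-E(y))^{-1}$ is meromorphic on $\mathbb{C}\setminus(-\infty,0]$. Its poles there are positive real numbers, and there are finitely many of them, $p_1,\dots,p_{n_p}$ (distinct), with $n_p\le N$. Let $R_j$ be the residue at $p_j$. 2. For every $y>0$ the limits $$A^{\mp}(y)=\lim_{\varepsilon\to0^+}ic\,\Gamma(-iy\pm\varepsilon)$$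 exist, and the matrices $y-\Omega+\frac{\gamma}{c}A^{\pm}(y)$ are invertible. Let $H^\pm(y)=\left(y-\Omega+\frac{\gamma}{c}A^\pm(y)\right)^{-1}$. 3. Suppose that $\Omega I-E(0)$ is invertible. Let $\vec\beta:[0,\infty)\to\mathbb{C}^N$ be a solution of $$\beta_j'(t)=-\gamma\sum_{\ell=1}^N\int_0^t\beta_\ell(\tau)e^{i\Omega(t-\tau)}\int_0^\infty k^2e^{-ick(t-\tau)-k^2R^2}f(k,r_{j\ell})\,dk\,d\tau ,\qquad j=1,\dots,N,$$ that is, $\vec\beta$ is continuous on $[0,\infty)$ and differentiable on $(0,\infty)$, and the equation holds for all $t>0$. Then for every $t\ge0$ the integral below converges absolutely and $$\vec\beta(t)=\frac{e^{i\Omega t}}{2\pi i}\int_0^\infty e^{-iyt}\left(H^+(y)-H^-(y)\right)\vec\beta(0)\,dy+\sum_{j=1}^{n_p}R_j\vec\beta(0)\,e^{i(p_j+\Omega)t}.$$ -/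

import Mathlib

open Filter Topology MeasureTheory Set

noncomputable section

namespace AtomPhoton

/-- `f(k, r) = 4π sin(kr) / (kr)`, with its continuous value `4π` at `kr = 0`. -/
def sphKernel (k r : ℝ) : ℝ := 4 * Real.pi * Real.sinc (k * r)

/-- The constant `g² / (2π)³`. -/
def coupling (g : ℝ) : ℝ := g ^ 2 / (2 * Real.pi) ^ 3

/-- `β` is a solution, for `t ≥ 0`, of the integro-differential system
`β_j'(t) = -g²/(2π)³ ∑_ℓ ∫₀ᵗ β_ℓ(τ) e^{iΩ(t-τ)} ∫₀^∞ k² e^{-ick(t-τ) - k²R²} f(k, r_{jℓ}) dk dτ`,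
where `r_{jℓ} = |x_j - x_ℓ|`. -/
structure IsSolution (c Ω g R : ℝ) {N : ℕ} (x : Fin N → EuclideanSpace ℝ (Fin 3))
    (β : ℝ → Fin N → ℂ) : Prop where
  continuousOn : ContinuousOn β (Ici 0)
  hasDerivAt : ∀ t : ℝ, 0 < t → ∀ j : Fin N,
    HasDerivAt (fun s => β s j)
      (-(coupling g : ℂ) * ∑ l : Fin N, ∫ τ in (0 : ℝ)..t,
        β τ l * Complex.exp (Complex.I * Ω * (t - τ)) *
          ∫ k in Ioi (0 : ℝ),
            (k : ℂ) ^ 2 * Complex.exp (-Complex.I * c * k * (t - τ) - (k : ℂ) ^ 2 * (R : ℂ) ^ 2) *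
              (sphKernel k (dist (x j) (x l)) : ℂ)) t

/-- `Γ_{jℓ}(s) = (ic)⁻¹ ∫₀^∞ e^{-k²R²} k² f(k, r_{jℓ}) / (s/(ic) + k) dk`, for complex `s` off
the negative imaginary axis. -/
def Gam (c R : ℝ) {N : ℕ} (x : Fin N → EuclideanSpace ℝ (Fin 3)) (s : ℂ) :
    Matrix (Fin N) (Fin N) ℂ :=
  Matrix.of fun j l =>
    (1 / (Complex.I * c)) * ∫ k in Ioi (0 : ℝ),
      (Real.exp (-(k ^ 2 * R ^ 2)) : ℂ) / (s / (Complex.I * c) + k) * (k : ℂ) ^ 2 *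
        (sphKernel k (dist (x j) (x l)) : ℂ)

/-- `A⁺(y) = lim_{ε → 0⁺} i c Γ(-iy - ε)`, entrywise, for `y > 0`. -/
def APlus (c R : ℝ) {N : ℕ} (x : Fin N → EuclideanSpace ℝ (Fin 3)) (y : ℝ) :
    Matrix (Fin N) (Fin N) ℂ :=
  Matrix.of fun j l =>
    limUnder (𝓝[>] (0 : ℝ)) fun ε : ℝ => Complex.I * c * Gam c R x (-Complex.I * y - ε) j l

/-- `A⁻(y) = lim_{ε → 0⁺} i c Γ(-iy + ε)`, entrywise, for `y > 0`. -/
def AMinus (c R : ℝ) {N : ℕ} (x : Fin N → EuclideanSpace ℝ (Fin 3)) (y : ℝ) :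
    Matrix (Fin N) (Fin N) ℂ :=
  Matrix.of fun j l =>
    limUnder (𝓝[>] (0 : ℝ)) fun ε : ℝ => Complex.I * c * Gam c R x (-Complex.I * y + ε) j l

/-- `y - Ω + g²/((2π)³c) A⁺(y)`. -/
def DPlus (c Ω g R : ℝ) {N : ℕ} (x : Fin N → EuclideanSpace ℝ (Fin 3)) (y : ℝ) :
    Matrix (Fin N) (Fin N) ℂ :=
  ((y : ℂ) - Ω) • (1 : Matrix (Fin N) (Fin N) ℂ) + ((coupling g : ℂ) / c) • APlus c R x y

/-- `y - Ω + g²/((2π)³c) A⁻(y)`. -/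
def DMinus (c Ω g R : ℝ) {N : ℕ} (x : Fin N → EuclideanSpace ℝ (Fin 3)) (y : ℝ) :
    Matrix (Fin N) (Fin N) ℂ :=
  ((y : ℂ) - Ω) • (1 : Matrix (Fin N) (Fin N) ℂ) + ((coupling g : ℂ) / c) • AMinus c R x y

/-- `H⁺(y) = (y - Ω + g²/((2π)³c) A⁺(y))⁻¹`. -/
def HPlus (c Ω g R : ℝ) {N : ℕ} (x : Fin N → EuclideanSpace ℝ (Fin 3)) (y : ℝ) :
    Matrix (Fin N) (Fin N) ℂ := (DPlus c Ω g R x y)⁻¹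

/-- `H⁻(y) = (y - Ω + g²/((2π)³c) A⁻(y))⁻¹`. -/
def HMinus (c Ω g R : ℝ) {N : ℕ} (x : Fin N → EuclideanSpace ℝ (Fin 3)) (y : ℝ) :
    Matrix (Fin N) (Fin N) ℂ := (DMinus c Ω g R x y)⁻¹

/-- `E_{jℓ}(y) = g²/(2π)³ ∫₀^∞ k² f(k, r_{jℓ}) e^{-k²R²} / (y + ck) dk`, for complex `y` outside
the half-line `(-∞, 0)`. -/
def EMat (c g R : ℝ) {N : ℕ} (x : Fin N → EuclideanSpace ℝ (Fin 3)) (y : ℂ) :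
    Matrix (Fin N) (Fin N) ℂ :=
  Matrix.of fun j l =>
    (coupling g : ℂ) * ∫ k in Ioi (0 : ℝ),
      (k : ℂ) ^ 2 * (sphKernel k (dist (x j) (x l)) : ℂ) * (Real.exp (-(k ^ 2 * R ^ 2)) : ℂ) /
        (y + c * k)

/-- The matrix function `(y + Ω - E(y))⁻¹`. -/
def resolv (c Ω g R : ℝ) {N : ℕ} (x : Fin N → EuclideanSpace ℝ (Fin 3)) (y : ℂ) :
    Matrix (Fin N) (Fin N) ℂ :=
  ((y + Ω) • (1 : Matrix (Fin N) (Fin N) ℂ) - EMat c g R x y)⁻¹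

/-- A pole of a matrix-valued function at `p`: some entry has a pole at `p`. -/
def IsMatrixPole {N : ℕ} (F : ℂ → Matrix (Fin N) (Fin N) ℂ) (p : ℂ) : Prop :=
  ∃ j l : Fin N, meromorphicOrderAt (fun y => F y j l) p < 0

/-- The residue of a matrix-valued function at `p`, entrywise
`lim_{ε → 0⁺} (2πi)⁻¹ ∮_{|y - p| = ε} F(y) dy`. -/
def matrixResidue {N : ℕ} (F : ℂ → Matrix (Fin N) (Fin N) ℂ) (p : ℂ) :
    Matrix (Fin N) (Fin N) ℂ :=
  Matrix.of fun j l =>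
    limUnder (𝓝[>] (0 : ℝ)) fun ε : ℝ =>
      (2 * Real.pi * Complex.I)⁻¹ * ∮ y in C(p, ε), F y j l

end AtomPhoton

end

/-!
Eliminating the photon field leaves the matrix `M(z) = Ω - z - ∫₀^∞ W(k) / (k - z) dk`, where `W` is
the spectral density of the field. The entries of `W(k)` are multiples of `sin(kr) / (kr)`, the
Fourier transform of the surface measure of the unit sphere, so `W(k)` is a Gram matrix of plane
waves on the sphere; these are linearly independent, hence `W(k)` is positive definite for `k > 0`.

* `M(-p)` is strictly increasing in `p > 0`, so the form of `M(-q)` is negative on combinations of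
  kernel vectors of `M(-p)`, `p > q`. Hence kernel vectors for distinct `p` are linearly independent
  and at most `N` values of `p` occur. They are the poles of `(y + Ω - E(y))⁻¹ = M(-y)⁻¹`, all
  simple.
* Rotating the path of integration continues `M` to the cut `[0, ∞)` from above. There
  `Im M(x) = -π W(x)` is negative definite for `x > 0`, so the boundary values are invertible.
* The Laplace transform of a solution `β` is `-i M(is + Ω)⁻¹ β(0)`. Cauchy's formula writes `M⁻¹` as
  the Stieltjes transform of its jump across the cut plus its principal parts at the poles, which is
  the Laplace transform of the asserted formula; the transform is injective.
-/

namespace AtomPhoton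

open Complex (I)
open scoped ComplexConjugate ComplexOrder Matrix Pointwise Real

/-! ### Stieltjes transforms -/

/-- The Stieltjes transform `z ↦ ∫₀^∞ φ(k) / (k - z) dk` of a density on the half-line, a function
on the complement of the cut `[0, ∞)`; that `z` is off the cut reads `-z ∈ Complex.slitPlane`. -/
noncomputable def stieltjes (φ : ℝ → ℂ) (z : ℂ) : ℂ :=
  ∫ k in Ioi (0 : ℝ), φ k / (k - z)

theorem neg_mem_slitPlane_of_im_ne_zero {z : ℂ} (hz : z.im ≠ 0) : -z ∈ Complex.slitPlane :=
  Complex.mem_slitPlane_iff.2 (Or.inr (by simpa using hz))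

theorem exists_forall_ball_le_norm_ofReal_sub {z : ℂ} (hz : -z ∈ Complex.slitPlane) :
    ∃ δ > 0, ∀ w ∈ Metric.ball z δ, ∀ k : ℝ, 0 < k → δ ≤ ‖(k - w : ℂ)‖ := by
  obtain ⟨ε, hε, hball⟩ := Metric.isOpen_iff.1
    (Complex.isOpen_slitPlane.preimage continuous_neg) z hz
  refine ⟨ε / 2, by positivity, fun w hw k hk => le_of_not_gt fun hlt => ?_⟩
  have hkz : (k : ℂ) ∈ Metric.ball z ε := by
    have := dist_triangle (k : ℂ) w z
    rw [Metric.mem_ball] at hw ⊢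
    rw [dist_eq_norm (k : ℂ) w] at this
    linarith
  have : 0 < (-(k : ℂ)).re ∨ (-(k : ℂ)).im ≠ 0 := Complex.mem_slitPlane_iff.1 (hball hkz)
  simp only [Complex.neg_re, Complex.ofReal_re, Complex.neg_im, Complex.ofReal_im, neg_zero, ne_eq,
    not_true_eq_false, or_false] at this
  linarith

section Integrable

variable {φ : ℝ → ℂ}

theorem aestronglyMeasurable_div_sub (hφ : IntegrableOn φ (Ioi 0)) (w : ℂ) :
    AEStronglyMeasurable (fun k : ℝ => φ k / (k - w)) (volume.restrict (Ioi 0)) :=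
  (hφ.aemeasurable.div (by fun_prop)).aestronglyMeasurable

theorem integrableOn_div_sub (hφ : IntegrableOn φ (Ioi 0)) {z : ℂ} (hz : -z ∈ Complex.slitPlane) :
    IntegrableOn (fun k : ℝ => φ k / (k - z)) (Ioi 0) := by
  obtain ⟨δ, hδ, hle⟩ := exists_forall_ball_le_norm_ofReal_sub hz
  refine Integrable.mono' (hφ.norm.div_const δ) (aestronglyMeasurable_div_sub hφ z) ?_
  refine (ae_restrict_mem measurableSet_Ioi).mono fun k hk => ?_
  rw [norm_div]
  gcongr
  exact hle z (Metric.mem_ball_self hδ) k hk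

theorem differentiableAt_stieltjes (hφ : IntegrableOn φ (Ioi 0)) {z : ℂ}
    (hz : -z ∈ Complex.slitPlane) : DifferentiableAt ℂ (stieltjes φ) z := by
  obtain ⟨δ, hδ, hle⟩ := exists_forall_ball_le_norm_ofReal_sub hz
  refine (hasDerivAt_integral_of_dominated_loc_of_deriv_le (𝕜 := ℂ)
    (F := fun w (k : ℝ) => φ k / (k - w)) (F' := fun w (k : ℝ) => φ k / (k - w) ^ 2)
    (bound := fun k => ‖φ k‖ / δ ^ 2) (Metric.ball_mem_nhds z hδ)
    (Eventually.of_forall (aestronglyMeasurable_div_sub hφ)) (integrableOn_div_sub hφ hz)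
    (hφ.aemeasurable.div (by fun_prop)).aestronglyMeasurable ?_ (hφ.norm.div_const _)
    ?_).2.differentiableAt
  · refine (ae_restrict_mem measurableSet_Ioi).mono fun k hk w hw => ?_
    rw [norm_div, norm_pow]
    gcongr
    exact hle w hw k hk
  · refine (ae_restrict_mem measurableSet_Ioi).mono fun k hk w hw => ?_
    have hne : (k - w : ℂ) ≠ 0 := norm_pos_iff.1 (hδ.trans_le (hle w hw k hk))
    convert! (hasDerivAt_const w (φ k)).div ((hasDerivAt_id w).const_sub (k : ℂ)) hne using 1
    simp

end Integrable

theorem stieltjes_conj (φ : ℝ → ℂ) (z : ℂ) :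
    stieltjes φ (conj z) = conj (stieltjes (fun k => conj (φ k)) z) := by
  rw [stieltjes, stieltjes, ← integral_conj]
  simp

section RealDensity

variable {ρ : ℝ → ℝ}

theorem im_ofReal_div_sub (a k : ℝ) (z : ℂ) :
    ((a : ℂ) / (k - z)).im = a * z.im / Complex.normSq (k - z) := by
  simp [Complex.div_im, neg_div]

theorem integrableOn_mul_im_div_normSq (hρ : IntegrableOn ρ (Ioi 0)) {z : ℂ}
    (hz : -z ∈ Complex.slitPlane) :
    IntegrableOn (fun k : ℝ => ρ k * z.im / Complex.normSq (k - z)) (Ioi 0) := by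
  simp_rw [← im_ofReal_div_sub]
  exact (integrableOn_div_sub hρ.ofReal hz).im

theorem im_stieltjes_ofReal (hρ : IntegrableOn ρ (Ioi 0)) {z : ℂ} (hz : -z ∈ Complex.slitPlane) :
    (stieltjes (fun k => ρ k) z).im =
      ∫ k in Ioi (0 : ℝ), ρ k * z.im / Complex.normSq (k - z) := by
  simp_rw [← im_ofReal_div_sub]
  exact (integral_im (integrableOn_div_sub hρ.ofReal hz)).symm

theorem mul_im_stieltjes_ofReal_nonneg (hρ : IntegrableOn ρ (Ioi 0))
    (hpos : ∀ k, 0 < k → 0 ≤ ρ k) {z : ℂ} (hz : -z ∈ Complex.slitPlane) :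
    0 ≤ z.im * (stieltjes (fun k => ρ k) z).im := by
  rw [im_stieltjes_ofReal hρ hz, ← integral_const_mul]
  refine setIntegral_nonneg measurableSet_Ioi fun k hk => ?_
  rw [mul_div_assoc', mul_left_comm]
  exact div_nonneg (mul_nonneg (hpos k hk) (mul_self_nonneg _)) (Complex.normSq_nonneg _)

-- On `(x, x + ε]` the Poisson kernel `ε / ((k - x)² + ε²)` is at least `1 / (2ε)`.
theorem half_le_im_stieltjes_ofReal (hρ : IntegrableOn ρ (Ioi 0)) (hpos : ∀ k, 0 < k → 0 ≤ ρ k)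
    {x ε m : ℝ} (hx : 0 ≤ x) (hε : 0 < ε) (hm : 0 ≤ m) (hle : ∀ k ∈ Ioc x (x + ε), m ≤ ρ k) :
    m / 2 ≤ (stieltjes (fun k => ρ k) (x + ε * I)).im := by
  have him : (x + ε * I : ℂ).im = ε := by simp
  have hslit : -(x + ε * I : ℂ) ∈ Complex.slitPlane :=
    neg_mem_slitPlane_of_im_ne_zero (by rw [him]; exact hε.ne')
  have hint := integrableOn_mul_im_div_normSq hρ hslit
  have hsub : Ioc x (x + ε) ⊆ Ioi 0 := fun k hk => hx.trans_lt hk.1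
  have hkernel : ∀ k ∈ Ioc x (x + ε),
      m / (2 * ε) ≤ ρ k * (x + ε * I : ℂ).im / Complex.normSq (k - (x + ε * I)) := by
    intro k hk
    have hns : Complex.normSq (k - (x + ε * I)) = (k - x) ^ 2 + ε ^ 2 := by
      rw [Complex.normSq_apply]; simp; ring
    have hsq : (k - x) ^ 2 ≤ ε ^ 2 := by nlinarith [hk.1, hk.2]
    rw [him, hns, div_le_div_iff₀ (by positivity) (by positivity)]
    nlinarith [mul_nonneg hm (sub_nonneg.2 hsq),
      mul_nonneg (sub_nonneg.2 (hle k hk)) (sq_nonneg ε)]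
  calc m / 2 = ∫ _ in Ioc x (x + ε), m / (2 * ε) := by
        rw [setIntegral_const, Real.volume_real_Ioc_of_le (by linarith), smul_eq_mul]
        field_simp; ring
    _ ≤ ∫ k in Ioc x (x + ε), ρ k * (x + ε * I : ℂ).im / Complex.normSq (k - (x + ε * I)) :=
        setIntegral_mono_on (by simp) (hint.mono_set hsub) measurableSet_Ioc hkernel
    _ ≤ ∫ k in Ioi 0, ρ k * (x + ε * I : ℂ).im / Complex.normSq (k - (x + ε * I)) := by
        refine setIntegral_mono_set hint ?_ hsub.eventuallyLE
        refine (ae_restrict_mem measurableSet_Ioi).mono fun k hk => ?_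
        exact div_nonneg (mul_nonneg (hpos k hk) (by rw [him]; exact hε.le))
          (Complex.normSq_nonneg _)
    _ = _ := (im_stieltjes_ofReal hρ hslit).symm

end RealDensity

/-! ### Boundary values by rotation of the path of integration -/

section Strip

variable {E : Type*} [NormedAddCommGroup E] [NormedSpace ℂ E]
  {f : ℂ → E} {a b : ℝ} {B : ℝ → ℝ}

theorem tendsto_intervalIntegral_vertical_of_norm_le {l : Filter ℝ}
    (hab : a ≤ b) (hB : ∀ u : ℂ, a ≤ u.im → u.im ≤ b → ‖f u‖ ≤ B u.re) (hl : Tendsto B l (𝓝 0)) :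
    Tendsto (fun T : ℝ => ∫ y in a..b, f (T + y * I)) l (𝓝 0) := by
  refine squeeze_zero_norm (a := fun T => B T * |b - a|) (fun T => ?_)
    (by simpa using hl.mul_const |b - a|)
  refine intervalIntegral.norm_integral_le_of_norm_le_const fun y hy => ?_
  rw [uIoc_of_le hab] at hy
  simpa using hB (T + y * I) (by simpa using hy.1.le) (by simpa using hy.2)

theorem integral_add_mul_I_eq_of_strip (hab : a ≤ b)
    (hd : ∀ u : ℂ, a ≤ u.im → u.im ≤ b → DifferentiableAt ℂ f u)
    (hB : ∀ u : ℂ, a ≤ u.im → u.im ≤ b → ‖f u‖ ≤ B u.re) (hint : Integrable B)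
    (htop : Tendsto B atTop (𝓝 0)) (hbot : Tendsto B atBot (𝓝 0)) :
    ∫ x : ℝ, f (x + a * I) = ∫ x : ℝ, f (x + b * I) := by
  have hline : ∀ y : ℝ, a ≤ y → y ≤ b → Integrable fun x : ℝ => f (x + y * I) := by
    intro y hay hyb
    have hcont : Continuous fun x : ℝ => f (x + y * I) :=
      continuous_iff_continuousAt.2 fun x => ContinuousAt.comp (f := fun x : ℝ => (x + y * I : ℂ))
        (hd (x + y * I) (by simpa using hay) (by simpa using hyb)).continuousAt (by fun_prop)
    exact hint.mono' hcont.aestronglyMeasurable (Eventually.of_forall fun x => by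
      simpa using hB (x + y * I) (by simpa using hay) (by simpa using hyb))
  have hrect : ∀ T : ℝ, (∫ x in (-T)..T, f (x + a * I)) - (∫ x in (-T)..T, f (x + b * I))
      + I • (∫ y in a..b, f (T + y * I)) - I • (∫ y in a..b, f ((-T : ℝ) + y * I)) = 0 := fun T =>
    Complex.integral_boundary_rect_eq_zero_of_differentiableOn f ⟨-T, a⟩ ⟨T, b⟩ fun u hu => by
      have him : u.im ∈ uIcc a b := hu.2
      rw [uIcc_of_le hab] at him
      exact (hd u him.1 him.2).differentiableWithinAt
  have hright := tendsto_intervalIntegral_vertical_of_norm_le hab hB htop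
  have hleft := (tendsto_intervalIntegral_vertical_of_norm_le hab hB hbot).comp
    tendsto_neg_atTop_atBot
  have hhor := fun y hay hyb => intervalIntegral_tendsto_integral (hline y hay hyb)
    tendsto_neg_atTop_atBot tendsto_id
  have hlim := (((hhor a le_rfl hab).sub (hhor b hab le_rfl)).add (hright.const_smul I)).sub
    (hleft.const_smul I)
  have := tendsto_nhds_unique (hlim.congr hrect) tendsto_const_nhds
  simpa [sub_eq_zero] using this

end Strip

theorem integrable_exp_neg_abs : Integrable fun x : ℝ => Real.exp (-|x|) := by
  rw [← integrableOn_univ, ← Iic_union_Ioi (a := (0 : ℝ))]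
  refine IntegrableOn.union ?_ ?_
  · refine (integrableOn_exp_Iic 0).congr_fun (fun x hx => ?_) measurableSet_Iic
    simp only [abs_of_nonpos (show x ≤ 0 from hx), neg_neg]
  · refine (exp_neg_integrableOn_Ioi 0 one_pos).congr_fun (fun x hx => ?_) measurableSet_Ioi
    simp only [abs_of_pos (show 0 < x from hx), neg_mul, one_mul]

theorem exp_pow_mul_exp_neg_exp_le {n : ℕ} (hn : n ≠ 0) (a : ℝ) :
    Real.exp a ^ n * Real.exp (-Real.exp a) ≤ (n + 1).factorial * Real.exp (-|a|) := by
  set r := Real.exp a with hr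
  have hr0 : 0 < r := Real.exp_pos a
  have hfact : (1 : ℝ) ≤ (n + 1).factorial := by exact_mod_cast (n + 1).factorial_pos
  rcases le_total 0 a with ha | ha
  · have hpow := Real.pow_div_factorial_le_exp r hr0.le (n + 1)
    rw [abs_of_nonneg ha, Real.exp_neg, Real.exp_neg, ← hr, ← div_eq_mul_inv, ← div_eq_mul_inv,
      div_le_div_iff₀ (Real.exp_pos r) hr0, ← pow_succ]
    rwa [div_le_iff₀ (by positivity), mul_comm] at hpow
  · rw [abs_of_nonpos ha, neg_neg, ← hr]
    calc r ^ n * Real.exp (-r) ≤ r * 1 :=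
          mul_le_mul (pow_le_of_le_one hr0.le (Real.exp_le_one_iff.2 ha) hn)
            (Real.exp_le_one_iff.2 (neg_nonpos.2 hr0.le)) (Real.exp_pos _).le hr0.le
      _ ≤ (n + 1).factorial * r := by rw [mul_comm]; gcongr

theorem integral_exp_mul_comp_exp (g : ℝ → ℂ) :
    ∫ u : ℝ, (Real.exp u : ℂ) * g (Real.exp u) = ∫ k in Ioi (0 : ℝ), g k := by
  have := integral_image_eq_integral_abs_deriv_smul (f := Real.exp) MeasurableSet.univ
    (fun x _ => (Real.hasDerivAt_exp x).hasDerivWithinAt) Real.exp_injective.injOn g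
  rw [image_univ, Real.range_exp] at this
  simp [this, abs_of_pos (Real.exp_pos _)]

/-- An entire function that, in the sector `|arg k| ≤ π/6`, vanishes at the origin like `‖k‖` and
decays exponentially: the densities whose Stieltjes transforms have boundary values on the cut. -/
structure SectorDecay (φ : ℂ → ℂ) : Prop where
  differentiable : Differentiable ℂ φ
  exists_bound : ∃ K : ℝ, ∀ k : ℂ, |k.arg| ≤ π / 6 → ‖φ k‖ ≤ K * (‖k‖ * Real.exp (-‖k‖))

/-- The point `e^{u - iπ/6}` of the ray `arg k = -π/6`. -/
noncomputable def rayPoint (u : ℝ) : ℂ := Complex.exp (u + (-(π / 6) : ℝ) * I)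

/-- The Stieltjes transform with its path rotated to the ray `arg k = -π/6`, in the variable
`u = log |k|`. It no longer sees the cut from above, and so continues the transform from the open
to the closed upper half-plane. -/
noncomputable def rotatedStieltjes (φ : ℂ → ℂ) (z : ℂ) : ℂ :=
  ∫ u : ℝ, rayPoint u * (φ (rayPoint u) / (rayPoint u - z))

@[fun_prop]
theorem continuous_rayPoint : Continuous rayPoint := by
  unfold rayPoint
  fun_prop

theorem norm_rayPoint (u : ℝ) : ‖rayPoint u‖ = Real.exp u := by
  simp [rayPoint, Complex.norm_exp]

theorem half_exp_le_norm_rayPoint_sub {z : ℂ} (hz : 0 ≤ z.im) (u : ℝ) :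
    Real.exp u / 2 ≤ ‖rayPoint u - z‖ := by
  have him : (rayPoint u - z).im = -(Real.exp u / 2) - z.im := by
    have hexp : (u + (-(π / 6) : ℝ) * I : ℂ) = ⟨u, -(π / 6)⟩ := by apply Complex.ext <;> simp
    rw [Complex.sub_im, rayPoint, hexp, Complex.exp_im, Real.sin_neg, Real.sin_pi_div_six]
    ring
  have hpos := Real.exp_pos u
  refine le_trans ?_ (Complex.abs_im_le_norm _)
  rw [him, abs_of_neg (by linarith)]
  linarith

theorem im_le_norm_exp_sub {u : ℂ} (hlo : -(π / 6) ≤ u.im) (hup : u.im ≤ 0) (z : ℂ) :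
    z.im ≤ ‖Complex.exp u - z‖ := by
  have hsin : Real.sin u.im ≤ 0 :=
    Real.sin_nonpos_of_nonpos_of_neg_pi_le hup (by linarith [Real.pi_pos])
  have him : (Complex.exp u - z).im ≤ -z.im := by
    rw [Complex.sub_im, Complex.exp_im]
    linarith [mul_nonpos_of_nonneg_of_nonpos (Real.exp_pos u.re).le hsin]
  linarith [(neg_le_abs _).trans (Complex.abs_im_le_norm (Complex.exp u - z))]

section SectorDecay

variable {φ : ℂ → ℂ}

theorem SectorDecay.const_mul (h : SectorDecay φ) (a : ℂ) : SectorDecay fun k => a * φ k := by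
  obtain ⟨K, hK⟩ := h.exists_bound
  refine ⟨h.differentiable.const_mul a, ‖a‖ * K, fun k hk => ?_⟩
  rw [norm_mul, mul_assoc]
  gcongr
  exact hK k hk

theorem SectorDecay.sum {ι : Type*} (s : Finset ι) {φ : ι → ℂ → ℂ}
    (h : ∀ i ∈ s, SectorDecay (φ i)) : SectorDecay fun k => ∑ i ∈ s, φ i k := by
  choose! K hK using fun i hi => (h i hi).exists_bound
  refine ⟨Differentiable.fun_sum fun i hi => (h i hi).differentiable, ∑ i ∈ s, K i, fun k hk => ?_⟩
  rw [Finset.sum_mul]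
  exact (norm_sum_le _ _).trans (Finset.sum_le_sum fun i hi => hK i hi k hk)

theorem SectorDecay.continuous_ofReal (h : SectorDecay φ) : Continuous fun k : ℝ => φ k :=
  h.differentiable.continuous.comp Complex.continuous_ofReal

theorem SectorDecay.exists_nonneg_bound (h : SectorDecay φ) : ∃ K : ℝ, 0 ≤ K ∧
    ∀ k : ℂ, |k.arg| ≤ π / 6 → ‖φ k‖ ≤ K * (‖k‖ * Real.exp (-‖k‖)) := by
  obtain ⟨K, hK⟩ := h.exists_bound
  refine ⟨|K|, abs_nonneg K, fun k hk => (hK k hk).trans ?_⟩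
  gcongr
  exact le_abs_self K

theorem SectorDecay.integrableOn (h : SectorDecay φ) :
    IntegrableOn (fun k : ℝ => φ k) (Ioi 0) := by
  obtain ⟨K, hK⟩ := h.exists_bound
  have hmajorant : IntegrableOn (fun k : ℝ => K * (k * Real.exp (-k))) (Ioi 0) := by
    have := Real.GammaIntegral_convergent (s := 2) two_pos
    refine IntegrableOn.congr_fun (this.const_mul K) (fun k _ => ?_) measurableSet_Ioi
    rw [show (2 : ℝ) - 1 = 1 by norm_num, Real.rpow_one, mul_comm k]
  refine hmajorant.mono' h.continuous_ofReal.aestronglyMeasurable ?_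
  refine (ae_restrict_mem measurableSet_Ioi).mono fun k (hk : 0 < k) => ?_
  have := hK k (by rw [Complex.arg_ofReal_of_nonneg hk.le, abs_zero]; positivity)
  rwa [Complex.norm_of_nonneg hk.le] at this

theorem SectorDecay.exists_norm_exp_le (h : SectorDecay φ) : ∃ K : ℝ, 0 ≤ K ∧
    ∀ u : ℂ, -(π / 6) ≤ u.im → u.im ≤ 0 →
      ‖φ (Complex.exp u)‖ ≤ K * (Real.exp u.re * Real.exp (-Real.exp u.re)) := by
  obtain ⟨K, hK0, hK⟩ := h.exists_nonneg_bound
  refine ⟨K, hK0, fun u hlo hup => ?_⟩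
  have harg : (Complex.exp u).arg = u.im := by
    rw [← Complex.log_im, Complex.log_exp] <;> linarith [Real.pi_pos]
  have := hK (Complex.exp u) (by rw [harg, abs_of_nonpos hup]; linarith)
  rwa [Complex.norm_exp] at this

/-- Shifting the line `Im u = 0` to `Im u = -π/6` in the variable `u = log k`. -/
theorem SectorDecay.stieltjes_eq_rotated_of_norm_le (h : SectorDecay φ) {z : ℂ} {C : ℝ}
    (hne : ∀ u : ℂ, -(π / 6) ≤ u.im → u.im ≤ 0 → Complex.exp u ≠ z)
    (hC : ∀ u : ℂ, -(π / 6) ≤ u.im → u.im ≤ 0 →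
      ‖Complex.exp u * (φ (Complex.exp u) / (Complex.exp u - z))‖ ≤ C * Real.exp (-|u.re|)) :
    stieltjes (fun k => φ k) z = rotatedStieltjes φ z := by
  have hdecay : ∀ l : Filter ℝ, Tendsto (fun x : ℝ => |x|) l atTop →
      Tendsto (fun x : ℝ => C * Real.exp (-|x|)) l (𝓝 0) := fun l hl => by
    simpa using (Real.tendsto_exp_neg_atTop_nhds_zero.comp hl).const_mul C
  have hshift := integral_add_mul_I_eq_of_strip (a := -(π / 6)) (b := 0)
    (f := fun u => Complex.exp u * (φ (Complex.exp u) / (Complex.exp u - z)))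
    (by linarith [Real.pi_pos])
    (fun u hlo hup => Complex.differentiableAt_exp.mul
      ((h.differentiable.comp Complex.differentiable_exp u).div (by fun_prop)
        (sub_ne_zero.2 (hne u hlo hup))))
    hC (integrable_exp_neg_abs.const_mul C) (hdecay _ tendsto_abs_atTop_atTop)
    (hdecay _ tendsto_abs_atBot_atTop)
  rw [stieltjes, ← integral_exp_mul_comp_exp fun k => φ k / (k - z)]
  simpa [rotatedStieltjes, rayPoint] using hshift.symm

theorem SectorDecay.stieltjes_eq_rotated (h : SectorDecay φ) {z : ℂ} (hz : 0 < z.im) :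
    stieltjes (fun k => φ k) z = rotatedStieltjes φ z := by
  obtain ⟨K, hK0, hK⟩ := h.exists_norm_exp_le
  refine h.stieltjes_eq_rotated_of_norm_le (C := K * 6 / z.im) (fun u hlo hup hu => ?_)
    fun u hlo hup => ?_
  · have := im_le_norm_exp_sub hlo hup z
    simp only [hu, sub_self, norm_zero] at this
    linarith
  · have hsq := exp_pow_mul_exp_neg_exp_le two_ne_zero u.re
    norm_num [Nat.factorial] at hsq
    rw [norm_mul, norm_div, Complex.norm_exp]
    calc Real.exp u.re * (‖φ (Complex.exp u)‖ / ‖Complex.exp u - z‖)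
        ≤ Real.exp u.re * (K * (Real.exp u.re * Real.exp (-Real.exp u.re)) / z.im) := by
          gcongr
          · exact hK u hlo hup
          · exact im_le_norm_exp_sub hlo hup z
      _ = K * (Real.exp u.re ^ 2 * Real.exp (-Real.exp u.re)) / z.im := by ring
      _ ≤ K * (6 * Real.exp (-|u.re|)) / z.im := by gcongr
      _ = K * 6 / z.im * Real.exp (-|u.re|) := by ring

theorem SectorDecay.stieltjes_zero_eq_rotated (h : SectorDecay φ) :
    stieltjes (fun k => φ k) 0 = rotatedStieltjes φ 0 := by
  obtain ⟨K, hK0, hK⟩ := h.exists_norm_exp_le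
  refine h.stieltjes_eq_rotated_of_norm_le (C := K * 2) (fun u _ _ => Complex.exp_ne_zero u)
    fun u hlo hup => ?_
  have hpow := exp_pow_mul_exp_neg_exp_le one_ne_zero u.re
  norm_num at hpow
  rw [sub_zero, mul_div_cancel₀ _ (Complex.exp_ne_zero u), mul_assoc]
  exact (hK u hlo hup).trans (by gcongr)

theorem SectorDecay.exists_norm_rotated_integrand_le (h : SectorDecay φ) : ∃ C : ℝ,
    ∀ z : ℂ, 0 ≤ z.im → ∀ u : ℝ,
      ‖rayPoint u * (φ (rayPoint u) / (rayPoint u - z))‖ ≤ C * Real.exp (-|u|) := by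
  obtain ⟨K, hK0, hK⟩ := h.exists_norm_exp_le
  refine ⟨K * 4, fun z hz u => ?_⟩
  have hφ : ‖φ (rayPoint u)‖ ≤ K * (Real.exp u * Real.exp (-Real.exp u)) := by
    simpa [rayPoint] using hK (u + (-(π / 6) : ℝ) * I) (by simp)
      (by simpa using (by positivity : (0 : ℝ) ≤ π / 6))
  have hpow := exp_pow_mul_exp_neg_exp_le one_ne_zero u
  norm_num at hpow
  rw [norm_mul, norm_div, norm_rayPoint]
  calc Real.exp u * (‖φ (rayPoint u)‖ / ‖rayPoint u - z‖)
      ≤ Real.exp u * (K * (Real.exp u * Real.exp (-Real.exp u)) / (Real.exp u / 2)) := by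
        gcongr
        exact half_exp_le_norm_rayPoint_sub hz u
    _ = 2 * K * (Real.exp u * Real.exp (-Real.exp u)) := by field_simp
    _ ≤ 2 * K * (2 * Real.exp (-|u|)) := by gcongr
    _ = K * 4 * Real.exp (-|u|) := by ring

theorem SectorDecay.continuousOn_rotatedStieltjes (h : SectorDecay φ) :
    ContinuousOn (rotatedStieltjes φ) {z | 0 ≤ z.im} := by
  obtain ⟨C, hC⟩ := h.exists_norm_rotated_integrand_le
  have hφ := h.differentiable.continuous
  have hne : ∀ z : ℂ, 0 ≤ z.im → ∀ u, rayPoint u - z ≠ 0 := fun z hz u =>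
    norm_pos_iff.1 ((half_pos (Real.exp_pos u)).trans_le (half_exp_le_norm_rayPoint_sub hz u))
  refine continuousOn_of_dominated (bound := fun u => C * Real.exp (-|u|)) (fun z hz => ?_)
    (fun z hz => Eventually.of_forall (hC z hz)) (integrable_exp_neg_abs.const_mul C)
    (Eventually.of_forall fun u => ?_)
  · exact Continuous.aestronglyMeasurable
      (continuous_rayPoint.mul ((by fun_prop : Continuous fun u => φ (rayPoint u)).div
        (by fun_prop) (hne z hz)))
  · exact continuousOn_const.mul (continuousOn_const.div (by fun_prop) fun z hz => hne z hz u)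

theorem SectorDecay.tendsto_stieltjes_add_mul_I (h : SectorDecay φ) (x : ℝ) :
    Tendsto (fun ε : ℝ => stieltjes (fun k => φ k) (x + ε * I)) (𝓝[>] 0)
      (𝓝 (rotatedStieltjes φ x)) := by
  have hpath : Tendsto (fun ε : ℝ => (x + ε * I : ℂ)) (𝓝[>] 0) (𝓝[{z | 0 ≤ z.im}] x) := by
    refine tendsto_nhdsWithin_iff.2 ⟨?_, eventually_mem_nhdsWithin.mono fun ε hε => ?_⟩
    · exact (Continuous.tendsto' (by fun_prop) _ _ (by simp)).mono_left nhdsWithin_le_nhds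
    · simpa using (mem_Ioi.1 hε).le
  refine ((h.continuousOn_rotatedStieltjes x (by simp)).tendsto.comp hpath).congr' ?_
  filter_upwards [self_mem_nhdsWithin] with ε hε
  exact (h.stieltjes_eq_rotated (z := x + ε * I) (by simpa using hε)).symm

theorem SectorDecay.exists_norm_rotatedStieltjes_le (h : SectorDecay φ) :
    ∃ C, ∀ z : ℂ, 0 ≤ z.im → ‖rotatedStieltjes φ z‖ ≤ C := by
  obtain ⟨C, hC⟩ := h.exists_norm_rotated_integrand_le
  exact ⟨∫ u : ℝ, C * Real.exp (-|u|), fun z hz => norm_integral_le_of_norm_le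
    (integrable_exp_neg_abs.const_mul C) (Eventually.of_forall (hC z hz))⟩

end SectorDecay

/-! ### Cauchy's formula for the upper half-plane -/

/-- The filter of neighbourhoods of infinity in the open upper half-plane. -/
noncomputable def upperInfty : Filter ℂ := Bornology.cobounded ℂ ⊓ 𝓟 {z | 0 < z.im}

theorem eventually_upperInfty {p : ℂ → Prop} :
    (∀ᶠ z in upperInfty, p z) ↔ ∃ r, ∀ z : ℂ, r ≤ ‖z‖ → 0 < z.im → p z := by
  simp [upperInfty, eventually_inf_principal, hasBasis_cobounded_norm.eventually_iff]


section BoundaryDecay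

variable {f : ℂ → ℂ} {n : ℕ}

theorem isBigO_ofReal_of_isBigO_upperInfty (hf : ContinuousOn f {z | 0 ≤ z.im})
    (hO : f =O[upperInfty] fun z => z⁻¹ ^ n) :
    (fun x : ℝ => f x) =O[Bornology.cobounded ℝ] fun x => x⁻¹ ^ n := by
  obtain ⟨C, hC⟩ := hO.bound
  obtain ⟨r, hr⟩ := eventually_upperInfty.1 hC
  refine Asymptotics.IsBigO.of_bound C (hasBasis_cobounded_norm.eventually_iff.2
    ⟨max r 0 + 1, trivial, fun x (hx : max r 0 + 1 ≤ ‖x‖) => ?_⟩)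
  have hx0 : (x : ℂ) ≠ 0 := by
    rw [← norm_pos_iff, Complex.norm_real]
    linarith [le_max_right r 0]
  have hmem : (x : ℂ) ∈ closure {z : ℂ | 0 < z.im} := by
    rw [Complex.closure_setOfPred_lt_im]
    simp
  have := mem_closure_iff_nhdsWithin_neBot.1 hmem
  have hlim : Tendsto f (𝓝[{z | 0 < z.im}] (x : ℂ)) (𝓝 (f x)) :=
    (hf x (by simp)).mono_left (nhdsWithin_mono _ fun z (hz : 0 < z.im) => hz.le)
  have hbound : ContinuousAt (fun z : ℂ => C * ‖z⁻¹ ^ n‖) x := by fun_prop (disch := assumption)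
  have hfar : ∀ᶠ z in 𝓝[{z | 0 < z.im}] (x : ℂ), r ≤ ‖z‖ :=
    (continuous_norm.continuousAt.eventually_const_le (by
      change r < ‖(x : ℂ)‖
      rw [Complex.norm_real]; linarith [le_max_left r 0])).filter_mono nhdsWithin_le_nhds
  have := le_of_tendsto_of_tendsto hlim.norm (hbound.tendsto.mono_left nhdsWithin_le_nhds)
    (hfar.and self_mem_nhdsWithin |>.mono fun z hz => hr z hz.1 hz.2)
  simpa using this

end BoundaryDecay

theorem integrable_of_isBigO_inv_sq {f : ℝ → ℂ} (hf : Continuous f)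
    (hO : f =O[Bornology.cobounded ℝ] fun x => x⁻¹ ^ 2) : Integrable f := by
  refine hf.locallyIntegrable.integrable_of_isBigO_cocompact
    (g := fun x : ℝ => (1 + x ^ 2)⁻¹) ?_ (integrable_inv_one_add_sq.integrableAtFilter _)
  rw [← Metric.cobounded_eq_cocompact]
  refine hO.trans (Asymptotics.IsBigO.of_bound 2 (hasBasis_cobounded_norm.eventually_iff.2
    ⟨1, trivial, fun x (hx : 1 ≤ ‖x‖) => ?_⟩))
  have hx2 : 1 ≤ x ^ 2 := by simpa using hx
  rw [Real.norm_of_nonneg (by positivity), Real.norm_of_nonneg (by positivity), inv_pow,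
    ← div_eq_mul_inv, ← one_div, div_le_div_iff₀ (by linarith) (by linarith)]
  linarith

theorem tendsto_intervalIntegral_of_isBigO_upperInfty {f : ℂ → ℂ}
    (hf : f =O[upperInfty] fun z => z⁻¹ ^ 2) {γ : ℝ → ℝ → ℂ} {a b : ℝ → ℝ}
    (hγ : ∀ T > 0, ∀ y ∈ uIoc (a T) (b T), 0 < (γ T y).im ∧ T ≤ ‖γ T y‖)
    (hab : ∀ T > 0, |b T - a T| ≤ 2 * T) :
    Tendsto (fun T => ∫ y in a T..b T, f (γ T y)) atTop (𝓝 0) := by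
  obtain ⟨C, hC⟩ := hf.exists_nonneg
  obtain ⟨r, hr⟩ := eventually_upperInfty.1 hC.2.bound
  refine squeeze_zero_norm' (a := fun T => C * 2 * T⁻¹) ?_
    (by simpa using tendsto_inv_atTop_zero.const_mul (C * 2))
  filter_upwards [eventually_ge_atTop r, eventually_gt_atTop 0] with T hTr hT
  calc ‖∫ y in a T..b T, f (γ T y)‖ ≤ C * (T⁻¹) ^ 2 * |b T - a T| := by
        refine intervalIntegral.norm_integral_le_of_norm_le_const fun y hy => ?_
        obtain ⟨him, hle⟩ := hγ T hT y hy
        refine (hr _ (hTr.trans hle) him).trans ?_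
        rw [norm_pow, norm_inv]
        have := hC.1
        gcongr
    _ ≤ C * (T⁻¹) ^ 2 * (2 * T) := by
        have := hC.1
        gcongr
        exact hab T hT
    _ = C * 2 * T⁻¹ := by field_simp

section Cauchy

variable {f U : ℂ → ℂ} {z : ℂ}

theorem continuousOn_of_diffContOnCl_upper (hf : DiffContOnCl ℂ f {z | 0 < z.im}) :
    ContinuousOn f {z | 0 ≤ z.im} := by
  simpa only [Complex.closure_setOfPred_lt_im] using hf.continuousOn

theorem continuous_ofReal_of_diffContOnCl_upper (hf : DiffContOnCl ℂ f {z | 0 < z.im}) :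
    Continuous fun x : ℝ => f x :=
  (continuousOn_of_diffContOnCl_upper hf).comp_continuous Complex.continuous_ofReal fun _ => by simp

theorem integrable_ofReal_of_isBigO_upperInfty (hf : DiffContOnCl ℂ f {z | 0 < z.im})
    (hO : f =O[upperInfty] fun z => z⁻¹ ^ 2) : Integrable fun x : ℝ => f x :=
  integrable_of_isBigO_inv_sq (continuous_ofReal_of_diffContOnCl_upper hf)
    (isBigO_ofReal_of_isBigO_upperInfty (continuousOn_of_diffContOnCl_upper hf) hO)

theorem integral_ofReal_eq_zero_of_isBigO_upperInfty (hf : DiffContOnCl ℂ f {z | 0 < z.im})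
    (hO : f =O[upperInfty] fun z => z⁻¹ ^ 2) : ∫ x : ℝ, f x = 0 := by
  have hrect : ∀ᶠ T : ℝ in atTop,
      (∫ x in (-T)..T, f x) - (∫ x in (-T)..T, f (x + T * I))
        + I • (∫ y in 0..T, f (T + y * I)) - I • (∫ y in 0..T, f ((-T : ℝ) + y * I)) = 0 := by
    filter_upwards [eventually_gt_atTop 0] with T hT
    have := Complex.integral_boundary_rect_eq_zero_of_continuousOn_of_differentiableOn f
      ⟨-T, 0⟩ ⟨T, T⟩ ((continuousOn_of_diffContOnCl_upper hf).mono fun w hw => ?_)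
      (hf.differentiableOn.mono fun w hw => ?_)
    · simpa using this
    · have him : w.im ∈ uIcc 0 T := hw.2
      rw [uIcc_of_le hT.le] at him
      exact him.1
    · have him : w.im ∈ Ioo (min 0 T) (max 0 T) := hw.2
      rw [min_eq_left hT.le] at him
      exact him.1
  have hline := intervalIntegral_tendsto_integral (integrable_ofReal_of_isBigO_upperInfty hf hO)
    tendsto_neg_atTop_atBot tendsto_id
  have hlength : ∀ T : ℝ, T > 0 → |T - -T| ≤ 2 * T := fun T hT => by
    rw [abs_of_pos (by linarith)]; linarith
  have htop := tendsto_intervalIntegral_of_isBigO_upperInfty hO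
    (γ := fun T x => x + T * I) (a := fun T => -T) (b := fun T => T)
    (fun T hT x _ => ⟨by simpa using hT, by
      simpa [abs_of_pos hT] using Complex.abs_im_le_norm (x + T * I)⟩) hlength
  have hside : ∀ σ : ℝ, |σ| = 1 →
      Tendsto (fun T : ℝ => ∫ y in 0..T, f ((σ * T : ℝ) + y * I)) atTop (𝓝 0) := fun σ hσ =>
    tendsto_intervalIntegral_of_isBigO_upperInfty hO
      (γ := fun T y => (σ * T : ℝ) + y * I) (a := fun _ => 0) (b := fun T => T)
      (fun T hT y hy => ⟨by rw [uIoc_of_le hT.le] at hy; simpa using hy.1, by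
        simpa [abs_mul, hσ, abs_of_pos hT] using
          Complex.abs_re_le_norm ((σ * T : ℝ) + y * I)⟩)
      (fun T hT => by rw [sub_zero, abs_of_pos hT]; linarith)
  have hright := hside 1 abs_one
  have hleft := hside (-1) (by simp)
  simp only [one_mul, neg_one_mul] at hright hleft
  have hlim := ((hline.sub htop).add (hright.const_smul I)).sub (hleft.const_smul I)
  simpa using tendsto_nhds_unique (hlim.congr' hrect) tendsto_const_nhds

theorem isBigO_inv_sub_const (a : ℂ) (n : ℕ) :
    (fun z : ℂ => (z - a)⁻¹ ^ n) =O[Bornology.cobounded ℂ] fun z => z⁻¹ ^ n := by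
  refine (Asymptotics.IsBigO.of_bound 2 (hasBasis_cobounded_norm.eventually_iff.2
    ⟨2 * ‖a‖ + 1, trivial, fun w (hw : 2 * ‖a‖ + 1 ≤ ‖w‖) => ?_⟩)).pow n
  have htri := norm_sub_norm_le w a
  have ha := norm_nonneg a
  rw [norm_inv, norm_inv, ← div_eq_mul_inv, inv_eq_one_div, div_le_div_iff₀] <;> linarith

theorem ofReal_sub_ne_zero_of_im_ne_zero (hz : z.im ≠ 0) (x : ℝ) : (x - z : ℂ) ≠ 0 := fun h =>
  hz (by simp [← sub_eq_zero.1 h])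

theorem integrable_div_sub (hU : DiffContOnCl ℂ U {z | 0 < z.im})
    (hO : U =O[upperInfty] fun z => z⁻¹ ^ 1) (hz : z.im ≠ 0) :
    Integrable fun x : ℝ => U x / (x - z) := by
  refine integrable_of_isBigO_inv_sq ((continuous_ofReal_of_diffContOnCl_upper hU).div
    (by fun_prop) (ofReal_sub_ne_zero_of_im_ne_zero hz)) ?_
  have hker : (fun x : ℝ => (x - z : ℂ)⁻¹) =O[Bornology.cobounded ℝ] fun x => x⁻¹ := by
    refine (((isBigO_inv_sub_const z 1).comp_tendsto
      (tendsto_algebraMap_cobounded ℝ ℂ)).trans (Asymptotics.isBigO_of_le _ fun x => ?_)).congr_left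
      fun x => ?_ <;> simp
  simpa only [div_eq_mul_inv, pow_one, sq] using
    (isBigO_ofReal_of_isBigO_upperInfty (continuousOn_of_diffContOnCl_upper hU) hO).mul hker

theorem integral_div_sub_eq_zero (hU : DiffContOnCl ℂ U {z | 0 < z.im})
    (hO : U =O[upperInfty] fun z => z⁻¹ ^ 1) (hz : z.im < 0) : ∫ x : ℝ, U x / (x - z) = 0 := by
  have hne : ∀ w ∈ closure {w : ℂ | 0 < w.im}, w - z ≠ 0 := fun w hw h => by
    rw [Complex.closure_setOfPred_lt_im] at hw
    have : 0 ≤ w.im := hw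
    rw [sub_eq_zero.1 h] at this
    linarith
  refine integral_ofReal_eq_zero_of_isBigO_upperInfty (f := fun w => U w / (w - z)) ?_ ?_
  · have hinv : DiffContOnCl ℂ (fun w => (w - z)⁻¹) {w | 0 < w.im} :=
      (Differentiable.diffContOnCl (by fun_prop)).inv hne
    simpa only [div_eq_inv_mul, smul_eq_mul] using hinv.smul hU
  · simpa only [div_eq_mul_inv, pow_one, sq] using
      hO.mul ((isBigO_inv_sub_const z 1).mono inf_le_left)

theorem integral_poissonKernel (hz : 0 < z.im) :
    ∫ x : ℝ, (1 / (x - z) - 1 / (x - conj z)) = 2 * π * I := by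
  have hker : ∀ x : ℝ, 1 / (x - z) - 1 / (x - conj z) =
      (2 * π * I) * (ProbabilityTheory.cauchyPDFReal z.re z.im.toNNReal x : ℂ) := fun x => by
    have h1 := ofReal_sub_ne_zero_of_im_ne_zero hz.ne' x
    have h2 := ofReal_sub_ne_zero_of_im_ne_zero (z := conj z) (by simpa using hz.ne') x
    have hns : ((x - z.re) ^ 2 + z.im ^ 2 : ℂ) = (x - z) * (x - conj z) := by
      apply Complex.ext
      · simp [sq]
      · simp [sq]
        ring
    have hsub : z - conj z = 2 * z.im * I := by rw [Complex.sub_conj]; push_cast; ring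
    rw [ProbabilityTheory.cauchyPDFReal_def, Real.coe_toNNReal _ hz.le, div_sub_div _ _ h1 h2,
      show 1 * (x - conj z) - (x - z) * 1 = z - conj z by ring, hsub]
    push_cast
    rw [hns]
    field_simp
  simp_rw [hker]
  rw [integral_const_mul, integral_complex_ofReal,
    ProbabilityTheory.integral_cauchyPDFReal_eq_one _ (by simpa using hz), Complex.ofReal_one,
    mul_one]

theorem diffContOnCl_dslope (hU : DiffContOnCl ℂ U {z | 0 < z.im}) (hz : 0 < z.im) :
    DiffContOnCl ℂ (dslope U z) {z | 0 < z.im} := by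
  have hopen : IsOpen {w : ℂ | 0 < w.im} := isOpen_lt continuous_const Complex.continuous_im
  have hmem : {w : ℂ | 0 < w.im} ∈ 𝓝 z := hopen.mem_nhds hz
  exact ⟨(Complex.differentiableOn_dslope hmem).2 hU.differentiableOn,
    (continuousOn_dslope (mem_of_superset hmem subset_closure)).2
      ⟨hU.continuousOn, hU.differentiableOn.differentiableAt hmem⟩⟩

theorem isBigO_upperInfty_dslope (hO : U =O[upperInfty] fun z => z⁻¹ ^ 1) (z : ℂ) :
    dslope U z =O[upperInfty] fun z => z⁻¹ ^ 1 := by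
  have hone : (fun w : ℂ => w⁻¹ ^ 1) =O[upperInfty] fun _ => (1 : ℂ) := by
    have hinv : Tendsto (fun w : ℂ => w⁻¹) (Bornology.cobounded ℂ) (𝓝 0) :=
      tendsto_inv₀_cobounded
    simp only [pow_one]
    exact (hinv.isBigO_one ℂ).mono inf_le_left
  have hnum : (fun w => U w - U z) =O[upperInfty] fun _ => (1 : ℂ) :=
    (hO.trans hone).sub (Asymptotics.isBigO_const_const _ one_ne_zero _)
  refine (((isBigO_inv_sub_const z 1).mono inf_le_left).mul hnum).congr' ?_ (by simp)
  filter_upwards [eventually_upperInfty.2 ⟨‖z‖ + 1, fun w hw _ => (by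
    rintro rfl; linarith : w ≠ z)⟩] with w hw
  rw [dslope_of_ne _ hw, slope_def_field, pow_one, div_eq_inv_mul]

theorem integral_div_sub_eq (hU : DiffContOnCl ℂ U {z | 0 < z.im})
    (hO : U =O[upperInfty] fun z => z⁻¹ ^ 1) (hz : 0 < z.im) :
    ∫ x : ℝ, U x / (x - z) = 2 * π * I * U z := by
  have hzconj : (conj z).im < 0 := by simpa using hz
  have hD := diffContOnCl_dslope hU hz
  have hDO := isBigO_upperInfty_dslope hO z
  have hsplit : ∀ x : ℝ, U z * (1 / (x - z) - 1 / (x - conj z)) =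
      U x / (x - z) - U x / (x - conj z) - (z - conj z) * (dslope U z x / (x - conj z)) := by
    intro x
    have h1 := ofReal_sub_ne_zero_of_im_ne_zero hz.ne' x
    have h2 := ofReal_sub_ne_zero_of_im_ne_zero hzconj.ne x
    rw [dslope_of_ne _ (sub_ne_zero.1 h1), slope_def_field]
    field_simp
    ring
  have hsum : ∫ x : ℝ, U z * (1 / (x - z) - 1 / (x - conj z)) = ∫ x : ℝ, U x / (x - z) := by
    simp_rw [hsplit]
    rw [integral_sub (f := fun x : ℝ => U x / (x - z) - U x / (x - conj z))
        ((integrable_div_sub hU hO hz.ne').sub (integrable_div_sub hU hO hzconj.ne))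
        ((integrable_div_sub hD hDO hzconj.ne).const_mul _),
      integral_sub (integrable_div_sub hU hO hz.ne') (integrable_div_sub hU hO hzconj.ne),
      integral_const_mul, integral_div_sub_eq_zero hU hO hzconj,
      integral_div_sub_eq_zero hD hDO hzconj, mul_zero, sub_zero, sub_zero]
  rw [← hsum, integral_const_mul, integral_poissonKernel hz, mul_comm]

theorem eq_stieltjes_of_diffContOnCl {V : ℂ → ℂ} (hU : DiffContOnCl ℂ U {z | 0 < z.im})
    (hUO : U =O[upperInfty] fun z => z⁻¹ ^ 1) (hV : DiffContOnCl ℂ V {z | 0 < z.im})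
    (hVO : V =O[upperInfty] fun z => z⁻¹ ^ 1) (hjump : ∀ x : ℝ, x < 0 → U x = conj (V x))
    (hz : 0 < z.im) :
    2 * π * I * U z = stieltjes (fun x => U x - conj (V x)) z := by
  have hzconj : (conj z).im < 0 := by simpa using hz
  have hVconj : ∀ x : ℝ, conj (V x) / (x - z) = conj (V x / (x - conj z)) := fun x => by simp
  have hVint : Integrable fun x : ℝ => conj (V x) / (x - z) := by
    simp_rw [hVconj]
    exact (Complex.conjCLE : ℂ →L[ℝ] ℂ).integrable_comp (integrable_div_sub hV hVO hzconj.ne)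
  have hVzero : ∫ x : ℝ, conj (V x) / (x - z) = 0 := by
    simp_rw [hVconj]
    rw [integral_conj, integral_div_sub_eq_zero hV hVO hzconj, map_zero]
  calc 2 * π * I * U z = ∫ x : ℝ, (U x - conj (V x)) / (x - z) := by
        simp_rw [sub_div]
        rw [integral_sub (integrable_div_sub hU hUO hz.ne') hVint, hVzero, sub_zero,
          integral_div_sub_eq hU hUO hz]
    _ = ∫ x in Ici (0 : ℝ), (U x - conj (V x)) / (x - z) := by
        refine (setIntegral_eq_integral_of_forall_compl_eq_zero fun x hx => ?_).symm
        rw [hjump x (not_le.1 hx), sub_self, zero_div]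
    _ = stieltjes (fun x => U x - conj (V x)) z := integral_Ici_eq_integral_Ioi

end Cauchy

theorem exists_diffContOnCl_extension {U : ℂ → ℂ} {u : ℝ → ℂ}
    (hU : DifferentiableOn ℂ U {z | 0 < z.im})
    (hu : ∀ x : ℝ, Tendsto U (𝓝[{z | 0 < z.im}] (x : ℂ)) (𝓝 (u x))) :
    ∃ F : ℂ → ℂ, DiffContOnCl ℂ F {z | 0 < z.im} ∧ EqOn F U {z | 0 < z.im} ∧
      ∀ x : ℝ, F x = u x := by
  have hext : EqOn (extendFrom {z | 0 < z.im} U) U {z | 0 < z.im} :=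
    extendFrom_extends hU.continuousOn
  refine ⟨extendFrom {z | 0 < z.im} U, ⟨hU.congr hext, ?_⟩, hext, fun x => ?_⟩
  · refine continuousOn_extendFrom subset_rfl fun z hz => ?_
    rw [Complex.closure_setOfPred_lt_im] at hz
    rcases (show 0 ≤ z.im from hz).eq_or_lt with h | h
    · have hre : (z.re : ℂ) = z := Complex.ext rfl h
      exact ⟨u z.re, hre ▸ hu z.re⟩
    · exact ⟨U z, hU.continuousOn z h⟩
  · exact extendFrom_eq (by rw [Complex.closure_setOfPred_lt_im]; simp) (hu x)

/-! ### Simple poles -/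

section SimplePole

variable {f : ℂ → ℂ} {p r : ℂ}

theorem exists_tendsto_sub_mul_of_norm_le (hf : MeromorphicAt f p) {C : ℝ}
    (hC : ∀ᶠ ε : ℝ in 𝓝[>] 0, ‖f (p + ε * I)‖ ≤ C / ε) :
    ∃ r, Tendsto (fun y => (y - p) * f y) (𝓝[≠] p) (𝓝 r) := by
  have hmer : MeromorphicAt (fun y => (y - p) * f y) p := by fun_prop
  rw [tendsto_nhds_iff_meromorphicOrderAt_nonneg hmer, ← not_lt,
    ← tendsto_cobounded_iff_meromorphicOrderAt_neg hmer]
  intro hinf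
  have hpath : Tendsto (fun ε : ℝ => p + ε * I) (𝓝[>] 0) (𝓝[≠] p) := by
    refine tendsto_nhdsWithin_iff.2 ⟨?_, ?_⟩
    · have : Continuous fun ε : ℝ => p + ε * I := by fun_prop
      simpa using (this.tendsto 0).mono_left nhdsWithin_le_nhds
    · filter_upwards [self_mem_nhdsWithin] with ε hε
      simpa using (mem_Ioi.1 hε).ne'
  obtain ⟨ε, hlarge, hle, hε⟩ := ((tendsto_norm_cobounded_atTop.comp (hinf.comp hpath)
    |>.eventually_gt_atTop C).and (hC.and self_mem_nhdsWithin)).exists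
  have hε : 0 < ε := hε
  have : ε * ‖f (p + ε * I)‖ ≤ C := by rwa [le_div_iff₀' hε] at hle
  simp [abs_of_pos hε] at hlarge
  linarith

theorem exists_tendsto_sub_principal_part (hf : MeromorphicAt f p)
    (hr : Tendsto (fun y => (y - p) * f y) (𝓝[≠] p) (𝓝 r)) :
    ∃ v, Tendsto (fun y => f y - r / (y - p)) (𝓝[≠] p) (𝓝 v) := by
  have hmer : MeromorphicAt (fun y => f y - r / (y - p)) p := by fun_prop
  have hmul : Tendsto ((fun y => y - p) * fun y => f y - r / (y - p)) (𝓝[≠] p) (𝓝 0) := by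
    rw [← sub_self r]
    refine (hr.sub tendsto_const_nhds).congr' ?_
    filter_upwards [self_mem_nhdsWithin] with y hy
    have : y - p ≠ 0 := sub_ne_zero.2 hy
    simp [mul_sub, mul_div_cancel₀ _ this]
  have hid : MeromorphicAt (fun y => y - p) p := by fun_prop
  rw [tendsto_nhds_iff_meromorphicOrderAt_nonneg hmer]
  rw [tendsto_zero_iff_meromorphicOrderAt_pos (hid.mul hmer), meromorphicOrderAt_mul hid hmer,
    meromorphicOrderAt_id_sub_const] at hmul
  generalize meromorphicOrderAt (fun y => f y - r / (y - p)) p = n at hmul ⊢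
  cases n with
  | top => exact le_top
  | coe n =>
    norm_cast at hmul ⊢
    omega

theorem tendsto_circleIntegral_of_tendsto_sub_mul (hf : MeromorphicAt f p)
    (hr : Tendsto (fun y => (y - p) * f y) (𝓝[≠] p) (𝓝 r)) :
    Tendsto (fun ε : ℝ => (2 * π * I)⁻¹ * ∮ y in C(p, ε), f y) (𝓝[>] 0) (𝓝 r) := by
  obtain ⟨δ, hδ, hball⟩ := Metric.eventually_nhds_iff.1
    (eventually_nhdsWithin_iff.1 hf.eventually_analyticAt)
  refine tendsto_const_nhds.congr' ?_
  filter_upwards [Ioo_mem_nhdsGT hδ] with ε hε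
  have hdiff : ∀ y ∈ Metric.closedBall p ε \ {p},
      DifferentiableAt ℂ (fun y => (y - p) * f y) y := fun y hy =>
    (differentiableAt_id.sub_const p).mul
      (hball ((Metric.mem_closedBall.1 hy.1).trans_lt hε.2) hy.2).differentiableAt
  have hcauchy :=
    Complex.circleIntegral_sub_center_inv_smul_of_differentiable_on_off_countable_of_tendsto hε.1
      countable_empty (fun y hy => (hdiff y hy).continuousAt.continuousWithinAt)
      (fun y hy => hdiff y ⟨Metric.ball_subset_closedBall hy.1.1, hy.1.2⟩) hr
  rw [eq_inv_mul_iff_mul_eq₀ Complex.two_pi_I_ne_zero, ← smul_eq_mul, ← hcauchy]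
  refine circleIntegral.integral_congr hε.1.le fun y hy => ?_
  have : y - p ≠ 0 := sub_ne_zero.2 (Metric.ne_of_mem_sphere hy hε.1.ne')
  simp only [smul_eq_mul, inv_mul_cancel_left₀ this]

end SimplePole

/-! ### Laplace transforms and Volterra equations -/

section Laplace

variable {E : Type*} [NormedAddCommGroup E] [NormedSpace ℂ E]

/-- The Laplace transform `s ↦ ∫₀^∞ e^{-st} f(t) dt`. -/
noncomputable def laplace (f : ℝ → E) (s : ℂ) : E :=
  ∫ t in Ioi (0 : ℝ), Complex.exp (-(s * t)) • f t

theorem laplace_exp_smul (w : ℂ) (f : ℝ → E) (s : ℂ) :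
    laplace (fun t => Complex.exp (w * t) • f t) s = laplace f (s - w) := by
  refine integral_congr_ae (Eventually.of_forall fun t => ?_)
  simp only [smul_smul, ← Complex.exp_add]
  ring_nf

open FourierTransform in
/-- On the line `Re s = σ` the Laplace transform is the Fourier transform of
`1_{t > 0} e^{-σt} f(t)`. -/
theorem eq_zero_of_laplace_eq_zero [CompleteSpace E] {f : ℝ → E} {σ : ℝ}
    (hf : ContinuousOn f (Ioi 0))
    (hint : IntegrableOn (fun t : ℝ => Complex.exp (-(σ * t)) • f t) (Ioi 0))
    (hzero : ∀ τ : ℝ, laplace f (σ + τ * I) = 0) {t : ℝ} (ht : 0 < t) : f t = 0 := by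
  let F : ℝ → E := (Ioi (0 : ℝ)).indicator fun t => Complex.exp (-(σ * t)) • f t
  have hfourier : 𝓕 F = 0 := by
    ext w
    rw [Real.fourier_real_eq_integral_exp_smul, Pi.zero_apply, ← hzero (2 * π * w), laplace,
      ← integral_indicator measurableSet_Ioi]
    congr 1
    ext v
    simp only [F, indicator]
    split_ifs
    · rw [smul_smul, ← Complex.exp_add]
      congr 2
      push_cast
      ring
    · simp
  have hcont : ContinuousAt F t := by
    have : ContinuousAt (fun t : ℝ => Complex.exp (-(σ * t)) • f t) t :=
      (Continuous.continuousAt (by fun_prop)).smul (hf.continuousAt (Ioi_mem_nhds ht))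
    refine this.congr ?_
    filter_upwards [Ioi_mem_nhds ht] with v hv
    simp only [F, indicator_of_mem hv]
  have hinv : 𝓕⁻ (𝓕 F) t = F t :=
    ((integrable_indicator_iff measurableSet_Ioi).2 hint).fourierInv_fourier_eq
      (by rw [hfourier]; exact integrable_zero _ _ _) hcont
  have hFt : F t = 0 := by
    rw [← hinv, hfourier, Real.fourierInv_eq']
    simp
  simp only [F, indicator_of_mem (mem_Ioi.2 ht)] at hFt
  exact (smul_eq_zero.1 hFt).resolve_left (Complex.exp_ne_zero _)

theorem integrableOn_exp_neg_mul {s : ℂ} (hs : 0 < s.re) :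
    IntegrableOn (fun t : ℝ => Complex.exp (-(s * t))) (Ioi 0) := by
  simpa using integrableOn_exp_mul_complex_Ioi (a := -s) (by simpa using hs) 0

theorem integral_exp_neg_mul {s : ℂ} (hs : 0 < s.re) :
    ∫ t in Ioi (0 : ℝ), Complex.exp (-(s * t)) = s⁻¹ := by
  simpa using integral_exp_mul_complex_Ioi (a := -s) (by simpa using hs) 0

theorem norm_exp_neg_I_mul_mul (y t : ℝ) : ‖Complex.exp (-(I * y * t))‖ = 1 := by
  simp [Complex.norm_exp]

theorem laplace_integral_exp_eq_stieltjes {a : ℝ → ℂ} (ha : IntegrableOn a (Ioi 0)) {s : ℂ}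
    (hs : 0 < s.re) :
    laplace (fun t => ∫ y in Ioi (0 : ℝ), Complex.exp (-(I * y * t)) * a y) s =
      -I * stieltjes a (I * s) := by
  have hint : Integrable (Function.uncurry fun t y : ℝ =>
      Complex.exp (-(s * t)) * (Complex.exp (-(I * y * t)) * a y))
      ((volume.restrict (Ioi 0)).prod (volume.restrict (Ioi 0))) := by
    refine (((integrableOn_exp_neg_mul hs).mul_prod ha).bdd_mul (c := 1)
      (f := fun q : ℝ × ℝ => Complex.exp (-(I * q.2 * q.1)))
      (Continuous.aestronglyMeasurable (by fun_prop))
      (Eventually.of_forall fun q => (norm_exp_neg_I_mul_mul _ _).le)).congr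
      (Eventually.of_forall fun q => ?_)
    simp only [Function.uncurry]
    ring
  have hinner : ∀ y : ℝ, ∫ t in Ioi (0 : ℝ),
      Complex.exp (-(s * t)) * (Complex.exp (-(I * y * t)) * a y) = -I * (a y / (y - I * s)) := by
    intro y
    have hsplit : ∀ t : ℝ, Complex.exp (-(s * t)) * (Complex.exp (-(I * y * t)) * a y) =
        Complex.exp (-((s + I * y) * t)) * a y := fun t => by
      rw [← mul_assoc, ← Complex.exp_add]
      ring_nf
    have hfactor : y - I * s = -I * (s + I * y) := by linear_combination (y : ℂ) * Complex.I_sq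
    simp_rw [hsplit]
    rw [integral_mul_const, integral_exp_neg_mul (by simpa using hs), hfactor, ← mul_div_assoc,
      mul_div_mul_left _ _ (neg_ne_zero.2 Complex.I_ne_zero), inv_mul_eq_div]
  simp only [laplace, stieltjes, smul_eq_mul, ← integral_const_mul]
  rw [integral_integral_swap hint]
  simp_rw [hinner]

theorem norm_exp_neg_mul_smul_le {f : ℝ → E} {C σ t : ℝ} (hf : ‖f t‖ ≤ C * Real.exp (σ * t))
    (s : ℂ) : ‖Complex.exp (-(s * t)) • f t‖ ≤ C * Real.exp (-(s.re - σ) * t) := by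
  calc ‖Complex.exp (-(s * t)) • f t‖ ≤ Real.exp (-(s.re * t)) * (C * Real.exp (σ * t)) := by
        rw [norm_smul, Complex.norm_exp]
        simp only [Complex.neg_re, Complex.re_mul_ofReal]
        gcongr
    _ = C * Real.exp (-(s.re - σ) * t) := by
        rw [mul_left_comm, ← Real.exp_add]
        ring_nf

theorem integrableOn_exp_neg_mul_smul {f : ℝ → E} (hf : ContinuousOn f (Ioi 0)) {C σ : ℝ}
    (hC : ∀ t : ℝ, 0 < t → ‖f t‖ ≤ C * Real.exp (σ * t)) {s : ℂ} (hs : σ < s.re) :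
    IntegrableOn (fun t : ℝ => Complex.exp (-(s * t)) • f t) (Ioi 0) :=
  Integrable.mono' ((exp_neg_integrableOn_Ioi 0 (sub_pos.2 hs)).const_mul C)
    (ContinuousOn.aestronglyMeasurable ((Continuous.continuousOn (by fun_prop)).smul hf)
      measurableSet_Ioi)
    ((ae_restrict_mem measurableSet_Ioi).mono fun t ht => norm_exp_neg_mul_smul_le (hC t ht) s)

theorem tendsto_exp_neg_mul_smul {f : ℝ → E} {C σ : ℝ}
    (hC : ∀ t : ℝ, 0 < t → ‖f t‖ ≤ C * Real.exp (σ * t)) {s : ℂ} (hs : σ < s.re) :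
    Tendsto (fun t : ℝ => Complex.exp (-(s * t)) • f t) atTop (𝓝 0) := by
  refine squeeze_zero_norm' ((eventually_gt_atTop 0).mono fun t ht =>
    norm_exp_neg_mul_smul_le (hC t ht) s) ?_
  simpa [neg_mul, -neg_sub] using (Real.tendsto_exp_neg_atTop_nhds_zero.comp
    (tendsto_id.const_mul_atTop (sub_pos.2 hs))).const_mul C

theorem laplace_of_hasDerivAt [CompleteSpace E] {f f' : ℝ → E} (hf : ContinuousOn f (Ici 0))
    (hderiv : ∀ t, 0 < t → HasDerivAt f (f' t) t) {C σ : ℝ}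
    (hC : ∀ t, 0 < t → ‖f t‖ ≤ C * Real.exp (σ * t)) {s : ℂ} (hs : σ < s.re)
    (hf' : IntegrableOn (fun t : ℝ => Complex.exp (-(s * t)) • f' t) (Ioi 0)) :
    laplace f' s = s • laplace f s - f 0 := by
  have hexp : ∀ t : ℝ, HasDerivAt (fun t : ℝ => Complex.exp (-(s * t)))
      (-(s * Complex.exp (-(s * t)))) t := fun t => by
    simpa [mul_comm] using ((Complex.ofRealCLM.hasDerivAt (x := t)).const_mul s).neg.cexp
  have hprod : ∀ t ∈ Ioi (0 : ℝ), HasDerivAt (fun t : ℝ => Complex.exp (-(s * t)) • f t)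
      (Complex.exp (-(s * t)) • f' t - s • (Complex.exp (-(s * t)) • f t)) t := fun t ht => by
    refine ((hexp t).smul (hderiv t ht)).congr_deriv ?_
    rw [neg_smul, smul_smul, sub_eq_add_neg]
  have hcont : ContinuousWithinAt (fun t : ℝ => Complex.exp (-(s * t)) • f t) (Ici 0) 0 :=
    (Continuous.continuousWithinAt (by fun_prop)).smul (hf 0 self_mem_Ici)
  have hint : IntegrableOn (fun t : ℝ => s • (Complex.exp (-(s * t)) • f t)) (Ioi 0) :=
    (integrableOn_exp_neg_mul_smul (hf.mono Ioi_subset_Ici_self) hC hs).smul s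
  have hftc := integral_Ioi_of_hasDerivAt_of_tendsto hcont hprod (hf'.sub hint)
    (tendsto_exp_neg_mul_smul hC hs)
  rw [integral_sub hf' hint, integral_smul, Complex.ofReal_zero, mul_zero, neg_zero,
    Complex.exp_zero, one_smul, zero_sub] at hftc
  rw [sub_eq_add_neg, ← hftc, laplace, laplace]
  abel

theorem norm_le_exp_of_norm_deriv_le {F : Type*} [NormedAddCommGroup F] [NormedSpace ℝ F]
    {f f' : ℝ → F} {K : ℝ} (hf : ContinuousWithinAt f (Ici 0) 0)
    (hderiv : ∀ t, 0 < t → HasDerivAt f (f' t) t) (hK : ∀ t, 0 < t → ‖f' t‖ ≤ K * ‖f t‖)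
    {t : ℝ} (ht : 0 ≤ t) : ‖f t‖ ≤ ‖f 0‖ * Real.exp (K * t) := by
  rcases ht.eq_or_lt with rfl | hpos
  · simp
  have hgronwall : ∀ a ∈ Ioo 0 t, ‖f t‖ ≤ ‖f a‖ * Real.exp (K * (t - a)) := fun a ha => by
    rw [← gronwallBound_ε0]
    refine norm_le_gronwallBound_of_norm_deriv_right_le (f' := f')
      (fun x hx => (hderiv x (ha.1.trans_le hx.1)).continuousAt.continuousWithinAt)
      (fun x hx => (hderiv x (ha.1.trans_le hx.1)).hasDerivWithinAt) le_rfl (fun x hx => ?_) t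
      ⟨ha.2.le, le_rfl⟩
    rw [add_zero]
    exact hK x (ha.1.trans_le hx.1)
  have hlim : Tendsto (fun a => ‖f a‖ * Real.exp (K * (t - a))) (𝓝[>] 0)
      (𝓝 (‖f 0‖ * Real.exp (K * (t - 0)))) :=
    (hf.mono Ioi_subset_Ici_self).norm.mul (Continuous.continuousWithinAt (by fun_prop))
  rw [sub_zero] at hlim
  exact ge_of_tendsto hlim (mem_of_superset (Ioo_mem_nhdsGT hpos) hgronwall)

end Laplace

section Volterra

variable {E : Type*} [NormedAddCommGroup E] [NormedSpace ℂ E]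
  {κ : ℝ → E →L[ℂ] E} {β : ℝ → E} {M : ℝ}

theorem norm_integral_volterra_le (hβ : ContinuousOn β (Ici 0))
    (hM : ∀ t, 0 ≤ t → ‖κ t‖ ≤ M) {t : ℝ} (ht : 0 ≤ t) :
    ‖∫ τ in 0..t, κ (t - τ) (β τ)‖ ≤ M * ∫ τ in 0..t, ‖β τ‖ := by
  have hint : IntervalIntegrable (fun τ => ‖β τ‖) volume 0 t :=
    (hβ.norm.mono (by rw [uIcc_of_le ht]; exact Icc_subset_Ici_self)).intervalIntegrable
  rw [← intervalIntegral.integral_const_mul]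
  refine intervalIntegral.norm_integral_le_of_norm_le ht
    (Eventually.of_forall fun τ hτ => ?_) (hint.const_mul M)
  exact (κ (t - τ)).le_of_opNorm_le (hM _ (sub_nonneg.2 hτ.2)) _

/-- Grönwall's inequality for the pair of `β` and `∫ ‖β‖`. -/
theorem norm_le_exp_of_volterra (hβ : ContinuousOn β (Ici 0)) (hM : ∀ t, 0 ≤ t → ‖κ t‖ ≤ M)
    (hderiv : ∀ t, 0 < t → HasDerivAt β (-∫ τ in 0..t, κ (t - τ) (β τ)) t) {t : ℝ}
    (ht : 0 ≤ t) : ‖β t‖ ≤ ‖β 0‖ * Real.exp (max M 1 * t) := by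
  set φ : ℝ → ℝ := fun t => ∫ τ in 0..t, ‖β τ‖ with hφdef
  have hint : ∀ t, 0 ≤ t → IntegrableOn (fun τ => ‖β τ‖) (uIcc 0 t) := fun t ht =>
    (hβ.norm.mono (by rw [uIcc_of_le ht]; exact Icc_subset_Ici_self)).integrableOn_compact
      isCompact_uIcc
  have hφ : ∀ t, 0 < t → HasDerivAt φ ‖β t‖ t := fun t ht =>
    intervalIntegral.integral_hasDerivAt_right (hint t ht.le).intervalIntegrable
      ((hβ.norm.mono Ioi_subset_Ici_self).stronglyMeasurableAtFilter isOpen_Ioi t ht)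
      (hβ.norm.continuousAt (Ici_mem_nhds ht))
  have hφ0 : ContinuousWithinAt φ (Ici 0) 0 :=
    (intervalIntegral.continuousOn_primitive_interval (hint 1 zero_le_one) 0
      left_mem_uIcc).mono_of_mem_nhdsWithin (by
        rw [uIcc_of_le zero_le_one]; exact Icc_mem_nhdsGE zero_lt_one)
  have hM0 : 0 ≤ M := (norm_nonneg _).trans (hM 0 le_rfl)
  have hpair := norm_le_exp_of_norm_deriv_le (f := fun t => (β t, φ t)) (K := max M 1)
    ((hβ 0 self_mem_Ici).prodMk hφ0) (fun t ht => (hderiv t ht).prodMk (hφ t ht))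
    (fun t ht => ?_) ht
  · refine (norm_fst_le (β t, φ t)).trans (hpair.trans_eq ?_)
    simp [hφdef, Prod.norm_mk]
  rw [Prod.norm_mk, norm_norm, norm_neg]
  refine max_le ?_ ?_
  · calc _ ≤ M * φ t := norm_integral_volterra_le hβ hM ht.le
      _ ≤ M * ‖(β t, φ t)‖ := by
        gcongr
        exact (le_abs_self (φ t)).trans (norm_snd_le (β t, φ t))
      _ ≤ max M 1 * ‖(β t, φ t)‖ := by gcongr; exact le_max_left _ _
  · calc ‖β t‖ ≤ 1 * ‖(β t, φ t)‖ := by rw [one_mul]; exact norm_fst_le (β t, φ t)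
      _ ≤ max M 1 * ‖(β t, φ t)‖ := by gcongr; exact le_max_right _ _

theorem laplace_integral_convolution [CompleteSpace E] {s : ℂ}
    (hβ : IntegrableOn (fun t : ℝ => Complex.exp (-(s * t)) • β t) (Ioi 0))
    (hκ : IntegrableOn (fun t : ℝ => Complex.exp (-(s * t)) • κ t) (Ioi 0)) :
    IntegrableOn (fun t : ℝ => Complex.exp (-(s * t)) • ∫ τ in 0..t, κ (t - τ) (β τ)) (Ioi 0) ∧
      laplace (fun t => ∫ τ in 0..t, κ (t - τ) (β τ)) s = laplace κ s (laplace β s) := by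
  set L : E →L[ℝ] (E →L[ℂ] E) →L[ℝ] E :=
    (ContinuousLinearMap.apply ℂ E (E := E)).bilinearRestrictScalars ℝ
  have hexp : ∀ t τ : ℝ, L (Complex.exp (-(s * τ)) • β τ)
      (Complex.exp (-(s * ((t - τ : ℝ) : ℂ))) • κ (t - τ)) =
      Complex.exp (-(s * t)) • κ (t - τ) (β τ) := fun t τ => by
    have hadd : Complex.exp (-(s * t)) =
        Complex.exp (-(s * ((t - τ : ℝ) : ℂ))) * Complex.exp (-(s * τ)) := by
      rw [← Complex.exp_add]; congr 1; push_cast; ring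
    simp [L, hadd, smul_smul]
  have hconv : ∀ t : ℝ, ∫ τ in (0 : ℝ)..t, L (Complex.exp (-(s * τ)) • β τ)
      (Complex.exp (-(s * ((t - τ : ℝ) : ℂ))) • κ (t - τ)) =
      Complex.exp (-(s * t)) • ∫ τ in (0 : ℝ)..t, κ (t - τ) (β τ) := fun t => by
    simp_rw [hexp, intervalIntegral.integral_smul]
  have hint := integrable_posConvolution hβ hκ L
  have hlaplace := integral_posConvolution hβ hκ L
  rw [posConvolution, integrable_indicator_iff measurableSet_Ioi] at hint
  simp only [hconv] at hint hlaplace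
  exact ⟨hint, hlaplace⟩

theorem laplace_volterra [CompleteSpace E] (hβ : ContinuousOn β (Ici 0))
    (hκ : ContinuousOn κ (Ici 0)) (hM : ∀ t, 0 ≤ t → ‖κ t‖ ≤ M)
    (hderiv : ∀ t, 0 < t → HasDerivAt β (-∫ τ in 0..t, κ (t - τ) (β τ)) t)
    {C σ : ℝ} (hσ : 0 ≤ σ) (hC : ∀ t, 0 ≤ t → ‖β t‖ ≤ C * Real.exp (σ * t))
    {s : ℂ} (hs : σ < s.re) : s • laplace β s + laplace κ s (laplace β s) = β 0 := by
  obtain ⟨hint, hconv⟩ := laplace_integral_convolution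
    (integrableOn_exp_neg_mul_smul (hβ.mono Ioi_subset_Ici_self) (fun t ht => hC t ht.le) hs)
    (integrableOn_exp_neg_mul_smul (hκ.mono Ioi_subset_Ici_self) (C := M) (σ := 0)
      (fun t ht => by simpa using hM t ht.le) (hσ.trans_lt hs))
  have hlaplace := laplace_of_hasDerivAt hβ hderiv (fun t ht => hC t ht.le) hs
    (by simp only [smul_neg]; exact hint.neg)
  have hneg : laplace (fun t => -∫ τ in 0..t, κ (t - τ) (β τ)) s =
      -laplace κ s (laplace β s) := by
    rw [← hconv]
    simp only [laplace, smul_neg, integral_neg]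
  rw [hneg, eq_sub_iff_add_eq, neg_add_eq_iff_eq_add] at hlaplace
  rw [hlaplace, add_comm]

end Volterra

/-! ### The Feshbach matrix -/

section Matrix

variable {ι : Type*} [Fintype ι]

theorem dotProduct_mulVec_eq_sum (A : Matrix ι ι ℂ) (u v : ι → ℂ) :
    u ⬝ᵥ A *ᵥ v = ∑ j, ∑ l, u j * v l * A j l := by
  simp only [dotProduct, Matrix.mulVec, Finset.mul_sum]
  exact Finset.sum_congr rfl fun j _ => Finset.sum_congr rfl fun l _ => by ring

theorem star_dotProduct_self (v : ι → ℂ) :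
    star v ⬝ᵥ v = ((‖WithLp.toLp 2 v‖ ^ 2 : ℝ) : ℂ) := by
  simp [EuclideanSpace.norm_sq_eq, dotProduct, Complex.conj_mul']

variable [DecidableEq ι] {A : Matrix ι ι ℂ}

theorem det_ne_zero_of_le_norm_form {δ : ℝ} (hδ : 0 < δ)
    (hA : ∀ v, δ * ‖WithLp.toLp 2 v‖ ^ 2 ≤ ‖star v ⬝ᵥ A *ᵥ v‖) : A.det ≠ 0 := by
  intro hdet
  obtain ⟨v, hv, hAv⟩ := Matrix.exists_mulVec_eq_zero_iff.2 hdet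
  have hle := hA v
  rw [hAv, dotProduct_zero, norm_zero] at hle
  have : 0 < ‖WithLp.toLp 2 v‖ := by simpa using hv
  exact hle.not_gt (by positivity)

theorem norm_inv_apply_le_of_le_norm_form {δ : ℝ} (hδ : 0 < δ)
    (hA : ∀ v, δ * ‖WithLp.toLp 2 v‖ ^ 2 ≤ ‖star v ⬝ᵥ A *ᵥ v‖) (j l : ι) :
    ‖A⁻¹ j l‖ ≤ 1 / δ := by
  have hmul : A * A⁻¹ = 1 :=
    Matrix.mul_nonsing_inv A (isUnit_iff_ne_zero.2 (det_ne_zero_of_le_norm_form hδ hA))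
  set u : ι → ℂ := A⁻¹ *ᵥ Pi.single l 1 with hu
  have hAu : A *ᵥ u = Pi.single l 1 := by rw [hu, Matrix.mulVec_mulVec, hmul, Matrix.one_mulVec]
  have hcoord : ∀ i, ‖u i‖ ≤ ‖WithLp.toLp 2 u‖ := PiLp.norm_apply_le (WithLp.toLp 2 u)
  have hquad := hA u
  rw [hAu, dotProduct_single_one, Pi.star_apply, norm_star] at hquad
  have hnorm : δ * ‖WithLp.toLp 2 u‖ ≤ 1 := by
    rcases (norm_nonneg (WithLp.toLp 2 u)).eq_or_lt with h0 | hpos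
    · rw [← h0, mul_zero]; exact zero_le_one
    · exact le_of_mul_le_mul_right (by linarith [hcoord l]) hpos
  have huj : u j = A⁻¹ j l := by simp [hu]
  rw [← huj, le_div_iff₀ hδ, mul_comm]
  exact (mul_le_mul_of_nonneg_left (hcoord j) hδ.le).trans hnorm

theorem continuousAt_matrix_inv_of_det_ne_zero (hA : A.det ≠ 0) :
    ContinuousAt (fun B : Matrix ι ι ℂ => B⁻¹) A :=
  continuousAt_matrix_inv A (by simpa using continuousAt_inv₀ hA)

end Matrix

section Feshbach

variable {ι : Type*} {W : ℂ → Matrix ι ι ℂ} {Ω : ℝ}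

/-- A matrix-valued spectral density of a coupling to a continuum: positive definite on the
positive half-line, with entries that continue analytically and decay in a sector around it. -/
structure IsSpectralDensity (W : ℂ → Matrix ι ι ℂ) : Prop where
  sectorDecay : ∀ j l, SectorDecay fun k => W k j l
  posDef : ∀ k : ℝ, 0 < k → (W k).PosDef

namespace IsSpectralDensity

theorem stieltjes_conj_apply (h : IsSpectralDensity W) (z : ℂ) (j l : ι) :
    stieltjes (fun k => W k j l) (conj z) = conj (stieltjes (fun k => W k l j) z) := by
  rw [stieltjes_conj]
  congr 1
  exact setIntegral_congr_fun measurableSet_Ioi fun k hk => by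
    simp only [← (h.posDef k hk).isHermitian.apply j l, Complex.star_def, Complex.conj_conj]

variable [Fintype ι]

theorem sectorDecay_form (h : IsSpectralDensity W) (u v : ι → ℂ) :
    SectorDecay fun k => u ⬝ᵥ W k *ᵥ v := by
  simp only [dotProduct_mulVec_eq_sum]
  exact .sum _ fun j _ => .sum _ fun l _ => (h.sectorDecay j l).const_mul _

theorem form_nonneg (h : IsSpectralDensity W) (v : ι → ℂ) {k : ℝ} (hk : 0 < k) :
    0 ≤ (star v ⬝ᵥ W k *ᵥ v).re :=
  (Complex.nonneg_iff.1 ((h.posDef k hk).posSemidef.dotProduct_mulVec_nonneg v)).1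

theorem ofReal_form (h : IsSpectralDensity W) (v : ι → ℂ) {k : ℝ} (hk : 0 < k) :
    (((star v ⬝ᵥ W k *ᵥ v).re : ℝ) : ℂ) = star v ⬝ᵥ W k *ᵥ v :=
  (Complex.eq_re_of_ofReal_le ((h.posDef k hk).posSemidef.dotProduct_mulVec_nonneg v)).symm

theorem integrableOn_form (h : IsSpectralDensity W) (v : ι → ℂ) :
    IntegrableOn (fun k : ℝ => (star v ⬝ᵥ W k *ᵥ v).re) (Ioi 0) :=
  (h.sectorDecay_form (star v) v).integrableOn.re

end IsSpectralDensity

variable [DecidableEq ι]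

/-- The Feshbach matrix `M(z) = Ω - z - ∫₀^∞ W(k)/(k - z) dk`, whose inverse is the compression to
the discrete levels of the resolvent at `z` of a Friedrichs model with levels `Ω`. -/
noncomputable def feshbach (Ω : ℝ) (W : ℂ → Matrix ι ι ℂ) (z : ℂ) : Matrix ι ι ℂ :=
  ((Ω : ℂ) - z) • 1 - Matrix.of fun j l => stieltjes (fun k => W k j l) z

/-- The continuation `M₊` of the Feshbach matrix from the open to the closed upper half-plane. -/
noncomputable def feshbachUpper (Ω : ℝ) (W : ℂ → Matrix ι ι ℂ) (z : ℂ) : Matrix ι ι ℂ :=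
  ((Ω : ℂ) - z) • 1 - Matrix.of fun j l => rotatedStieltjes (fun k => W k j l) z

namespace IsSpectralDensity

theorem feshbachUpper_eq (h : IsSpectralDensity W) {z : ℂ} (hz : 0 < z.im) :
    feshbachUpper Ω W z = feshbach Ω W z := by
  simp only [feshbach, feshbachUpper, fun j l => (h.sectorDecay j l).stieltjes_eq_rotated hz]

theorem feshbachUpper_zero (h : IsSpectralDensity W) :
    feshbachUpper Ω W 0 = feshbach Ω W 0 := by
  simp only [feshbach, feshbachUpper, fun j l => (h.sectorDecay j l).stieltjes_zero_eq_rotated]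

theorem differentiableAt_feshbach_apply (h : IsSpectralDensity W) {z : ℂ}
    (hz : -z ∈ Complex.slitPlane) (j l : ι) :
    DifferentiableAt ℂ (fun z => feshbach Ω W z j l) z := by
  have := differentiableAt_stieltjes (h.sectorDecay j l).integrableOn hz
  simp only [feshbach, Matrix.sub_apply, Matrix.smul_apply, Matrix.of_apply, smul_eq_mul]
  fun_prop

theorem continuousOn_feshbachUpper (h : IsSpectralDensity W) :
    ContinuousOn (feshbachUpper Ω W) {z | 0 ≤ z.im} := by
  refine (Continuous.continuousOn (by fun_prop)).sub ?_
  exact continuousOn_pi.2 fun j => continuousOn_pi.2 fun l =>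
    (h.sectorDecay j l).continuousOn_rotatedStieltjes

theorem feshbach_conj (h : IsSpectralDensity W) (z : ℂ) :
    feshbach Ω W (conj z) = (feshbach Ω W z)ᴴ := by
  ext j l
  by_cases hjl : j = l
  · simp [feshbach, h.stieltjes_conj_apply, hjl]
  · simp [feshbach, h.stieltjes_conj_apply, hjl, Ne.symm hjl]

theorem tendsto_feshbach_add_mul_I (h : IsSpectralDensity W) (x : ℝ) :
    Tendsto (fun ε : ℝ => feshbach Ω W (x + ε * I)) (𝓝[>] 0) (𝓝 (feshbachUpper Ω W x)) := by
  refine Tendsto.sub (Tendsto.mono_left (Continuous.tendsto' (by fun_prop) _ _ (by simp))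
    nhdsWithin_le_nhds) ?_
  exact tendsto_pi_nhds.2 fun j => tendsto_pi_nhds.2 fun l =>
    (h.sectorDecay j l).tendsto_stieltjes_add_mul_I x

variable [Fintype ι]

theorem inv_feshbach_conj (h : IsSpectralDensity W) (z : ℂ) :
    (feshbach Ω W (conj z))⁻¹ = ((feshbach Ω W z)⁻¹)ᴴ := by
  rw [h.feshbach_conj, Matrix.conjTranspose_nonsing_inv]

theorem dotProduct_feshbach_mulVec (h : IsSpectralDensity W) (u v : ι → ℂ) {z : ℂ}
    (hz : -z ∈ Complex.slitPlane) : u ⬝ᵥ feshbach Ω W z *ᵥ v =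
      (Ω - z) * (u ⬝ᵥ v) - stieltjes (fun k => u ⬝ᵥ W k *ᵥ v) z := by
  have hint : ∀ j l, IntegrableOn (fun k : ℝ => u j * v l * (W k j l / (k - z))) (Ioi 0) :=
    fun j l => (integrableOn_div_sub (h.sectorDecay j l).integrableOn hz).const_mul _
  rw [feshbach, Matrix.sub_mulVec, Matrix.smul_mulVec, Matrix.one_mulVec, dotProduct_sub,
    dotProduct_smul, smul_eq_mul, dotProduct_mulVec_eq_sum, sub_right_inj]
  simp only [dotProduct_mulVec_eq_sum, Matrix.of_apply, stieltjes, Finset.sum_div, mul_div_assoc]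
  rw [integral_finsetSum _ fun j _ => integrable_finsetSum _ fun l _ => hint j l]
  simp_rw [integral_finsetSum _ fun l _ => hint _ l, integral_const_mul]

theorem form_feshbach (h : IsSpectralDensity W) (v : ι → ℂ) {z : ℂ}
    (hz : -z ∈ Complex.slitPlane) : star v ⬝ᵥ feshbach Ω W z *ᵥ v =
      (Ω - z) * ((‖WithLp.toLp 2 v‖ ^ 2 : ℝ) : ℂ) -
        stieltjes (fun k => ((star v ⬝ᵥ W k *ᵥ v).re : ℂ)) z := by
  rw [h.dotProduct_feshbach_mulVec _ _ hz, star_dotProduct_self, sub_right_inj]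
  exact setIntegral_congr_fun measurableSet_Ioi fun k hk => by simp only [h.ofReal_form v hk]

theorem im_form_feshbach (h : IsSpectralDensity W) (v : ι → ℂ) {z : ℂ}
    (hz : -z ∈ Complex.slitPlane) : (star v ⬝ᵥ feshbach Ω W z *ᵥ v).im =
      -(z.im * ‖WithLp.toLp 2 v‖ ^ 2) -
        (stieltjes (fun k => ((star v ⬝ᵥ W k *ᵥ v).re : ℂ)) z).im := by
  simp only [h.form_feshbach v hz, Complex.sub_im, Complex.im_mul_ofReal, Complex.ofReal_im,
    zero_sub, neg_mul]

theorem le_norm_form_feshbach (h : IsSpectralDensity W) {z : ℂ} (hz : z.im ≠ 0) (v : ι → ℂ) :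
    |z.im| * ‖WithLp.toLp 2 v‖ ^ 2 ≤ ‖star v ⬝ᵥ feshbach Ω W z *ᵥ v‖ := by
  have hslit := neg_mem_slitPlane_of_im_ne_zero hz
  have him := h.im_form_feshbach (Ω := Ω) v hslit
  have hnonneg := mul_im_stieltjes_ofReal_nonneg (h.integrableOn_form v)
    (fun k hk => h.form_nonneg v hk) hslit
  refine le_trans ?_ (Complex.abs_im_le_norm _)
  refine le_of_mul_le_mul_left ?_ (abs_pos.2 hz)
  rw [← abs_mul, ← mul_assoc, abs_mul_abs_self, him]
  refine le_trans ?_ (neg_le_abs _)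
  linarith

theorem det_feshbach_ne_zero (h : IsSpectralDensity W) {z : ℂ} (hz : z.im ≠ 0) :
    (feshbach Ω W z).det ≠ 0 :=
  det_ne_zero_of_le_norm_form (abs_pos.2 hz) (h.le_norm_form_feshbach hz)

theorem norm_inv_feshbach_apply_le (h : IsSpectralDensity W) {z : ℂ} (hz : z.im ≠ 0) (j l : ι) :
    ‖(feshbach Ω W z)⁻¹ j l‖ ≤ 1 / |z.im| :=
  norm_inv_apply_le_of_le_norm_form (abs_pos.2 hz) (h.le_norm_form_feshbach hz) j l

theorem det_feshbachUpper_ne_zero (h : IsSpectralDensity W) {x : ℝ} (hx : 0 < x) :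
    (feshbachUpper Ω W x).det ≠ 0 := by
  intro hdet
  obtain ⟨v, hv, hMv⟩ := Matrix.exists_mulVec_eq_zero_iff.2 hdet
  set ρ : ℝ → ℝ := fun k => (star v ⬝ᵥ W k *ᵥ v).re
  obtain ⟨k₀, hk₀, hmin⟩ := isCompact_Icc.exists_isMinOn
    (nonempty_Icc.2 (le_add_of_nonneg_right zero_le_one : x ≤ x + 1))
    (Complex.continuous_re.comp (h.sectorDecay_form (star v) v).continuous_ofReal).continuousOn
  have hρ₀ : 0 < ρ k₀ := (Complex.pos_iff.1
    ((h.posDef k₀ (hx.trans_le hk₀.1)).dotProduct_mulVec_pos hv)).1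
  have hlim : Tendsto (fun ε : ℝ => (star v ⬝ᵥ feshbach Ω W (x + ε * I) *ᵥ v).im)
      (𝓝[>] 0) (𝓝 0) := by
    have hcont : Continuous fun M : Matrix ι ι ℂ => (star v ⬝ᵥ M *ᵥ v).im :=
      Complex.continuous_im.comp (by fun_prop)
    have := (hcont.tendsto _).comp (h.tendsto_feshbach_add_mul_I (Ω := Ω) x)
    rwa [hMv, dotProduct_zero, Complex.zero_im] at this
  have hle : ∀ᶠ ε : ℝ in 𝓝[>] 0,
      (star v ⬝ᵥ feshbach Ω W (x + ε * I) *ᵥ v).im ≤ -(ρ k₀ / 2) := by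
    filter_upwards [Ioo_mem_nhdsGT one_pos] with ε hε
    have him : (x + ε * I : ℂ).im = ε := by simp
    rw [h.im_form_feshbach v (neg_mem_slitPlane_of_im_ne_zero (him.trans_ne hε.1.ne')), him]
    have hhalf := half_le_im_stieltjes_ofReal (h.integrableOn_form v)
      (fun k hk => h.form_nonneg v hk) hx.le hε.1 hρ₀.le fun k hk =>
        hmin ⟨hk.1.le, hk.2.trans (by linarith [hε.2])⟩
    have : 0 ≤ ε * ‖WithLp.toLp 2 v‖ ^ 2 := mul_nonneg hε.1.le (sq_nonneg _)
    linarith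
  linarith [le_of_tendsto hlim hle]

end IsSpectralDensity

end Feshbach

/-! ### Zeros of the determinant of an increasing family -/

section IncreasingFamily

variable {ι : Type*} [Fintype ι]

theorem dotProduct_add_smul_mulVec_of_mulVec_eq_zero {A : Matrix ι ι ℂ} (hA : A.IsHermitian)
    {u : ι → ℂ} (hu : A *ᵥ u = 0) (a : ℂ) (w : ι → ℂ) :
    star (a • u + w) ⬝ᵥ A *ᵥ (a • u + w) = star w ⬝ᵥ A *ᵥ w := by
  have hleft : star u ᵥ* A = 0 := by
    rw [← hA.eq, ← Matrix.star_mulVec, hu, star_zero]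
  rw [Matrix.mulVec_add, Matrix.mulVec_smul, hu, smul_zero, zero_add, star_add, add_dotProduct,
    star_smul, smul_dotProduct, Matrix.dotProduct_mulVec (star u), hleft, zero_dotProduct,
    smul_zero, zero_add]

variable {α : Type*} [LinearOrder α] {A : α → Matrix ι ι ℂ} {S : Set α} {u : α → ι → ℂ}

/-- Adding a kernel vector of `A b` leaves the form of `A b` unchanged, so negativity of the forms
below `P` survives the insertion of a new minimum `b`. -/
theorem sum_kernel_ne_zero_and_form_neg (hA : ∀ p ∈ S, (A p).IsHermitian)
    (hmono : ∀ p ∈ S, ∀ q ∈ S, p < q → (A q - A p).PosDef)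
    (hu : ∀ p ∈ S, u p ≠ 0 ∧ A p *ᵥ u p = 0) (P : Finset α) (hP : ↑P ⊆ S) (a : α → ℂ)
    (ha : ∃ p ∈ P, a p ≠ 0) :
    ∑ p ∈ P, a p • u p ≠ 0 ∧ ∀ q ∈ S, (∀ p ∈ P, q < p) →
      star (∑ p ∈ P, a p • u p) ⬝ᵥ A q *ᵥ (∑ p ∈ P, a p • u p) < 0 := by
  induction P using Finset.induction_on_min with
  | empty => simp at ha
  | insert b P hbP ih =>
    rw [Finset.coe_insert, insert_subset_iff] at hP
    obtain ⟨hb, hPS⟩ := hP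
    rw [Finset.sum_insert fun h => (hbP b h).false]
    set w := ∑ p ∈ P, a p • u p
    have hform := dotProduct_add_smul_mulVec_of_mulVec_eq_zero (hA b hb) (hu b hb).2 (a b) w
    obtain ⟨hne, hle⟩ : a b • u b + w ≠ 0 ∧
        star (a b • u b + w) ⬝ᵥ A b *ᵥ (a b • u b + w) ≤ 0 := by
      by_cases haP : ∃ p ∈ P, a p ≠ 0
      · have hneg := hform.trans_lt ((ih hPS haP).2 b hb hbP)
        exact ⟨fun h => by simp [h] at hneg, hneg.le⟩
      · push Not at haP
        have hw0 : w = 0 := Finset.sum_eq_zero fun p hp => by rw [haP p hp, zero_smul]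
        have hab : a b ≠ 0 := by
          obtain ⟨p, hp, hap⟩ := ha
          rcases Finset.mem_insert.1 hp with rfl | hpP
          · exact hap
          · exact absurd (haP p hpP) hap
        exact ⟨by simpa [hw0] using ⟨hab, (hu b hb).1⟩, by rw [hform, hw0]; simp⟩
    refine ⟨hne, fun q hq hqP => lt_of_lt_of_le ?_ hle⟩
    have hpos := (hmono q hq b hb (hqP b (Finset.mem_insert_self b P))).dotProduct_mulVec_pos hne
    rwa [Matrix.sub_mulVec, dotProduct_sub, sub_pos] at hpos

theorem card_le_of_det_eq_zero [DecidableEq ι] {P : Finset α} (hA : ∀ p ∈ P, (A p).IsHermitian)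
    (hmono : ∀ p ∈ P, ∀ q ∈ P, p < q → (A q - A p).PosDef) (hP : ∀ p ∈ P, (A p).det = 0) :
    P.card ≤ Fintype.card ι := by
  have hker : ∀ p, ∃ v, p ∈ P → v ≠ 0 ∧ A p *ᵥ v = 0 := fun p => by
    by_cases hp : p ∈ P
    · exact (Matrix.exists_mulVec_eq_zero_iff.2 (hP p hp)).imp fun v hv _ => hv
    · exact ⟨0, fun h => absurd h hp⟩
  choose u hu using hker
  have hli : LinearIndepOn ℂ u P := linearIndepOn_finset_iff.2 fun a hsum p hp => by
    by_contra hap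
    exact (sum_kernel_ne_zero_and_form_neg (S := P) hA hmono hu P subset_rfl a
      ⟨p, hp, hap⟩).1 hsum
  simpa using hli.linearIndependent.fintype_card_le_finrank

end IncreasingFamily

section MatrixFunction

variable {ι : Type*} [Fintype ι] [DecidableEq ι]

theorem inv_apply_eq_inv_det_mul_adjugate (A : Matrix ι ι ℂ) (j l : ι) :
    A⁻¹ j l = A.det⁻¹ * A.adjugate j l := by
  simp [Matrix.inv_def]

variable {A : ℂ → Matrix ι ι ℂ} {y : ℂ}

theorem analyticAt_det (hA : ∀ j l, AnalyticAt ℂ (fun w => A w j l) y) :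
    AnalyticAt ℂ (fun w => (A w).det) y := by
  simp only [Matrix.det_apply, Units.smul_def, zsmul_eq_mul]
  fun_prop

theorem analyticAt_adjugate (hA : ∀ j l, AnalyticAt ℂ (fun w => A w j l) y) (j l : ι) :
    AnalyticAt ℂ (fun w => (A w).adjugate j l) y := by
  simp only [Matrix.adjugate_apply]
  refine analyticAt_det fun i m => ?_
  simp only [Matrix.updateRow_apply]
  split_ifs
  · exact analyticAt_const
  · exact hA i m

theorem analyticAt_inv_apply (hA : ∀ j l, AnalyticAt ℂ (fun w => A w j l) y)
    (hdet : (A y).det ≠ 0) (j l : ι) : AnalyticAt ℂ (fun w => (A w)⁻¹ j l) y := by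
  simp only [inv_apply_eq_inv_det_mul_adjugate]
  exact ((analyticAt_det hA).inv hdet).mul (analyticAt_adjugate hA j l)

theorem meromorphicAt_inv_apply (hA : ∀ j l, AnalyticAt ℂ (fun w => A w j l) y) (j l : ι) :
    MeromorphicAt (fun w => (A w)⁻¹ j l) y := by
  simp only [inv_apply_eq_inv_det_mul_adjugate]
  exact (analyticAt_det hA).meromorphicAt.inv.mul (analyticAt_adjugate hA j l).meromorphicAt

theorem exists_meromorphicOrderAt_inv_apply_neg_iff
    (hA : ∀ j l, AnalyticAt ℂ (fun w => A w j l) y) (hne : ∀ᶠ w in 𝓝[≠] y, (A w).det ≠ 0) :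
    (∃ j l, meromorphicOrderAt (fun w => (A w)⁻¹ j l) y < 0) ↔ (A y).det = 0 := by
  refine ⟨fun ⟨j, l, hjl⟩ => ?_, fun hdet => ?_⟩
  · by_contra hdet
    exact hjl.not_ge (analyticAt_inv_apply hA hdet j l).meromorphicOrderAt_nonneg
  by_contra! hnonneg
  choose B hB using fun j l =>
    tendsto_nhds_of_meromorphicOrderAt_nonneg (meromorphicAt_inv_apply hA j l) (hnonneg j l)
  have hinv : Tendsto (fun w => (A w)⁻¹) (𝓝[≠] y) (𝓝 (Matrix.of B)) :=
    tendsto_pi_nhds.2 fun j => tendsto_pi_nhds.2 (hB j)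
  have hlim : Tendsto A (𝓝[≠] y) (𝓝 (A y)) :=
    tendsto_pi_nhds.2 fun j => tendsto_pi_nhds.2 fun l =>
      (hA j l).continuousAt.mono_left nhdsWithin_le_nhds
  have hmul : A y * Matrix.of B = 1 := by
    refine tendsto_nhds_unique (hlim.mul hinv) (tendsto_const_nhds.congr' ?_)
    filter_upwards [hne] with w hw
    exact (Matrix.mul_nonsing_inv _ (isUnit_iff_ne_zero.2 hw)).symm
  simpa [hdet] using congrArg Matrix.det hmul

end MatrixFunction

/-! ### Poles of the inverse Feshbach matrix -/

section Poles

variable {ι : Type*} [DecidableEq ι] {W : ℂ → Matrix ι ι ℂ} {Ω : ℝ}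

namespace IsSpectralDensity

theorem analyticAt_feshbach_neg_apply (h : IsSpectralDensity W) {y : ℂ}
    (hy : y ∈ Complex.slitPlane) (j l : ι) :
    AnalyticAt ℂ (fun y => feshbach Ω W (-y) j l) y := by
  refine DifferentiableOn.analyticAt (fun w hw => ?_) (Complex.isOpen_slitPlane.mem_nhds hy)
  have := h.differentiableAt_feshbach_apply (Ω := Ω) (z := -w) (by rwa [neg_neg]) j l
  exact (this.comp w differentiableAt_id.neg).differentiableWithinAt

theorem isHermitian_feshbach_ofReal (h : IsSpectralDensity W) (x : ℝ) :
    (feshbach Ω W x).IsHermitian := by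
  rw [Matrix.IsHermitian, ← h.feshbach_conj, Complex.conj_ofReal]

variable [Fintype ι] in
theorem form_feshbach_neg_ofReal (h : IsSpectralDensity W) (v : ι → ℂ) {p : ℝ} (hp : 0 < p) :
    star v ⬝ᵥ feshbach Ω W (-p) *ᵥ v =
      (((Ω + p) * ‖WithLp.toLp 2 v‖ ^ 2 -
        ∫ k in Ioi (0 : ℝ), (star v ⬝ᵥ W k *ᵥ v).re / (k + p) : ℝ) : ℂ) := by
  rw [h.form_feshbach v (by simpa using hp), stieltjes]
  rw [Complex.ofReal_sub, ← integral_complex_ofReal]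
  push_cast
  simp only [sub_neg_eq_add]

theorem posDef_feshbach_neg_sub [Finite ι] (h : IsSpectralDensity W) {p q : ℝ} (hp : 0 < p)
    (hpq : p < q) :
    (feshbach Ω W (-(q : ℂ)) - feshbach Ω W (-(p : ℂ))).PosDef := by
  cases nonempty_fintype ι
  have hherm : ∀ x : ℝ, (feshbach Ω W (-(x : ℂ))).IsHermitian := fun x => by
    simpa using h.isHermitian_feshbach_ofReal (Ω := Ω) (-x)
  refine .of_dotProduct_mulVec_pos ((hherm q).sub (hherm p)) fun v hv => ?_
  have hint : ∀ x : ℝ, 0 < x →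
      IntegrableOn (fun k : ℝ => (star v ⬝ᵥ W k *ᵥ v).re / (k + x)) (Ioi 0) := fun x hx => by
    have hxslit : -(-(x : ℂ)) ∈ Complex.slitPlane := by simpa using hx
    refine (integrableOn_div_sub (h.integrableOn_form v).ofReal hxslit).re.congr ?_
    filter_upwards with k
    rw [sub_neg_eq_add, ← Complex.ofReal_add]
    exact congrArg Complex.re (Complex.ofReal_div _ _).symm
  have hmono : ∫ k in Ioi (0 : ℝ), (star v ⬝ᵥ W k *ᵥ v).re / (k + q) ≤
      ∫ k in Ioi (0 : ℝ), (star v ⬝ᵥ W k *ᵥ v).re / (k + p) := by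
    refine setIntegral_mono_on (hint q (hp.trans hpq)) (hint p hp) measurableSet_Ioi fun k hk => ?_
    have hk : 0 < k := hk
    have := h.form_nonneg v hk
    gcongr
  have hnorm : 0 < ‖WithLp.toLp 2 v‖ ^ 2 := by
    have : 0 < ‖WithLp.toLp 2 v‖ := by simpa using hv
    positivity
  rw [Matrix.sub_mulVec, dotProduct_sub, h.form_feshbach_neg_ofReal v hp,
    h.form_feshbach_neg_ofReal v (hp.trans hpq), ← Complex.ofReal_sub, Complex.zero_lt_real]
  nlinarith

end IsSpectralDensity

/-- The `p > 0` for which `-p` is an eigenvalue below the continuum `[0, ∞)`. -/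
def bindingEnergies (Ω : ℝ) (W : ℂ → Matrix ι ι ℂ) [Fintype ι] : Set ℝ :=
  {p | 0 < p ∧ (feshbach Ω W (-p)).det = 0}

namespace IsSpectralDensity

variable [Fintype ι]

theorem card_le_of_subset_bindingEnergies (h : IsSpectralDensity W) {P : Finset ℝ}
    (hP : ↑P ⊆ bindingEnergies Ω W) : P.card ≤ Fintype.card ι :=
  card_le_of_det_eq_zero (A := fun p : ℝ => feshbach Ω W (-(p : ℂ)))
    (fun p _ => by simpa using h.isHermitian_feshbach_ofReal (Ω := Ω) (-p))
    (fun _ hp _ _ hpq => h.posDef_feshbach_neg_sub (hP hp).1 hpq) fun _ hp => (hP hp).2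

theorem finite_bindingEnergies (h : IsSpectralDensity W) : (bindingEnergies Ω W).Finite := by
  by_contra hinf
  obtain ⟨P, hP, hcard⟩ :=
    Set.Infinite.exists_subset_card_eq (s := bindingEnergies Ω W) hinf (Fintype.card ι + 1)
  exact (h.card_le_of_subset_bindingEnergies hP).not_gt (by simp [hcard])

theorem det_feshbach_neg_eq_zero_iff (h : IsSpectralDensity W) {y : ℂ}
    (hy : y ∈ Complex.slitPlane) :
    (feshbach Ω W (-y)).det = 0 ↔ y ∈ (fun p : ℝ => (p : ℂ)) '' bindingEnergies Ω W := by
  refine ⟨fun hdet => ?_, ?_⟩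
  · have him : y.im = 0 := by
      by_contra hne
      exact h.det_feshbach_ne_zero (z := -y) (by simpa using hne) hdet
    have hre : (y.re : ℂ) = y := Complex.ext rfl him.symm
    exact ⟨y.re, ⟨(Complex.mem_slitPlane_iff.1 hy).resolve_right fun hne => hne him,
      by rwa [hre]⟩, hre⟩
  · rintro ⟨p, hp, rfl⟩
    exact hp.2

theorem meromorphicAt_inv_feshbach_neg_apply (h : IsSpectralDensity W) {y : ℂ}
    (hy : y ∈ Complex.slitPlane) (j l : ι) :
    MeromorphicAt (fun y => (feshbach Ω W (-y))⁻¹ j l) y :=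
  meromorphicAt_inv_apply (A := fun y => feshbach Ω W (-y))
    (fun j l => h.analyticAt_feshbach_neg_apply hy j l) j l

theorem eventually_det_feshbach_neg_ne_zero (h : IsSpectralDensity W) {y : ℂ}
    (hy : y ∈ Complex.slitPlane) : ∀ᶠ w in 𝓝[≠] y, (feshbach Ω W (-w)).det ≠ 0 := by
  have hfin := h.finite_bindingEnergies (Ω := Ω).image (fun p : ℝ => (p : ℂ))
  filter_upwards [mem_nhdsWithin_of_mem_nhds ((hfin.sdiff (t := {y})).isClosed.compl_mem_nhds
    fun hmem => hmem.2 rfl), self_mem_nhdsWithin, mem_nhdsWithin_of_mem_nhds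
    (Complex.isOpen_slitPlane.mem_nhds hy)] with w hw hwy hslit
  exact fun hdet => hw ⟨(h.det_feshbach_neg_eq_zero_iff hslit).1 hdet, hwy⟩

theorem exists_meromorphicOrderAt_inv_feshbach_neg_iff (h : IsSpectralDensity W) {y : ℂ}
    (hy : y ∈ Complex.slitPlane) :
    (∃ j l, meromorphicOrderAt (fun y => (feshbach Ω W (-y))⁻¹ j l) y < 0) ↔
      y ∈ (fun p : ℝ => (p : ℂ)) '' bindingEnergies Ω W := by
  rw [← h.det_feshbach_neg_eq_zero_iff hy]
  exact exists_meromorphicOrderAt_inv_apply_neg_iff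
    (fun j l => h.analyticAt_feshbach_neg_apply hy j l) (h.eventually_det_feshbach_neg_ne_zero hy)

end IsSpectralDensity

end Poles

/-! ### Spectral representation of the inverse Feshbach matrix -/

section Representation

variable {ι : Type*} [DecidableEq ι] {W : ℂ → Matrix ι ι ℂ} {Ω : ℝ}

namespace IsSpectralDensity

theorem tendsto_inv_smul_feshbachUpper (h : IsSpectralDensity W) :
    Tendsto (fun z => z⁻¹ • feshbachUpper Ω W z) (Bornology.cobounded ℂ ⊓ 𝓟 {z | 0 ≤ z.im})
      (𝓝 (-1)) := by
  have hinv : Tendsto (fun z : ℂ => z⁻¹) (Bornology.cobounded ℂ ⊓ 𝓟 {z | 0 ≤ z.im}) (𝓝 0) :=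
    tendsto_inv₀_cobounded.mono_left inf_le_left
  refine tendsto_pi_nhds.2 fun j => tendsto_pi_nhds.2 fun l => ?_
  obtain ⟨C, hC⟩ := (h.sectorDecay j l).exists_norm_rotatedStieltjes_le
  have hbdd : IsBoundedUnder (· ≤ ·) (Bornology.cobounded ℂ ⊓ 𝓟 {z | 0 ≤ z.im})
      fun z => ‖rotatedStieltjes (fun k => W k j l) z‖ :=
    ⟨C, eventually_map.2 (eventually_inf_principal.2 (.of_forall hC))⟩
  have hlim := ((((hinv.mul_const (Ω : ℂ)).sub_const 1).mul_const
    ((1 : Matrix ι ι ℂ) j l)).sub (hinv.zero_mul_isBoundedUnder_le hbdd))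
  simp only [zero_mul, zero_sub, sub_zero, neg_one_mul] at hlim
  refine hlim.congr' ?_
  filter_upwards [(Bornology.eventually_ne_cobounded (0 : ℂ)).filter_mono inf_le_left] with z hz
  simp only [feshbachUpper, Matrix.smul_apply, Matrix.sub_apply, Matrix.of_apply, smul_eq_mul]
  field_simp

theorem isBigO_conjTranspose_sub_feshbachUpper_apply (h : IsSpectralDensity W) (m n : ι) :
    (fun x : ℝ => ((feshbachUpper Ω W x)ᴴ - feshbachUpper Ω W x) m n)
      =O[atTop] fun _ => (1 : ℝ) := by
  obtain ⟨C, hC⟩ := (h.sectorDecay m n).exists_norm_rotatedStieltjes_le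
  obtain ⟨D, hD⟩ := (h.sectorDecay n m).exists_norm_rotatedStieltjes_le
  refine .of_bound (C + D) (.of_forall fun x => ?_)
  have heq : ((feshbachUpper Ω W x)ᴴ - feshbachUpper Ω W x) m n =
      rotatedStieltjes (fun k => W k m n) x - conj (rotatedStieltjes (fun k => W k n m) x) := by
    by_cases hmn : m = n
    · simp [feshbachUpper, hmn]
    · simp [feshbachUpper, hmn, neg_add_eq_sub]
  have hCx := hC x (by simp)
  have hDx := hD x (by simp)
  rw [heq, norm_one, mul_one]
  refine (norm_sub_le _ _).trans (add_le_add hCx ?_)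
  rwa [RCLike.norm_conj]

variable [Fintype ι]

theorem isBigO_inv_feshbachUpper_apply (h : IsSpectralDensity W) (j l : ι) :
    (fun z => (feshbachUpper Ω W z)⁻¹ j l)
      =O[Bornology.cobounded ℂ ⊓ 𝓟 {z | 0 ≤ z.im}] fun z => z⁻¹ ^ 1 := by
  have hdet : (-1 : Matrix ι ι ℂ).det ≠ 0 := by simp [Matrix.det_neg]
  have hlim := (continuousAt_matrix_inv_of_det_ne_zero hdet).tendsto.comp
    (h.tendsto_inv_smul_feshbachUpper (Ω := Ω))
  have hbdd := ((tendsto_pi_nhds.1 (tendsto_pi_nhds.1 hlim j) l)).isBigO_one ℂ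
  refine ((Asymptotics.isBigO_refl (fun z : ℂ => z⁻¹ ^ 1) _).mul hbdd).congr' ?_
    (.of_forall fun z => mul_one _)
  filter_upwards [(Bornology.eventually_ne_cobounded (0 : ℂ)).filter_mono inf_le_left,
    h.tendsto_inv_smul_feshbachUpper.eventually
      ((Continuous.matrix_det continuous_id).continuousAt.eventually_ne hdet)] with z hz hdetz
  rw [id_eq, Matrix.det_smul] at hdetz
  have hunit : IsUnit (feshbachUpper Ω W z).det :=
    isUnit_iff_ne_zero.2 (right_ne_zero_of_mul hdetz)
  have := invertibleOfNonzero (inv_ne_zero hz)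
  simp only [Function.comp_apply, Matrix.inv_smul _ _ hunit, Matrix.smul_apply, smul_eq_mul,
    invOf_eq_inv, inv_inv, pow_one]
  exact inv_mul_cancel_left₀ hz _

end IsSpectralDensity

variable [Fintype ι]

/-- The jump `M₊(x)⁻¹ - M₋(x)⁻¹` of the inverse Feshbach matrix across the cut, with
`M₋(x) = M₊(x)ᴴ` the boundary value from below. -/
noncomputable def jump (Ω : ℝ) (W : ℂ → Matrix ι ι ℂ) (x : ℝ) : Matrix ι ι ℂ :=
  (feshbachUpper Ω W x)⁻¹ - ((feshbachUpper Ω W x)⁻¹)ᴴ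

namespace IsSpectralDensity

theorem det_feshbachUpper_ofReal_ne_zero (h : IsSpectralDensity W)
    (h0 : (feshbach Ω W 0).det ≠ 0) {x : ℝ} (hx : 0 ≤ x) : (feshbachUpper Ω W x).det ≠ 0 := by
  rcases hx.eq_or_lt with rfl | hpos
  · rwa [Complex.ofReal_zero, h.feshbachUpper_zero]
  · exact h.det_feshbachUpper_ne_zero hpos

theorem continuousOn_inv_feshbachUpper (h : IsSpectralDensity W)
    (h0 : (feshbach Ω W 0).det ≠ 0) :
    ContinuousOn (fun x : ℝ => (feshbachUpper Ω W x)⁻¹) (Ici 0) := fun x hx => by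
  have hcont : ContinuousAt (fun x : ℝ => feshbachUpper Ω W x) x :=
    (h.continuousOn_feshbachUpper.comp_continuous Complex.continuous_ofReal
      fun _ => by simp).continuousAt
  exact ((continuousAt_matrix_inv_of_det_ne_zero (h.det_feshbachUpper_ofReal_ne_zero h0 hx)).comp
    (f := fun x : ℝ => feshbachUpper Ω W x) hcont).continuousWithinAt

theorem isBigO_inv_feshbachUpper_ofReal_apply (h : IsSpectralDensity W) (j l : ι) :
    (fun x : ℝ => (feshbachUpper Ω W x)⁻¹ j l) =O[atTop] fun x => x⁻¹ := by
  have hpath : Tendsto (fun x : ℝ => (x : ℂ)) atTop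
      (Bornology.cobounded ℂ ⊓ 𝓟 {z | 0 ≤ z.im}) :=
    tendsto_inf.2 ⟨(tendsto_algebraMap_cobounded ℝ ℂ).mono_left IsOrderBornology.atTop_le_cobounded,
      tendsto_principal.2 (.of_forall fun _ => by simp)⟩
  refine ((h.isBigO_inv_feshbachUpper_apply j l).comp_tendsto hpath).trans
    (Asymptotics.isBigO_of_le _ fun x => ?_)
  simp

theorem jump_eq_inv_mul_sub_mul_inv (h : IsSpectralDensity W) {x : ℝ} (hx : 0 < x) :
    jump Ω W x = (feshbachUpper Ω W x)⁻¹ * ((feshbachUpper Ω W x)ᴴ - feshbachUpper Ω W x) *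
      ((feshbachUpper Ω W x)⁻¹)ᴴ := by
  have hunit : IsUnit (feshbachUpper Ω W x) :=
    (Matrix.isUnit_iff_isUnit_det _).2 (isUnit_iff_ne_zero.2 (h.det_feshbachUpper_ne_zero hx))
  rw [jump, Matrix.conjTranspose_nonsing_inv]
  exact Matrix.inv_sub_inv (iff_of_true hunit hunit.star)

/-- The resolvent identity gains one power of decay: `M₊ᴴ - M₊` is bounded because the linear
terms in `x` cancel. -/
theorem isBigO_jump_apply (h : IsSpectralDensity W) (j l : ι) :
    (fun x => jump Ω W x j l) =O[atTop] fun x => (1 + x ^ 2)⁻¹ := by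
  refine .congr' ?_ ((eventually_gt_atTop 0).mono fun x hx =>
    (congr_fun₂ (h.jump_eq_inv_mul_sub_mul_inv hx) j l).symm) .rfl
  simp only [Matrix.mul_apply, Finset.sum_mul, Matrix.conjTranspose_apply]
  refine .fun_sum fun m _ => .fun_sum fun n _ => ?_
  have hstar : (fun x : ℝ => star ((feshbachUpper Ω W x)⁻¹ l m)) =O[atTop] fun x => x⁻¹ :=
    ((h.isBigO_inv_feshbachUpper_ofReal_apply l m).norm_left.congr_left
      fun x => (norm_star _).symm).of_norm_left
  refine (((h.isBigO_inv_feshbachUpper_ofReal_apply j n).mul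
    (h.isBigO_conjTranspose_sub_feshbachUpper_apply n m)).mul hstar).trans (.of_bound 2 ?_)
  filter_upwards [eventually_ge_atTop 1] with x hx
  rw [Real.norm_of_nonneg (by positivity), Real.norm_of_nonneg (by positivity)]
  field_simp
  nlinarith

theorem integrableOn_jump_apply (h : IsSpectralDensity W) (h0 : (feshbach Ω W 0).det ≠ 0)
    (j l : ι) : IntegrableOn (fun x => jump Ω W x j l) (Ioi 0) := by
  have hcont : ContinuousOn (fun x => jump Ω W x j l) (Ici 0) := by
    have hinv := h.continuousOn_inv_feshbachUpper h0
    have happly : ∀ m n, ContinuousOn (fun x : ℝ => (feshbachUpper Ω W x)⁻¹ m n) (Ici 0) :=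
      fun m n => continuousOn_pi.1 (continuousOn_pi.1 hinv m) n
    exact (happly j l).sub (happly l j).star
  exact ((hcont.locallyIntegrableOn measurableSet_Ici).integrableOn_of_isBigO_atTop
    (h.isBigO_jump_apply j l) (integrable_inv_one_add_sq.integrableAtFilter _)).mono_set
      Ioi_subset_Ici_self

end IsSpectralDensity

end Representation

/-! ### Residues at the binding energies -/

section Residue

variable {ι : Type*} [Fintype ι] [DecidableEq ι] {W : ℂ → Matrix ι ι ℂ} {Ω p : ℝ}

/-- The residue at `p` of `y ↦ M(-y)⁻¹`, as a limit: all poles are simple. -/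
noncomputable def feshbachResidue (Ω : ℝ) (W : ℂ → Matrix ι ι ℂ) (p : ℝ) : Matrix ι ι ℂ :=
  limUnder (𝓝[≠] (p : ℂ)) fun y => (y - p) • (feshbach Ω W (-y))⁻¹

theorem tendsto_conj_nhdsNE (x : ℝ) :
    Tendsto (conj : ℂ → ℂ) (𝓝[≠] (x : ℂ)) (𝓝[≠] (x : ℂ)) := by
  refine tendsto_nhdsWithin_iff.2 ⟨?_, eventually_mem_nhdsWithin.mono fun y hy heq => hy ?_⟩
  · exact (Complex.continuous_conj.tendsto' _ _ (Complex.conj_ofReal x)).mono_left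
      nhdsWithin_le_nhds
  · rw [mem_singleton_iff, ← Complex.conj_conj y, mem_singleton_iff.1 heq, Complex.conj_ofReal]

namespace IsSpectralDensity

theorem tendsto_feshbachResidue (h : IsSpectralDensity W) (hp : 0 < p) :
    Tendsto (fun y : ℂ => (y - p) • (feshbach Ω W (-y))⁻¹) (𝓝[≠] (p : ℂ))
      (𝓝 (feshbachResidue Ω W p)) := by
  have hbound : ∀ j l, ∀ᶠ ε : ℝ in 𝓝[>] 0,
      ‖(feshbach Ω W (-(p + ε * I)))⁻¹ j l‖ ≤ 1 / ε := fun j l => by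
    filter_upwards [self_mem_nhdsWithin] with ε hε
    have hε : 0 < ε := hε
    simpa [abs_of_pos hε] using
      h.norm_inv_feshbach_apply_le (Ω := Ω) (z := -(p + ε * I)) (by simpa using hε.ne') j l
  choose r hr using fun j l => exists_tendsto_sub_mul_of_norm_le
    (h.meromorphicAt_inv_feshbach_neg_apply (Ω := Ω) (Complex.ofReal_mem_slitPlane.2 hp) j l)
    (hbound j l)
  exact tendsto_nhds_limUnder
    ⟨Matrix.of r, tendsto_pi_nhds.2 fun j => tendsto_pi_nhds.2 fun l => hr j l⟩

theorem tendsto_feshbachResidue_apply (h : IsSpectralDensity W) (hp : 0 < p) (j l : ι) :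
    Tendsto (fun y : ℂ => (y - p) * (feshbach Ω W (-y))⁻¹ j l) (𝓝[≠] (p : ℂ))
      (𝓝 (feshbachResidue Ω W p j l)) :=
  tendsto_pi_nhds.1 (tendsto_pi_nhds.1 (h.tendsto_feshbachResidue hp) j) l

theorem isHermitian_feshbachResidue (h : IsSpectralDensity W) (hp : 0 < p) :
    (feshbachResidue Ω W p).IsHermitian := by
  refine tendsto_nhds_unique (((Continuous.matrix_conjTranspose continuous_id).tendsto _).comp
    ((h.tendsto_feshbachResidue hp).comp (tendsto_conj_nhdsNE p)))
    ((h.tendsto_feshbachResidue hp).congr fun y => ?_)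
  simp only [Function.comp_apply, id_eq, Matrix.conjTranspose_smul, star_sub, Complex.star_def,
    Complex.conj_conj, Complex.conj_ofReal, ← h.inv_feshbach_conj, map_neg]

theorem feshbachResidue_eq_zero (h : IsSpectralDensity W) (hp : 0 < p)
    (hpole : p ∉ bindingEnergies Ω W) : feshbachResidue Ω W p = 0 := by
  have hslit := Complex.ofReal_mem_slitPlane.2 hp
  have hcont : ContinuousAt (fun y : ℂ => (feshbach Ω W (-y))⁻¹) p :=
    continuousAt_pi.2 fun j => continuousAt_pi.2 fun l => (analyticAt_inv_apply
      (A := fun y => feshbach Ω W (-y)) (h.analyticAt_feshbach_neg_apply hslit)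
      (fun hdet => hpole ⟨hp, hdet⟩) j l).continuousAt
  have hsub : ContinuousAt (fun y : ℂ => y - p) p := by fun_prop
  have hlim : Tendsto (fun y : ℂ => (y - p) • (feshbach Ω W (-y))⁻¹) (𝓝[≠] (p : ℂ))
      (𝓝 ((p - p : ℂ) • (feshbach Ω W (-p))⁻¹)) :=
    (hsub.smul hcont).tendsto.mono_left nhdsWithin_le_nhds
  rw [sub_self, zero_smul] at hlim
  exact tendsto_nhds_unique (h.tendsto_feshbachResidue hp) hlim

end IsSpectralDensity

end Residue

/-! ### Subtraction of the poles -/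

theorem continuousAt_sum_inv_add_smul {E : Type*} [AddCommMonoid E] [Module ℂ E]
    [TopologicalSpace E] [ContinuousAdd E] [ContinuousSMul ℂ E] {P : Finset ℝ} (R : ℝ → E) {x : ℝ}
    (hx : ∀ p ∈ P, x + p ≠ 0) : ContinuousAt (fun z : ℂ => ∑ p ∈ P, (z + p)⁻¹ • R p) x := by
  refine tendsto_finsetSum _ fun p hp => Tendsto.smul_const (Tendsto.inv₀ ?_ ?_) _
  · exact Continuous.tendsto (by fun_prop) _
  · exact_mod_cast hx p hp

section RegularPart

variable {ι : Type*} [Fintype ι] [DecidableEq ι] {W : ℂ → Matrix ι ι ℂ} {Ω : ℝ} {P : Finset ℝ}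

/-- The inverse Feshbach matrix with its principal parts at `-p`, `p ∈ P`, subtracted. The residue
of `z ↦ M(z)⁻¹` at `-p` is minus `feshbachResidue Ω W p`, hence the sign. -/
noncomputable def regularPart (Ω : ℝ) (W : ℂ → Matrix ι ι ℂ) (P : Finset ℝ) (z : ℂ) :
    Matrix ι ι ℂ :=
  (feshbach Ω W z)⁻¹ + ∑ p ∈ P, (z + p)⁻¹ • feshbachResidue Ω W p

namespace IsSpectralDensity

theorem regularPart_conj (h : IsSpectralDensity W) (hP : ↑P ⊆ bindingEnergies Ω W) (z : ℂ) :
    regularPart Ω W P (conj z) = (regularPart Ω W P z)ᴴ := by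
  rw [regularPart, regularPart, h.inv_feshbach_conj, Matrix.conjTranspose_add,
    Matrix.conjTranspose_sum]
  congr 1
  refine Finset.sum_congr rfl fun p hp => ?_
  rw [Matrix.conjTranspose_smul, (h.isHermitian_feshbachResidue (hP hp).1).eq]
  simp

theorem differentiableAt_regularPart_apply (h : IsSpectralDensity W) {z : ℂ} (hz : z.im ≠ 0)
    (j l : ι) : DifferentiableAt ℂ (fun z => regularPart Ω W P z j l) z := by
  have hslit := neg_mem_slitPlane_of_im_ne_zero hz
  have hinv : DifferentiableAt ℂ (fun z => (feshbach Ω W z)⁻¹ j l) z := by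
    have := (analyticAt_inv_apply (A := fun y => feshbach Ω W (-y)) (y := -z)
      (h.analyticAt_feshbach_neg_apply hslit)
      (by rw [neg_neg]; exact h.det_feshbach_ne_zero hz) j l).differentiableAt
    simpa only [Function.comp_def, id_eq, Pi.neg_apply, neg_neg] using
      this.comp z differentiableAt_id.neg
  have hne : ∀ p : ℝ, z + p ≠ 0 := fun p hp => hz (by simpa using congrArg Complex.im hp)
  simp only [regularPart, Matrix.add_apply, Matrix.sum_apply, Matrix.smul_apply, smul_eq_mul]
  exact hinv.fun_add (.fun_sum fun p _ =>
    ((differentiableAt_id.add_const (p : ℂ)).fun_inv (hne p)).mul_const _)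

theorem isBigO_regularPart_apply (h : IsSpectralDensity W) (j l : ι) :
    (fun z => regularPart Ω W P z j l) =O[upperInfty] fun z => z⁻¹ ^ 1 := by
  have hle : upperInfty ≤ Bornology.cobounded ℂ ⊓ 𝓟 {z | 0 ≤ z.im} :=
    inf_le_inf_left _ (principal_mono.2 fun z (hz : 0 < z.im) => hz.le)
  simp only [regularPart, Matrix.add_apply, Matrix.sum_apply, Matrix.smul_apply, smul_eq_mul]
  refine (((h.isBigO_inv_feshbachUpper_apply (Ω := Ω) j l).mono hle).congr' ?_ .rfl).add
    (.fun_sum fun p _ => ?_)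
  · filter_upwards [mem_inf_of_right (mem_principal_self _)] with z hz
    rw [h.feshbachUpper_eq hz]
  · have := ((isBigO_inv_sub_const (-p) 1).mono
      (show upperInfty ≤ _ from inf_le_left)).const_mul_left (feshbachResidue Ω W p j l)
    simpa only [sub_neg_eq_add, pow_one, mul_comm] using this

theorem exists_tendsto_regularPart_neg (h : IsSpectralDensity W)
    (hP : ↑P = bindingEnergies Ω W) {q : ℝ} (hq : 0 < q) :
    ∃ V, Tendsto (regularPart Ω W P) (𝓝[≠] (-q : ℂ)) (𝓝 V) := by
  have hsum : ∀ z : ℂ, ∑ p ∈ P, (z + p)⁻¹ • feshbachResidue Ω W p =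
      (z + q)⁻¹ • feshbachResidue Ω W q +
        ∑ p ∈ P.erase q, (z + p)⁻¹ • feshbachResidue Ω W p := fun z => by
    by_cases hqP : q ∈ P
    · exact (Finset.add_sum_erase P (fun p : ℝ => (z + p)⁻¹ • feshbachResidue Ω W p) hqP).symm
    · rw [Finset.erase_eq_of_notMem hqP, h.feshbachResidue_eq_zero hq
        (by rwa [← hP, Finset.mem_coe]), smul_zero, zero_add]
  choose V hV using fun j l => exists_tendsto_sub_principal_part
    (h.meromorphicAt_inv_feshbach_neg_apply (Complex.ofReal_mem_slitPlane.2 hq) j l)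
    (h.tendsto_feshbachResidue_apply (Ω := Ω) hq j l)
  have hneg : Tendsto (fun z : ℂ => -z) (𝓝[≠] (-q : ℂ)) (𝓝[≠] (q : ℂ)) := by
    refine tendsto_nhdsWithin_iff.2 ⟨?_, eventually_mem_nhdsWithin.mono fun z hz heq => hz ?_⟩
    · exact (continuous_neg.tendsto' _ _ (neg_neg _)).mono_left nhdsWithin_le_nhds
    · exact neg_eq_iff_eq_neg.1 heq
  have hmain : Tendsto (fun z : ℂ => (feshbach Ω W z)⁻¹ + (z + q)⁻¹ • feshbachResidue Ω W q)
      (𝓝[≠] (-q : ℂ)) (𝓝 (Matrix.of V)) := by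
    refine tendsto_pi_nhds.2 fun j => tendsto_pi_nhds.2 fun l =>
      ((hV j l).comp hneg).congr fun z => ?_
    simp only [Function.comp_apply, neg_neg, ← neg_add', div_neg, sub_neg_eq_add, Matrix.add_apply,
      Matrix.smul_apply, smul_eq_mul, ← div_eq_inv_mul]
  have hrest := continuousAt_sum_inv_add_smul (P := P.erase q) (feshbachResidue Ω W) (x := -q)
    fun p hp hpq => Finset.ne_of_mem_erase hp (by linarith)
  rw [Complex.ofReal_neg] at hrest
  refine ⟨_, (hmain.add (hrest.tendsto.mono_left nhdsWithin_le_nhds)).congr fun z => ?_⟩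
  rw [regularPart, hsum, add_assoc]

theorem tendsto_regularPart_ofReal (h : IsSpectralDensity W) (hP : ↑P ⊆ bindingEnergies Ω W)
    (h0 : (feshbach Ω W 0).det ≠ 0) {x : ℝ} (hx : 0 ≤ x) :
    Tendsto (regularPart Ω W P) (𝓝[{z | 0 < z.im}] (x : ℂ))
      (𝓝 ((feshbachUpper Ω W x)⁻¹ + ∑ p ∈ P, (x + p : ℂ)⁻¹ • feshbachResidue Ω W p)) := by
  refine Tendsto.add ?_ ((continuousAt_sum_inv_add_smul _ fun p hp =>
    (add_pos_of_nonneg_of_pos hx (hP hp).1).ne').tendsto.mono_left nhdsWithin_le_nhds)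
  have hcont := (h.continuousOn_feshbachUpper (Ω := Ω) x (by simp)).tendsto.mono_left
    (nhdsWithin_mono _ fun z (hz : 0 < z.im) => hz.le)
  refine ((continuousAt_matrix_inv_of_det_ne_zero
    (h.det_feshbachUpper_ofReal_ne_zero h0 hx)).tendsto.comp hcont).congr' ?_
  filter_upwards [self_mem_nhdsWithin] with z hz
  rw [Function.comp_apply, h.feshbachUpper_eq hz]

theorem exists_boundaryValue_regularPart (h : IsSpectralDensity W)
    (hP : ↑P = bindingEnergies Ω W) (h0 : (feshbach Ω W 0).det ≠ 0) (x : ℝ) :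
    ∃ V : Matrix ι ι ℂ, Tendsto (regularPart Ω W P) (𝓝[{z | 0 < z.im}] (x : ℂ)) (𝓝 V) ∧
      V - Vᴴ = if 0 ≤ x then jump Ω W x else 0 := by
  split_ifs with hx
  · refine ⟨_, h.tendsto_regularPart_ofReal hP.le h0 hx, ?_⟩
    have hherm : (∑ p ∈ P, (x + p : ℂ)⁻¹ • feshbachResidue Ω W p).IsHermitian := by
      rw [Matrix.IsHermitian, Matrix.conjTranspose_sum]
      refine Finset.sum_congr rfl fun p hp => ?_
      rw [Matrix.conjTranspose_smul, (h.isHermitian_feshbachResidue (hP.le hp).1).eq]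
      simp
    rw [Matrix.conjTranspose_add, hherm.eq, add_sub_add_right_eq_sub, jump]
  · obtain ⟨V, hV⟩ := h.exists_tendsto_regularPart_neg hP (neg_pos.2 (not_le.1 hx))
    rw [Complex.ofReal_neg, neg_neg] at hV
    refine ⟨V, hV.mono_left (nhdsWithin_mono _ fun z (hz : 0 < z.im) => ?_), sub_eq_zero.2 ?_⟩
    · rintro rfl
      simp at hz
    · refine tendsto_nhds_unique (hV.comp (tendsto_conj_nhdsNE x)) ?_
      refine (((Continuous.matrix_conjTranspose continuous_id).tendsto _).comp hV).congr fun z => ?_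
      exact (h.regularPart_conj hP.le z).symm

theorem inv_feshbach_apply_eq (h : IsSpectralDensity W) (hP : ↑P = bindingEnergies Ω W)
    (h0 : (feshbach Ω W 0).det ≠ 0) {z : ℂ} (hz : 0 < z.im) (j l : ι) :
    (feshbach Ω W z)⁻¹ j l = (2 * π * I)⁻¹ * stieltjes (fun x => jump Ω W x j l) z -
      ∑ p ∈ P, feshbachResidue Ω W p j l / (z + p) := by
  choose V hV hjump using h.exists_boundaryValue_regularPart hP h0
  have hext : ∀ m n, ∃ U : ℂ → ℂ, DiffContOnCl ℂ U {z | 0 < z.im} ∧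
      EqOn U (fun z => regularPart Ω W P z m n) {z | 0 < z.im} ∧ ∀ x : ℝ, U x = V x m n :=
    fun m n => exists_diffContOnCl_extension
      (fun z (hz : 0 < z.im) =>
        (h.differentiableAt_regularPart_apply hz.ne' m n).differentiableWithinAt)
      fun x => tendsto_pi_nhds.1 (tendsto_pi_nhds.1 (hV x) m) n
  choose U hU hUeq hUV using hext
  have hUO : ∀ m n, U m n =O[upperInfty] fun z => z⁻¹ ^ 1 := fun m n =>
    (h.isBigO_regularPart_apply (Ω := Ω) (P := P) m n).congr'
      (mem_of_superset (mem_inf_of_right (mem_principal_self _)) fun z hz => (hUeq m n hz).symm)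
      .rfl
  have hUjump : ∀ x : ℝ, U j l x - conj (U l j x) =
      (if 0 ≤ x then jump Ω W x else 0 : Matrix ι ι ℂ) j l := fun x => by
    rw [hUV, hUV, ← hjump]; rfl
  have hcauchy := eq_stieltjes_of_diffContOnCl (hU j l) (hUO j l) (hU l j) (hUO l j)
    (fun x hx => sub_eq_zero.1 (by rw [hUjump, if_neg hx.not_ge]; rfl)) hz
  have hcut : stieltjes (fun x => U j l x - conj (U l j x)) z =
      stieltjes (fun x => jump Ω W x j l) z :=
    setIntegral_congr_fun measurableSet_Ioi fun x hx => by
      simp only [hUjump, if_pos (mem_Ioi.1 hx).le]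
  rw [hcut, hUeq j l hz, ← eq_inv_mul_iff_mul_eq₀ Complex.two_pi_I_ne_zero] at hcauchy
  rw [eq_sub_iff_add_eq, ← hcauchy]
  simp only [regularPart, Matrix.add_apply, Matrix.sum_apply, Matrix.smul_apply, smul_eq_mul,
    div_eq_inv_mul]

end IsSpectralDensity

end RegularPart

/-! ### Dynamics -/

section OscillatoryIntegral

variable {E : Type*} [NormedAddCommGroup E] [NormedSpace ℂ E]

theorem integrableOn_exp_neg_mul_smul_of_bounded {f : ℝ → E} (hf : Continuous f) {M : ℝ}
    (hM : ∀ t, ‖f t‖ ≤ M) {s : ℂ} (hs : 0 < s.re) :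
    IntegrableOn (fun t : ℝ => Complex.exp (-(s * t)) • f t) (Ioi 0) :=
  integrableOn_exp_neg_mul_smul (C := M) (σ := 0) hf.continuousOn (fun t _ => by simpa using hM t)
    hs

theorem laplace_clm_comp [CompleteSpace E] {F : Type*} [NormedAddCommGroup F] [NormedSpace ℂ F]
    [CompleteSpace F] {f : ℝ → E} {s : ℂ}
    (hf : IntegrableOn (fun t : ℝ => Complex.exp (-(s * t)) • f t) (Ioi 0)) (L : E →L[ℂ] F) :
    laplace (fun t => L (f t)) s = L (laplace f s) := by
  rw [laplace, laplace, ← L.integral_comp_comm hf]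
  simp only [map_smul]

theorem norm_exp_I_mul_mul (x t : ℝ) : ‖Complex.exp (I * x * t)‖ = 1 := by
  simp [Complex.norm_exp]

theorem norm_exp_I_mul_mul_smul (x t : ℝ) (w : E) :
    ‖Complex.exp (I * x * t) • w‖ = ‖w‖ := by
  rw [norm_smul, norm_exp_I_mul_mul, one_mul]

theorem integrableOn_exp_neg_I_smul {a : ℝ → E} (ha : IntegrableOn a (Ioi 0)) (t : ℝ) :
    IntegrableOn (fun y : ℝ => Complex.exp (-(I * y * t)) • a y) (Ioi 0) :=
  ha.bdd_smul 1 (Continuous.aestronglyMeasurable (by fun_prop))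
    (Eventually.of_forall fun y => (norm_exp_neg_I_mul_mul y t).le)

/-- The superposition `e^{iΩt} ∫₀^∞ e^{-iyt} a(y) dy` of the oscillations with frequencies `Ω - y`,
`y > 0`, with amplitudes `a`. -/
noncomputable def oscillatoryIntegral (Ω : ℝ) (a : ℝ → E) (t : ℝ) : E :=
  Complex.exp (I * Ω * t) • ∫ y in Ioi (0 : ℝ), Complex.exp (-(I * y * t)) • a y

theorem norm_oscillatoryIntegral_le (Ω : ℝ) (a : ℝ → E) (t : ℝ) :
    ‖oscillatoryIntegral Ω a t‖ ≤ ∫ y in Ioi (0 : ℝ), ‖a y‖ := by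
  rw [oscillatoryIntegral, norm_exp_I_mul_mul_smul]
  refine (norm_integral_le_integral_norm _).trans_eq ?_
  simp only [norm_smul, norm_exp_neg_I_mul_mul, one_mul]

theorem continuous_oscillatoryIntegral (Ω : ℝ) {a : ℝ → E} (ha : IntegrableOn a (Ioi 0)) :
    Continuous (oscillatoryIntegral Ω a) := by
  refine Continuous.smul (by fun_prop) (continuous_of_dominated (bound := fun y => ‖a y‖)
    (fun t => (integrableOn_exp_neg_I_smul ha t).aestronglyMeasurable)
    (fun t => Eventually.of_forall fun y => ?_) ha.norm
    (Eventually.of_forall fun y => by fun_prop))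
  rw [norm_smul, norm_exp_neg_I_mul_mul, one_mul]

theorem oscillatoryIntegral_apply {ι : Type*} [Fintype ι] (Ω : ℝ) {a : ℝ → ι → ℂ}
    (ha : IntegrableOn a (Ioi 0)) (t : ℝ) (j : ι) :
    oscillatoryIntegral Ω a t j = oscillatoryIntegral Ω (fun y => a y j) t := by
  rw [oscillatoryIntegral, Pi.smul_apply, eval_integral fun i =>
    (integrableOn_exp_neg_I_smul ha t).eval i]
  rfl

theorem laplace_oscillatoryIntegral (Ω : ℝ) {a : ℝ → ℂ} (ha : IntegrableOn a (Ioi 0)) {s : ℂ}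
    (hs : 0 < s.re) :
    laplace (oscillatoryIntegral Ω a) s = -I * stieltjes a (I * s + Ω) := by
  have hs' : 0 < (s - I * Ω).re := by simpa using hs
  have hshift : I * (s - I * Ω) = I * s + Ω := by linear_combination (-Ω : ℂ) * Complex.I_sq
  rw [← hshift, ← laplace_integral_exp_eq_stieltjes ha hs', ← laplace_exp_smul]
  rfl

theorem laplace_oscillatoryIntegral_apply {ι : Type*} [Fintype ι] (Ω : ℝ) {a : ℝ → ι → ℂ}
    (ha : IntegrableOn a (Ioi 0)) {s : ℂ} (hs : 0 < s.re) (j : ι) :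
    laplace (oscillatoryIntegral Ω a) s j = -I * stieltjes (fun y => a y j) (I * s + Ω) := by
  have hint := integrableOn_exp_neg_mul_smul_of_bounded (continuous_oscillatoryIntegral Ω ha)
    (norm_oscillatoryIntegral_le Ω a) hs
  have hcomp := laplace_clm_comp hint (ContinuousLinearMap.proj (R := ℂ) (φ := fun _ : ι => ℂ) j)
  simp only [ContinuousLinearMap.proj_apply, oscillatoryIntegral_apply Ω ha] at hcomp
  rw [← hcomp, ← laplace_oscillatoryIntegral Ω (ha.eval j) hs]

theorem laplace_exp_smul_const [CompleteSpace E] (q : ℝ) (w : E) {s : ℂ} (hs : 0 < s.re) :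
    laplace (fun t => Complex.exp (I * q * t) • w) s = (s - I * q)⁻¹ • w := by
  rw [laplace_exp_smul, laplace, integral_smul_const, integral_exp_neg_mul (by simpa using hs)]

end OscillatoryIntegral

section Dynamics

variable {ι : Type*} [Fintype ι] {W : ℂ → Matrix ι ι ℂ} {Ω : ℝ} {P : Finset ℝ}

theorem norm_mulVec_le (A : Matrix ι ι ℂ) (v : ι → ℂ) :
    ‖A *ᵥ v‖ ≤ (∑ j, ∑ l, ‖A j l‖) * ‖v‖ := by
  have hrow : ∀ j, 0 ≤ ∑ l, ‖A j l‖ := fun j => Finset.sum_nonneg fun l _ => norm_nonneg _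
  refine (pi_norm_le_iff_of_nonneg
    (mul_nonneg (Finset.sum_nonneg fun j _ => hrow j) (norm_nonneg v))).2 fun j => ?_
  calc ‖(A *ᵥ v) j‖ ≤ ∑ l, ‖A j l‖ * ‖v‖ := by
        refine norm_sum_le_of_le _ fun l _ => ?_
        rw [norm_mul]
        exact mul_le_mul_of_nonneg_left (norm_le_pi_norm v l) (norm_nonneg _)
    _ = (∑ l, ‖A j l‖) * ‖v‖ := by rw [Finset.sum_mul]
    _ ≤ _ := mul_le_mul_of_nonneg_right
        (Finset.single_le_sum (fun i _ => hrow i) (Finset.mem_univ j)) (norm_nonneg v)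

/-- The memory kernel `e^{iΩt} ∫₀^∞ e^{-iyt} W(y) dy` that the continuum contributes to the equation
of motion of the discrete levels. -/
noncomputable def memoryKernel (Ω : ℝ) (W : ℂ → Matrix ι ι ℂ) (t : ℝ) :
    (ι → ℂ) →L[ℂ] (ι → ℂ) :=
  (Matrix.of fun j l => oscillatoryIntegral Ω (fun y => W y j l) t).mulVecLin.toContinuousLinearMap

theorem memoryKernel_apply (t : ℝ) (v : ι → ℂ) (j : ι) :
    memoryKernel Ω W t v j = ∑ l, oscillatoryIntegral Ω (fun y => W y j l) t * v l :=
  rfl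

theorem norm_memoryKernel_le (t : ℝ) :
    ‖memoryKernel Ω W t‖ ≤ ∑ j, ∑ l, ∫ y in Ioi (0 : ℝ), ‖W y j l‖ := by
  refine ContinuousLinearMap.opNorm_le_bound _ (by positivity) fun v =>
    (norm_mulVec_le _ v).trans ?_
  gcongr with j _ l _
  exact norm_oscillatoryIntegral_le Ω (fun y => W y j l) t

namespace IsSpectralDensity

theorem continuous_memoryKernel (h : IsSpectralDensity W) : Continuous (memoryKernel Ω W) := by
  refine continuous_clm_apply.2 fun v => continuous_pi fun j => ?_
  simp only [memoryKernel_apply]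
  have := fun l => continuous_oscillatoryIntegral Ω (h.sectorDecay j l).integrableOn
  fun_prop

theorem laplace_memoryKernel_apply (h : IsSpectralDensity W) {s : ℂ} (hs : 0 < s.re) (v : ι → ℂ) :
    laplace (memoryKernel Ω W) s v =
      -I • (Matrix.of fun j l => stieltjes (fun y => W y j l) (I * s + Ω)) *ᵥ v := by
  have hint := integrableOn_exp_neg_mul_smul_of_bounded (h.continuous_memoryKernel (Ω := Ω))
    norm_memoryKernel_le hs
  have hentry : ∀ j l, IntegrableOn (fun t : ℝ => Complex.exp (-(s * t)) •
      oscillatoryIntegral Ω (fun y => W y j l) t) (Ioi 0) := fun j l =>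
    integrableOn_exp_neg_mul_smul_of_bounded
      (continuous_oscillatoryIntegral Ω (h.sectorDecay j l).integrableOn)
      (norm_oscillatoryIntegral_le Ω _) hs
  ext j
  have hcomp := laplace_clm_comp hint ((ContinuousLinearMap.proj (R := ℂ) (φ := fun _ => ℂ) j).comp
    (ContinuousLinearMap.apply ℂ (ι → ℂ) v))
  simp only [ContinuousLinearMap.comp_apply, ContinuousLinearMap.apply_apply,
    ContinuousLinearMap.proj_apply] at hcomp
  rw [← hcomp, laplace]
  simp only [memoryKernel_apply, smul_eq_mul, Finset.mul_sum, ← mul_assoc]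
  simp only [smul_eq_mul] at hentry
  rw [integral_finsetSum _ fun l _ => (hentry j l).mul_const (v l)]
  simp only [integral_mul_const, Pi.smul_apply, Matrix.mulVec, dotProduct, Matrix.of_apply,
    smul_eq_mul, Finset.mul_sum]
  refine Finset.sum_congr rfl fun l _ => ?_
  rw [← mul_assoc, ← laplace_oscillatoryIntegral Ω (h.sectorDecay j l).integrableOn hs]
  rfl

end IsSpectralDensity

variable [DecidableEq ι]

/-- The solution at time `t` of the equation of motion with initial datum `v`: the contributions of
the cut and of the binding energies `P`. -/
noncomputable def evolution (Ω : ℝ) (W : ℂ → Matrix ι ι ℂ) (P : Finset ℝ) (v : ι → ℂ) (t : ℝ) :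
    ι → ℂ :=
  (2 * π * I : ℂ)⁻¹ • oscillatoryIntegral Ω (fun y => jump Ω W y *ᵥ v) t +
    ∑ p ∈ P, Complex.exp (I * (p + Ω : ℝ) * t) • feshbachResidue Ω W p *ᵥ v

theorem norm_evolution_le (v : ι → ℂ) (t : ℝ) :
    ‖evolution Ω W P v t‖ ≤
      ‖(2 * π * I : ℂ)⁻¹‖ * (∫ y in Ioi (0 : ℝ), ‖jump Ω W y *ᵥ v‖) +
        ∑ p ∈ P, ‖feshbachResidue Ω W p *ᵥ v‖ := by
  refine norm_add_le_of_le ?_ (norm_sum_le_of_le _ fun p _ => (norm_exp_I_mul_mul_smul _ _ _).le)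
  rw [norm_smul]
  gcongr
  exact norm_oscillatoryIntegral_le Ω _ t

namespace IsSpectralDensity

theorem integrableOn_jump_mulVec (h : IsSpectralDensity W) (h0 : (feshbach Ω W 0).det ≠ 0)
    (v : ι → ℂ) : IntegrableOn (fun y => jump Ω W y *ᵥ v) (Ioi 0) :=
  Integrable.of_eval fun j => integrable_finsetSum _ fun l _ =>
    (h.integrableOn_jump_apply h0 j l).mul_const (v l)

theorem inv_feshbach_mulVec_apply_eq (h : IsSpectralDensity W) (hP : ↑P = bindingEnergies Ω W)
    (h0 : (feshbach Ω W 0).det ≠ 0) {z : ℂ} (hz : 0 < z.im) (v : ι → ℂ) (j : ι) :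
    ((feshbach Ω W z)⁻¹ *ᵥ v) j =
      (2 * π * I)⁻¹ * stieltjes (fun y => (jump Ω W y *ᵥ v) j) z -
        ∑ p ∈ P, (feshbachResidue Ω W p *ᵥ v) j / (z + p) := by
  have hcut : stieltjes (fun y => (jump Ω W y *ᵥ v) j) z =
      ∑ l, stieltjes (fun y => jump Ω W y j l) z * v l := by
    have hint : ∀ l, IntegrableOn (fun y : ℝ => jump Ω W y j l / (y - z) * v l) (Ioi 0) := fun l =>
      (integrableOn_div_sub (h.integrableOn_jump_apply h0 j l)
        (neg_mem_slitPlane_of_im_ne_zero hz.ne')).mul_const _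
    simp only [stieltjes, ← integral_mul_const]
    rw [← integral_finsetSum _ fun l _ => hint l]
    simp only [Matrix.mulVec, dotProduct, Finset.sum_div, div_mul_eq_mul_div]
  rw [hcut]
  simp only [Matrix.mulVec, dotProduct, h.inv_feshbach_apply_eq hP h0 hz, sub_mul,
    Finset.sum_sub_distrib, Finset.mul_sum, Finset.sum_mul, Finset.sum_div, mul_assoc,
    div_mul_eq_mul_div]
  rw [Finset.sum_comm]

theorem continuous_evolution (h : IsSpectralDensity W) (h0 : (feshbach Ω W 0).det ≠ 0)
    (v : ι → ℂ) : Continuous (evolution Ω W P v) := by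
  have := continuous_oscillatoryIntegral Ω (h.integrableOn_jump_mulVec h0 v)
  unfold evolution
  fun_prop

theorem laplace_evolution (h : IsSpectralDensity W) (hP : ↑P = bindingEnergies Ω W)
    (h0 : (feshbach Ω W 0).det ≠ 0) {s : ℂ} (hs : 0 < s.re) (v : ι → ℂ) :
    laplace (evolution Ω W P v) s = -I • (feshbach Ω W (I * s + Ω))⁻¹ *ᵥ v := by
  have hjump := h.integrableOn_jump_mulVec h0 v
  have hcut := integrableOn_exp_neg_mul_smul_of_bounded
    (continuous_oscillatoryIntegral Ω hjump) (norm_oscillatoryIntegral_le Ω _) hs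
  have hpole := fun p : ℝ => integrableOn_exp_neg_mul_smul_of_bounded
    (f := fun t : ℝ => Complex.exp (I * (p + Ω : ℝ) * t) • feshbachResidue Ω W p *ᵥ v)
    (by fun_prop) (fun t => (norm_exp_I_mul_mul_smul _ _ _).le) hs
  have hsplit : laplace (evolution Ω W P v) s =
      (2 * π * I : ℂ)⁻¹ • laplace (oscillatoryIntegral Ω fun y => jump Ω W y *ᵥ v) s +
        ∑ p ∈ P, (s - I * (p + Ω : ℝ))⁻¹ • feshbachResidue Ω W p *ᵥ v := by
    simp only [← laplace_exp_smul_const _ _ hs, laplace]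
    rw [← integral_smul, ← integral_finsetSum _ fun p _ => hpole p,
      ← integral_add (hcut.fun_smul _) (integrable_finsetSum _ fun p _ => hpole p)]
    simp only [evolution, smul_add, Finset.smul_sum, smul_comm _ (2 * π * I : ℂ)⁻¹]
  ext j
  have hz : 0 < (I * s + Ω).im := by simpa using hs
  simp only [hsplit, Pi.add_apply, Finset.sum_apply, Pi.smul_apply, smul_eq_mul,
    laplace_oscillatoryIntegral_apply Ω hjump hs, h.inv_feshbach_mulVec_apply_eq hP h0 hz,
    mul_sub, Finset.mul_sum]
  rw [sub_eq_add_neg, ← Finset.sum_neg_distrib]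
  congr 1
  · ring
  · refine Finset.sum_congr rfl fun p _ => ?_
    have hden : s - I * (p + Ω : ℝ) = -I * (I * s + Ω + p) := by
      push_cast
      linear_combination s * Complex.I_sq
    rw [hden, mul_inv, inv_neg, Complex.inv_I]
    ring

theorem feshbach_mulVec_laplace (h : IsSpectralDensity W) {β : ℝ → ι → ℂ}
    (hβ : ContinuousOn β (Ici 0))
    (hderiv : ∀ t, 0 < t → HasDerivAt β (-∫ τ in 0..t, memoryKernel Ω W (t - τ) (β τ)) t)
    {C σ : ℝ} (hσ : 0 ≤ σ) (hC : ∀ t, 0 ≤ t → ‖β t‖ ≤ C * Real.exp (σ * t)) {s : ℂ}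
    (hs : σ < s.re) : feshbach Ω W (I * s + Ω) *ᵥ laplace β s = -I • β 0 := by
  have hvolterra := laplace_volterra hβ h.continuous_memoryKernel.continuousOn
    (fun t _ => norm_memoryKernel_le t) hderiv hσ hC hs
  rw [h.laplace_memoryKernel_apply (hσ.trans_lt hs)] at hvolterra
  rw [← hvolterra, feshbach, Matrix.sub_mulVec, Matrix.smul_mulVec, Matrix.one_mulVec,
    sub_add_cancel_right, smul_add, smul_smul, smul_smul, neg_mul_neg, Complex.I_mul_I,
    neg_one_smul, neg_mul, sub_eq_add_neg]

theorem eq_evolution (h : IsSpectralDensity W) (hP : ↑P = bindingEnergies Ω W)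
    (h0 : (feshbach Ω W 0).det ≠ 0) {β : ℝ → ι → ℂ} (hβ : ContinuousOn β (Ici 0))
    (hderiv : ∀ t, 0 < t → HasDerivAt β (-∫ τ in 0..t, memoryKernel Ω W (t - τ) (β τ)) t)
    {t : ℝ} (ht : 0 ≤ t) : β t = evolution Ω W P (β 0) t := by
  obtain ⟨C, σ, hσ, hC⟩ :
      ∃ C σ : ℝ, 0 ≤ σ ∧ ∀ t, 0 ≤ t → ‖β t‖ ≤ C * Real.exp (σ * t) :=
    ⟨_, _, zero_le_one.trans (le_max_right _ _), fun _ =>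
      norm_le_exp_of_volterra hβ (fun t _ => norm_memoryKernel_le t) hderiv⟩
  have hevol := h.continuous_evolution (P := P) h0 (β 0)
  have hdiff : ContinuousOn (fun t => β t - evolution Ω W P (β 0) t) (Ici 0) :=
    hβ.sub hevol.continuousOn
  have hlaplace : ∀ s : ℂ, σ < s.re →
      IntegrableOn (fun t : ℝ => Complex.exp (-(s * t)) • (β t - evolution Ω W P (β 0) t)) (Ioi 0) ∧
      laplace (fun t => β t - evolution Ω W P (β 0) t) s = 0 := fun s hs => by
    have hs0 := hσ.trans_lt hs
    have hz : (I * s + Ω).im ≠ 0 := by simpa using hs0.ne'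
    have hβint := integrableOn_exp_neg_mul_smul (hβ.mono Ioi_subset_Ici_self)
      (fun t ht => hC t ht.le) hs
    have hevolint := integrableOn_exp_neg_mul_smul_of_bounded hevol
      (norm_evolution_le (Ω := Ω) (W := W) (P := P) (β 0)) hs0
    have hsolve : laplace β s = -I • (feshbach Ω W (I * s + Ω))⁻¹ *ᵥ β 0 := by
      rw [← Matrix.mulVec_smul, ← h.feshbach_mulVec_laplace hβ hderiv hσ hC hs,
        Matrix.mulVec_mulVec, Matrix.nonsing_inv_mul _ (h.det_feshbach_ne_zero hz).isUnit,
        Matrix.one_mulVec]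
    simp only [laplace, smul_sub]
    refine ⟨hβint.sub hevolint, ?_⟩
    rw [integral_sub hβint hevolint, sub_eq_zero]
    exact hsolve.trans (h.laplace_evolution hP h0 hs0 (β 0)).symm
  have hpos : ∀ t ∈ Ioi (0 : ℝ), β t = evolution Ω W P (β 0) t := fun t ht =>
    sub_eq_zero.1 <| eq_zero_of_laplace_eq_zero (σ := σ + 1) (hdiff.mono Ioi_subset_Ici_self)
      (hlaplace _ (by simp)).1 (fun τ => (hlaplace _ (by simp)).2) ht
  have hclosure : EqOn β (evolution Ω W P (β 0)) (Ici 0) :=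
    EqOn.of_subset_closure hpos hβ hevol.continuousOn Ioi_subset_Ici_self
      (closure_Ioi (0 : ℝ)).ge
  exact hclosure ht

end IsSpectralDensity

end Dynamics

/-! ### Plane waves on the unit sphere -/

section SphereFourier

variable {E : Type*} [NormedAddCommGroup E] [InnerProductSpace ℝ E]

theorem hasDerivAt_cexp_inner (y e ω : E) (s : ℝ) :
    HasDerivAt (fun s : ℝ => Complex.exp (I * (inner ℝ (y + s • e) ω : ℝ)))
      (I * ((inner ℝ e ω : ℝ) * Complex.exp (I * (inner ℝ (y + s • e) ω : ℝ)))) s := by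
  have hphase : HasDerivAt (fun s : ℝ => I * (inner ℝ (y + s • e) ω : ℝ))
      (I * (inner ℝ e ω : ℝ)) s := by
    simp only [inner_add_left, real_inner_smul_left]
    have := ((hasDerivAt_id s).mul_const (inner ℝ e ω)).const_add (inner ℝ y ω)
    simpa using this.ofReal_comp.const_mul I
  exact hphase.cexp.congr_deriv (by ring)

variable [FiniteDimensional ℝ E] [MeasurableSpace E] [BorelSpace E]

local notation "σ" => Measure.toSphere (volume : Measure E)

theorem integral_toSphere_comp_isometry (U : E ≃ₗᵢ[ℝ] E) (f : E → ℂ) :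
    ∫ ω : Metric.sphere (0 : E) 1, f (U ω) ∂σ = ∫ ω : Metric.sphere (0 : E) 1, f ω ∂σ := by
  have hU (ω : E) : ω ∈ Metric.sphere (0 : E) 1 ↔ U ω ∈ Metric.sphere (0 : E) 1 := by
    simp only [mem_sphere_zero_iff_norm, U.norm_map]
  let V : Metric.sphere (0 : E) 1 ≃ᵐ Metric.sphere (0 : E) 1 :=
    (U.toHomeomorph.subtype hU).toMeasurableEquiv
  have hV : MeasurePreserving V σ σ := by
    refine ⟨V.measurable, Measure.ext fun s hs => ?_⟩
    have hcone : U ⁻¹' (Ioo (0 : ℝ) 1 • ((↑) '' s : Set E)) =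
        Ioo (0 : ℝ) 1 • ((↑) '' (V ⁻¹' s) : Set E) := by
      have hcoe : ((↑) '' (V ⁻¹' s) : Set E) = U.symm '' ((↑) '' s) := by
        rw [← V.image_symm, image_image, image_image]
        rfl
      rw [hcoe, ← U.symm_symm, ← U.symm.image_eq_preimage_symm, U.symm_symm]
      exact image_image2_distrib_right fun a ω => U.symm.map_smul a ω
    rw [Measure.map_apply V.measurable hs, Measure.toSphere_apply' _ (V.measurable hs),
      Measure.toSphere_apply' _ hs, ← hcone,
      U.measurePreserving.measure_preimage_emb U.toHomeomorph.measurableEmbedding]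
  exact hV.integral_comp' (g := fun ω : Metric.sphere (0 : E) 1 => f ω)

/-- The Fourier transform of the measure `h dω` on the unit sphere. -/
noncomputable def sphereFourier (h : E → ℂ) (y : E) : ℂ :=
  ∫ ω : Metric.sphere (0 : E) 1, h ω * Complex.exp (I * (inner ℝ y (ω : E) : ℝ)) ∂σ

theorem sphereFourier_comp_isometry (U : E ≃ₗᵢ[ℝ] E) (h : E → ℂ) (y : E) :
    sphereFourier (h ∘ U) y = sphereFourier h (U y) := by
  have := integral_toSphere_comp_isometry U
    fun ω => h ω * Complex.exp (I * (inner ℝ (U y) ω : ℝ))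
  simpa only [U.inner_map_map] using! this

theorem integrable_toSphere {f : E → ℂ} (hf : Continuous f) :
    Integrable (fun ω : Metric.sphere (0 : E) 1 => f ω) σ :=
  (hf.comp continuous_subtype_val).integrable_of_hasCompactSupport
    (HasCompactSupport.of_compactSpace _)

theorem hasDerivAt_sphereFourier {h : E → ℂ} (hh : Continuous h) (y e : E) (s : ℝ) :
    HasDerivAt (fun s : ℝ => sphereFourier h (y + s • e))
      (I * sphereFourier (fun ω => (inner ℝ e ω : ℝ) * h ω) (y + s • e)) s := by
  let F (r : ℝ) (ω : E) : ℂ := h ω * Complex.exp (I * (inner ℝ (y + r • e) ω : ℝ))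
  let F' (r : ℝ) (ω : E) : ℂ :=
    (inner ℝ e ω : ℝ) * h ω * Complex.exp (I * (inner ℝ (y + r • e) ω : ℝ))
  have hF (r : ℝ) : Continuous (F r) := by fun_prop
  have hF' : Continuous (F' s) := by fun_prop
  have hderiv (r : ℝ) (ω : E) : HasDerivAt (fun r => F r ω) (I * F' r ω) r :=
    ((hasDerivAt_cexp_inner y e ω r).const_mul (h ω)).congr_deriv (by simp only [F']; ring)
  have hbound (r : ℝ) (ω : E) : ‖I * F' r ω‖ ≤ ‖(inner ℝ e ω : ℝ) * h ω‖ := by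
    rw [norm_mul, norm_mul, Complex.norm_I, one_mul, mul_comm I, Complex.norm_exp_ofReal_mul_I,
      mul_one]
  have hdominant : Continuous fun ω : E => (inner ℝ e ω : ℝ) * h ω := by fun_prop
  have hdiff := hasDerivAt_integral_of_dominated_loc_of_deriv_le (μ := σ) (s := univ)
    (F := fun r ω => F r ω) (F' := fun r ω => I * F' r ω) (x₀ := s) univ_mem
    (Eventually.of_forall fun r => (integrable_toSphere (hF r)).aestronglyMeasurable)
    (integrable_toSphere (hF s))
    ((integrable_toSphere hF').const_mul I).aestronglyMeasurable
    (Eventually.of_forall fun ω r _ => hbound r ω)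
    (integrable_toSphere hdominant).norm
    (Eventually.of_forall fun ω r _ => hderiv r ω)
  exact hdiff.2.congr_deriv (integral_const_mul _ _)

/-- The reflection along `z` fixes `y` and reverses the sign of the integrand. -/
theorem sphereFourier_inner_eq_zero {y z : E} (hyz : inner ℝ z y = 0) :
    sphereFourier (fun ω => (inner ℝ z ω : ℝ)) y = 0 := by
  let U := (ℝ ∙ z)ᗮ.reflection
  have hUz : U z = -z := Submodule.reflection_orthogonalComplement_singleton_eq_neg z
  have hUy : U y = y := Submodule.reflection_mem_subspace_eq_self
    (Submodule.mem_orthogonal_singleton_iff_inner_right.2 hyz)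
  have hneg := sphereFourier_comp_isometry U (fun ω => (inner ℝ z ω : ℝ)) y
  have hodd : (fun ω => ((inner ℝ z ω : ℝ) : ℂ)) ∘ U = fun ω => -((inner ℝ z ω : ℝ) : ℂ) := by
    ext ω
    have : inner ℝ z (U ω) = -inner ℝ z ω := by
      rw [← U.inner_map_map z ω, hUz, inner_neg_left, neg_neg]
    simp only [Function.comp_apply, this, Complex.ofReal_neg]
  rw [hodd, hUy] at hneg
  simp only [sphereFourier, neg_mul, integral_neg] at hneg ⊢
  exact self_eq_neg.1 hneg.symm

theorem sphereFourier_const_mul (c : ℂ) (h : E → ℂ) (y : E) :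
    sphereFourier (fun ω => c * h ω) y = c * sphereFourier h y := by
  simp only [sphereFourier, mul_assoc, integral_const_mul]

theorem sphereFourier_sum {κ : Type*} (s : Finset κ) {h : κ → E → ℂ} (hh : ∀ j, Continuous (h j))
    (y : E) : sphereFourier (fun ω => ∑ j ∈ s, h j ω) y = ∑ j ∈ s, sphereFourier (h j) y := by
  simp only [sphereFourier, Finset.sum_mul]
  refine integral_finsetSum s fun j _ => ?_
  exact integrable_toSphere (f := fun ω => h j ω * Complex.exp (I * (inner ℝ y ω : ℝ)))
    (by fun_prop)

theorem sphereFourier_add {h k : E → ℂ} (hh : Continuous h) (hk : Continuous k) (y : E) :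
    sphereFourier (fun ω => h ω + k ω) y = sphereFourier h y + sphereFourier k y := by
  simp only [sphereFourier, add_mul]
  exact integral_add
    (integrable_toSphere (f := fun ω => h ω * Complex.exp (I * (inner ℝ y ω : ℝ))) (by fun_prop))
    (integrable_toSphere (f := fun ω => k ω * Complex.exp (I * (inner ℝ y ω : ℝ))) (by fun_prop))

theorem mul_sphereFourier_inner_eq {e f : E} (he : ‖e‖ = 1) (hf : ‖f‖ = 1) (hef : inner ℝ e f = 0)
    (r s : ℝ) :
    r * sphereFourier (fun ω => (inner ℝ f ω : ℝ)) (r • e + s • f) =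
      s * sphereFourier (fun ω => (inner ℝ e ω : ℝ)) (r • e + s • f) := by
  have horth : inner ℝ (r • f + (-s) • e) (r • e + s • f) = 0 := by
    simp only [inner_add_left, inner_add_right, real_inner_smul_left, real_inner_smul_right,
      real_inner_self_eq_norm_sq, he, hf, hef, real_inner_comm e f]
    ring
  have hzero := sphereFourier_inner_eq_zero horth
  simp only [inner_add_left, real_inner_smul_left, Complex.ofReal_add, Complex.ofReal_mul,
    Complex.ofReal_neg] at hzero
  rw [sphereFourier_add (by fun_prop) (by fun_prop), sphereFourier_const_mul,
    sphereFourier_const_mul] at hzero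
  linear_combination hzero

/-- This is the derivative at `s = 0` of `mul_sphereFourier_inner_eq`. -/
theorem mul_sphereFourier_inner_sq {e f : E} (he : ‖e‖ = 1) (hf : ‖f‖ = 1) (hef : inner ℝ e f = 0)
    (r : ℝ) :
    I * r * sphereFourier (fun ω => (inner ℝ f ω : ℝ) ^ 2) (r • e) =
      sphereFourier (fun ω => (inner ℝ e ω : ℝ)) (r • e) := by
  have hleft := (hasDerivAt_sphereFourier (h := fun ω => (inner ℝ f ω : ℝ)) (by fun_prop)
    (r • e) f 0).const_mul (r : ℂ)
  have hright := (hasDerivAt_id (0 : ℝ)).ofReal_comp.mul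
    (hasDerivAt_sphereFourier (h := fun ω => (inner ℝ e ω : ℝ)) (by fun_prop) (r • e) f 0)
  have heq := hleft.unique
    (hright.congr_of_eventuallyEq (Eventually.of_forall (mul_sphereFourier_inner_eq he hf hef r)))
  simp only [← sq, zero_smul, add_zero, Complex.ofReal_one, one_mul, id, Complex.ofReal_zero,
    zero_mul] at heq
  rw [← heq]
  ring

/-- The radial form of the Helmholtz equation `Δu = -u` for the transform `u` of the surface
measure. -/
theorem sphereFourier_helmholtz {κ : Type*} [Fintype κ]
    (b : OrthonormalBasis κ ℝ E) (i : κ) (r : ℝ) :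
    I * r * (sphereFourier (fun _ => 1) (r • b i) -
        sphereFourier (fun ω => (inner ℝ (b i) ω : ℝ) ^ 2) (r • b i)) =
      (Fintype.card κ - 1 : ℂ) * sphereFourier (fun ω => (inner ℝ (b i) ω : ℝ)) (r • b i) := by
  classical
  have hone : sphereFourier (fun _ => 1) (r • b i) =
      ∑ j, sphereFourier (fun ω => (inner ℝ (b j) ω : ℝ) ^ 2) (r • b i) := by
    rw [← sphereFourier_sum _ fun j => by fun_prop]
    refine integral_congr_ae (Eventually.of_forall fun ω => ?_)
    have hω : ∑ j, (inner ℝ (b j) (ω : E)) ^ 2 = 1 := by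
      rw [b.sum_sq_inner_right, norm_eq_of_mem_sphere, one_pow]
    have hω' : ∑ j, ((inner ℝ (b j) (ω : E) : ℝ) : ℂ) ^ 2 = 1 := mod_cast hω
    simp only [hω']
  have hother (j : κ) (hj : j ∈ Finset.univ.erase i) :
      I * r * sphereFourier (fun ω => (inner ℝ (b j) ω : ℝ) ^ 2) (r • b i) =
        sphereFourier (fun ω => (inner ℝ (b i) ω : ℝ)) (r • b i) :=
    mul_sphereFourier_inner_sq (b.norm_eq_one i) (b.norm_eq_one j)
      (b.inner_eq_zero (Finset.ne_of_mem_erase hj).symm) r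
  rw [hone, ← Finset.sum_erase_eq_sub (Finset.mem_univ i), Finset.mul_sum,
    Finset.sum_congr rfl hother, Finset.sum_const, Finset.card_erase_of_mem (Finset.mem_univ i),
    Finset.card_univ, nsmul_eq_mul, Nat.cast_pred (Fintype.card_pos_iff.2 ⟨i⟩)]

end SphereFourier

theorem eq_mul_sin_of_hasDerivAt {w w' : ℝ → ℂ} (hw : ∀ r, HasDerivAt w (w' r) r)
    (hw' : ∀ r, HasDerivAt w' (-w r) r) (h0 : w 0 = 0) (r : ℝ) : w r = w' 0 * Real.sin r := by
  have hsin (r : ℝ) := (Real.hasDerivAt_sin r).ofReal_comp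
  have hcos (r : ℝ) := (Real.hasDerivAt_cos r).ofReal_comp
  have hA (r : ℝ) : HasDerivAt
      (fun r => w r * (Real.cos r : ℂ) - w' r * (Real.sin r : ℂ)) 0 r :=
    (((hw r).mul (hcos r)).sub ((hw' r).mul (hsin r))).congr_deriv (by push_cast; ring)
  have hB (r : ℝ) : HasDerivAt
      (fun r => w r * (Real.sin r : ℂ) + w' r * (Real.cos r : ℂ)) 0 r :=
    (((hw r).mul (hsin r)).add ((hw' r).mul (hcos r))).congr_deriv (by push_cast; ring)
  have hA0 := is_const_of_deriv_eq_zero (fun r => (hA r).differentiableAt)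
    (fun r => (hA r).deriv) r 0
  have hB0 := is_const_of_deriv_eq_zero (fun r => (hB r).differentiableAt)
    (fun r => (hB r).deriv) r 0
  simp only [h0, Real.sin_zero, Real.cos_zero, Complex.ofReal_zero, Complex.ofReal_one, mul_zero,
    sub_zero, zero_add, mul_one] at hA0 hB0
  have hsq : ((Real.sin r : ℂ)) ^ 2 + (Real.cos r : ℂ) ^ 2 = 1 := mod_cast Real.sin_sq_add_cos_sq r
  linear_combination (Real.cos r : ℂ) * hA0 + (Real.sin r : ℂ) * hB0 - w r * hsq

/-- Three-dimensional Euclidean space, in which the atoms are placed. -/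
abbrev Space : Type := EuclideanSpace ℝ (Fin 3)

theorem sphereFourier_one_zero : sphereFourier (fun _ => 1) (0 : Space) = 4 * π := by
  have harea : (Measure.toSphere (volume : Measure Space)).real univ = 4 * π := by
    rw [Measure.toSphere_real_apply_univ, finrank_euclideanSpace_fin, Measure.real,
      EuclideanSpace.volume_ball_fin_three, ENNReal.ofReal_one, one_pow, one_mul,
      ENNReal.toReal_ofReal (by positivity)]
    ring
  simp only [sphereFourier, inner_zero_left, Complex.ofReal_zero, mul_zero, Complex.exp_zero,
    mul_one, integral_const, harea, Complex.real_smul]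
  push_cast
  rfl

theorem mul_sphereFourier_one_smul (b : OrthonormalBasis (Fin 3) ℝ Space) (i : Fin 3) (r : ℝ) :
    r * sphereFourier (fun _ => 1) (r • b i) = 4 * π * Real.sin r := by
  let u (r : ℝ) : ℂ := sphereFourier (fun _ => 1) (r • b i)
  let v (r : ℝ) : ℂ := I * sphereFourier (fun ω => (inner ℝ (b i) ω : ℝ)) (r • b i)
  have hu (r : ℝ) : HasDerivAt u (v r) r := by
    simpa only [zero_add, mul_one] using!
      hasDerivAt_sphereFourier (h := fun _ => 1) continuous_const 0 (b i) r
  have hv (r : ℝ) : HasDerivAt v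
      (-sphereFourier (fun ω => (inner ℝ (b i) ω : ℝ) ^ 2) (r • b i)) r := by
    have := (hasDerivAt_sphereFourier (h := fun ω => (inner ℝ (b i) ω : ℝ)) (by fun_prop)
      0 (b i) r).const_mul I
    simpa only [zero_add, ← mul_assoc, Complex.I_mul_I, neg_one_mul, ← pow_two (Complex.ofReal _)]
      using! this
  have hw (r : ℝ) : HasDerivAt (fun r : ℝ => (r : ℂ) * u r) (u r + r * v r) r :=
    ((hasDerivAt_id r).ofReal_comp.mul (hu r)).congr_deriv (by simp)
  have hw' (r : ℝ) : HasDerivAt (fun r : ℝ => u r + r * v r) (-(r * u r)) r := by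
    refine ((hu r).add ((hasDerivAt_id r).ofReal_comp.mul (hv r))).congr_deriv ?_
    have := sphereFourier_helmholtz b i r
    rw [Fintype.card_fin] at this
    simp only [u, v, id, Complex.ofReal_one]
    push_cast at this
    linear_combination (-I) * this + r * (sphereFourier (fun _ => 1) (r • b i) -
      sphereFourier (fun ω => (inner ℝ (b i) ω : ℝ) ^ 2) (r • b i)) * Complex.I_sq
  have := eq_mul_sin_of_hasDerivAt hw hw' (by simp) r
  simpa [u, sphereFourier_one_zero] using this

theorem sphereFourier_one_eq_sinc (y : Space) :
    sphereFourier (fun _ => 1) y = 4 * π * Real.sinc ‖y‖ := by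
  rcases eq_or_ne y 0 with rfl | hy
  · rw [sphereFourier_one_zero, norm_zero, Real.sinc_zero, Complex.ofReal_one, mul_one]
  let b := EuclideanSpace.basisFun (Fin 3) ℝ
  have hnorm : ‖‖y‖ • b 0‖ = ‖y‖ := by rw [norm_smul, norm_norm, b.norm_eq_one, mul_one]
  have hrotate := sphereFourier_comp_isometry (ℝ ∙ (‖y‖ • b 0 - y))ᗮ.reflection (fun _ => 1)
    (‖y‖ • b 0)
  rw [Submodule.reflection_sub hnorm] at hrotate
  have hy' : ‖y‖ ≠ 0 := norm_ne_zero_iff.2 hy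
  have hy'' : (‖y‖ : ℂ) ≠ 0 := Complex.ofReal_ne_zero.2 hy'
  rw [← hrotate, Real.sinc_of_ne_zero hy', Complex.ofReal_div, ← mul_div_assoc, eq_div_iff hy'',
    ← mul_sphereFourier_one_smul b 0 ‖y‖, mul_comm]
  rfl

/-! ### Linear independence of plane waves -/

section PlaneWaves

variable {ι : Type*}

theorem norm_le_sum_of_exp_sum_eq_zero [Fintype ι] [DecidableEq ι]
    {v : ι → ℂ} {b : ι → ℝ} {a : ι → ℂ} (ha : ∀ l, ‖a l‖ = 1) {s : ℝ}
    (h : ∑ l, v l * (a l * Real.exp (s * b l)) = 0) (m : ι) :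
    ‖v m‖ ≤ ∑ l ∈ Finset.univ.erase m, ‖v l‖ * Real.exp (s * (b l - b m)) := by
  have hnorm (l : ι) : ‖v l * (a l * Real.exp (s * b l))‖ = ‖v l‖ * Real.exp (s * b l) := by
    rw [norm_mul, norm_mul, ha, one_mul, Complex.norm_real, Real.norm_of_nonneg (Real.exp_nonneg _)]
  rw [← Finset.add_sum_erase _ _ (Finset.mem_univ m)] at h
  have hle : ‖v m‖ * Real.exp (s * b m) ≤
      ∑ l ∈ Finset.univ.erase m, ‖v l‖ * Real.exp (s * b l) := by
    rw [← hnorm, eq_neg_of_add_eq_zero_left h, norm_neg]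
    exact (norm_sum_le _ _).trans_eq (Finset.sum_congr rfl fun l _ => hnorm l)
  simpa only [mul_sub, Real.exp_sub, ← mul_div_assoc, ← Finset.sum_div,
    le_div_iff₀ (Real.exp_pos _)] using hle

/-- As `s → ∞`, the nonzero term with the largest rate dominates all others. -/
theorem eq_zero_of_exp_sum_eq_zero [Fintype ι] {v : ι → ℂ} {b : ι → ℝ}
    (hb : Function.Injective b) {a : ι → ℝ → ℂ} (ha : ∀ l s, ‖a l s‖ = 1)
    (h : ∀ s : ℝ, ∑ l, v l * (a l s * Real.exp (s * b l)) = 0) : v = 0 := by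
  classical
  by_contra hv
  have hsupport : (Finset.univ.filter fun l => v l ≠ 0).Nonempty := by
    obtain ⟨l, hl⟩ := Function.ne_iff.1 hv
    exact ⟨l, by simpa using hl⟩
  obtain ⟨m, hm, hmax⟩ := Finset.exists_max_image _ b hsupport
  have hlim : Tendsto (fun s : ℝ => ∑ l ∈ Finset.univ.erase m,
      ‖v l‖ * Real.exp (s * (b l - b m))) atTop (𝓝 (∑ _ ∈ Finset.univ.erase m, 0)) := by
    refine tendsto_finsetSum _ fun l hl => ?_
    rcases eq_or_ne (v l) 0 with hvl | hvl
    · simp only [hvl, norm_zero, zero_mul, tendsto_const_nhds]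
    · have hlt : b l - b m < 0 := sub_neg.2
        (lt_of_le_of_ne (hmax l (by simpa using hvl)) (hb.ne (Finset.ne_of_mem_erase hl)))
      have hexp := Real.tendsto_exp_atBot.comp (tendsto_id.atTop_mul_const_of_neg hlt)
      simpa using hexp.const_mul ‖v l‖
  rw [Finset.sum_const_zero] at hlim
  exact (Finset.mem_filter.1 hm).2 (norm_le_zero_iff.1 (ge_of_tendsto' hlim fun s =>
    norm_le_sum_of_exp_sum_eq_zero (fun l => ha l s) (h s) m))

variable {E : Type*} [NormedAddCommGroup E] [InnerProductSpace ℝ E]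

theorem exists_inner_ne_zero [FiniteDimensional ℝ E] {S : Set E} (hS : S.Finite) (h0 : 0 ∉ S) :
    ∃ w : E, ∀ v ∈ S, inner ℝ w v ≠ 0 := by
  have := hS.to_subtype
  obtain ⟨f, hf⟩ := Module.exists_dual_forall_apply_ne_zero (K := ℝ) (fun v : S => (v : E))
    fun v hv => h0 (hv ▸ v.2)
  refine ⟨(InnerProductSpace.toDual ℝ E).symm (LinearMap.toContinuousLinearMap f), fun v hv => ?_⟩
  rw [InnerProductSpace.toDual_symm_apply]
  exact hf ⟨v, hv⟩

theorem exists_orthonormal_pair_injective_inner [Finite ι] [FiniteDimensional ℝ E]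
    (hE : 2 ≤ Module.finrank ℝ E) {y : ι → E} (hy : Function.Injective y) :
    ∃ e f : E, ‖e‖ = 1 ∧ ‖f‖ = 1 ∧ inner ℝ e f = 0 ∧
      Function.Injective fun l => inner ℝ f (y l) := by
  have : Nontrivial E := Module.nontrivial_of_finrank_pos (R := ℝ) (by lia)
  obtain ⟨u, hu⟩ := exists_ne (0 : E)
  obtain ⟨w, hw⟩ := exists_inner_ne_zero
    (((finite_range fun q : ι × ι => y q.1 - y q.2).sdiff (t := {0})).insert u)
    (by simp [hu.symm])
  have hw0 : w ≠ 0 := by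
    rintro rfl
    exact hw u (mem_insert _ _) (inner_zero_left u)
  have hperp : 0 < Module.finrank ℝ (ℝ ∙ w)ᗮ := by
    have := Submodule.finrank_add_finrank_orthogonal (ℝ ∙ w)
    rw [finrank_span_singleton hw0] at this
    lia
  obtain ⟨d, hd⟩ := Module.finrank_pos_iff_exists_ne_zero.1 hperp
  have hdw : inner ℝ (d : E) w = 0 := by
    rw [real_inner_comm]
    exact Submodule.mem_orthogonal_singleton_iff_inner_right.1 d.2
  refine ⟨‖(d : E)‖⁻¹ • (d : E), ‖w‖⁻¹ • w, norm_smul_inv_norm (Subtype.coe_ne_coe.2 hd),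
    norm_smul_inv_norm hw0, ?_, fun j l hjl => ?_⟩
  · rw [real_inner_smul_left, real_inner_smul_right, hdw, mul_zero, mul_zero]
  · by_contra hne
    refine hw (y j - y l)
      (mem_insert_of_mem _ ⟨mem_range_self (j, l), sub_ne_zero.2 (hy.ne hne)⟩) ?_
    simp only [real_inner_smul_left] at hjl
    rw [inner_sub_right, sub_eq_zero]
    exact mul_left_cancel₀ (inv_ne_zero (norm_ne_zero_iff.2 hw0)) hjl

theorem sum_cexp_complex_angle_eq_zero [Fintype ι] {v : ι → ℂ} {y : ι → E}
    (h : ∀ ω : E, ‖ω‖ = 1 → ∑ l, v l * Complex.exp (I * (inner ℝ (y l) ω : ℝ)) = 0)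
    {e f : E} (he : ‖e‖ = 1) (hf : ‖f‖ = 1) (hef : inner ℝ e f = 0) (θ : ℂ) :
    ∑ l, v l * Complex.exp (I * (Complex.cos θ * (inner ℝ e (y l) : ℝ) +
      Complex.sin θ * (inner ℝ f (y l) : ℝ))) = 0 := by
  set F : ℂ → ℂ := fun θ => ∑ l, v l * Complex.exp (I * (Complex.cos θ * (inner ℝ e (y l) : ℝ) +
      Complex.sin θ * (inner ℝ f (y l) : ℝ)))
  have hF : Differentiable ℂ F := by fun_prop
  have hreal (t : ℝ) : F t = 0 := by
    have hunit : ‖Real.cos t • e + Real.sin t • f‖ = 1 := by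
      have : ‖Real.cos t • e + Real.sin t • f‖ ^ 2 = 1 := by
        rw [norm_add_sq_real, norm_smul, norm_smul, he, hf, real_inner_smul_left,
          real_inner_smul_right, hef]
        simp
      exact (pow_eq_one_iff_of_nonneg (norm_nonneg _) two_ne_zero).1 this
    rw [← h _ hunit]
    simp only [F, inner_add_right, real_inner_smul_right, real_inner_comm (y _), Complex.ofReal_add,
      Complex.ofReal_mul, Complex.ofReal_cos, Complex.ofReal_sin]
  have hfreq : ∃ᶠ z in 𝓝[≠] (0 : ℂ), F z = 0 :=
    (Complex.continuous_ofReal.continuousWithinAt.tendsto_nhdsWithin (x := 0) (s := {0}ᶜ)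
      fun t ht => Complex.ofReal_ne_zero.2 ht).frequently (Eventually.of_forall hreal).frequently
  exact congrFun (AnalyticOnNhd.eq_of_frequently_eq
    (Complex.analyticOnNhd_univ_iff_differentiable.2 hF) analyticOnNhd_const hfreq) θ

/-- At the complex angle `θ = -i arsinh s` one has `i sin θ = s` while `cos θ` is real, so the
plane waves become exponentials with distinct rates. -/
theorem eq_zero_of_planeWave_sum_eq_zero [Fintype ι] [FiniteDimensional ℝ E]
    (hE : 2 ≤ Module.finrank ℝ E) {y : ι → E} (hy : Function.Injective y) {v : ι → ℂ}
    (h : ∀ ω : E, ‖ω‖ = 1 → ∑ l, v l * Complex.exp (I * (inner ℝ (y l) ω : ℝ)) = 0) : v = 0 := by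
  obtain ⟨e, f, he, hf, hef, hinj⟩ := exists_orthonormal_pair_injective_inner hE hy
  refine eq_zero_of_exp_sum_eq_zero hinj
    (a := fun l s => Complex.exp (((Real.cosh (Real.arsinh s) * inner ℝ e (y l) : ℝ) : ℂ) * I))
    (fun l s => Complex.norm_exp_ofReal_mul_I _) fun s => ?_
  rw [← sum_cexp_complex_angle_eq_zero h he hf hef (-(Real.arsinh s : ℂ) * I)]
  refine Finset.sum_congr rfl fun l _ => ?_
  rw [Complex.ofReal_exp, ← Complex.exp_add, Complex.cos_mul_I, Complex.sin_mul_I,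
    Complex.cosh_neg, Complex.sinh_neg, ← Complex.ofReal_cosh, ← Complex.ofReal_sinh,
    Real.sinh_arsinh]
  congr 2
  push_cast
  linear_combination ((s : ℂ) * (inner ℝ f (y l) : ℝ)) * Complex.I_sq

variable [FiniteDimensional ℝ E] [MeasurableSpace E] [BorelSpace E]

theorem conj_sphereFourier_one (y : E) :
    conj (sphereFourier (fun _ => 1) y) = sphereFourier (fun _ => 1) (-y) := by
  rw [sphereFourier, ← integral_conj]
  refine integral_congr_ae (Eventually.of_forall fun ω => ?_)
  simp [← Complex.exp_conj]

theorem integral_norm_sq_planeWave_sum [Fintype ι] (y : ι → E) (v : ι → ℂ) :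
    ((∫ ω : Metric.sphere (0 : E) 1, ‖∑ l, v l * Complex.exp (I * (inner ℝ (y l) (ω : E) : ℝ))‖ ^ 2
        ∂Measure.toSphere (volume : Measure E) : ℝ) : ℂ) =
      star v ⬝ᵥ Matrix.of (fun j l => sphereFourier (fun _ => 1) (y l - y j)) *ᵥ v := by
  have hexpand (ω : E) :
      ((‖∑ l, v l * Complex.exp (I * (inner ℝ (y l) ω : ℝ))‖ ^ 2 : ℝ) : ℂ) =
        ∑ j, ∑ l, star (v j) * v l * Complex.exp (I * (inner ℝ (y l - y j) ω : ℝ)) := by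
    rw [Complex.ofReal_pow, ← Complex.conj_mul', map_sum, Finset.sum_mul_sum]
    refine Finset.sum_congr rfl fun j _ => Finset.sum_congr rfl fun l _ => ?_
    have hphase : I * ((inner ℝ (y l - y j) ω : ℝ) : ℂ) =
        conj (I * (inner ℝ (y j) ω : ℝ)) + I * (inner ℝ (y l) ω : ℝ) := by
      rw [inner_sub_left, map_mul, Complex.conj_I, Complex.conj_ofReal]
      push_cast
      ring
    rw [hphase, Complex.exp_add, map_mul, ← Complex.exp_conj, Complex.star_def]
    ring
  have hint (j l : ι) : Integrable (fun ω : Metric.sphere (0 : E) 1 =>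
      star (v j) * v l * Complex.exp (I * (inner ℝ (y l - y j) (ω : E) : ℝ)))
      (Measure.toSphere volume) :=
    integrable_toSphere (f := fun ω => star (v j) * v l * Complex.exp
      (I * (inner ℝ (y l - y j) ω : ℝ))) (by fun_prop)
  rw [dotProduct_mulVec_eq_sum, ← integral_complex_ofReal]
  simp only [hexpand]
  rw [integral_finsetSum _ fun j _ => integrable_finsetSum _ fun l _ => hint j l]
  refine Finset.sum_congr rfl fun j _ => ?_
  rw [integral_finsetSum _ fun l _ => hint j l]
  refine Finset.sum_congr rfl fun l _ => ?_
  simp only [integral_const_mul, sphereFourier, Matrix.of_apply, Pi.star_apply, one_mul]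

theorem posDef_sphereFourier [Finite ι] (hE : 2 ≤ Module.finrank ℝ E) {y : ι → E}
    (hy : Function.Injective y) :
    (Matrix.of fun j l => sphereFourier (fun _ => 1) (y l - y j)).PosDef := by
  cases nonempty_fintype ι
  refine .of_dotProduct_mulVec_pos ?_ fun v hv => ?_
  · ext j l
    rw [Matrix.conjTranspose_apply, Matrix.of_apply, Matrix.of_apply, Complex.star_def,
      conj_sphereFourier_one, neg_sub]
  rw [← integral_norm_sq_planeWave_sum, Complex.zero_lt_real]
  have hcont : Continuous fun ω : Metric.sphere (0 : E) 1 =>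
      ‖∑ l, v l * Complex.exp (I * (inner ℝ (y l) (ω : E) : ℝ))‖ ^ 2 := by fun_prop
  refine lt_of_le_of_ne (integral_nonneg fun ω => sq_nonneg _) fun hzero => hv ?_
  have hae := (integral_eq_zero_iff_of_nonneg (fun ω => sq_nonneg _)
    (hcont.integrable_of_hasCompactSupport (HasCompactSupport.of_compactSpace _))).1 hzero.symm
  have heverywhere := (hcont.ae_eq_iff_eq (Measure.toSphere volume) continuous_const).1 hae
  refine eq_zero_of_planeWave_sum_eq_zero hE hy fun ω hω => ?_
  have hω0 := congrFun heverywhere ⟨ω, mem_sphere_zero_iff_norm.2 hω⟩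
  exact norm_eq_zero.1 ((pow_eq_zero_iff two_ne_zero).1 hω0)

theorem posDef_sphKernel [Finite ι] {x : ι → Space} (hx : Function.Injective x) {k : ℝ}
    (hk : 0 < k) :
    (Matrix.of fun j l => (sphKernel k (dist (x j) (x l)) : ℂ)).PosDef := by
  have hpos := posDef_sphereFourier (by simp) (y := fun l => k • x l)
    ((smul_right_injective _ hk.ne').comp hx)
  refine (congrArg Matrix.PosDef ?_).mp hpos
  ext j l
  rw [Matrix.of_apply, Matrix.of_apply, sphereFourier_one_eq_sinc, ← smul_sub, norm_smul,
    Real.norm_of_nonneg hk.le, ← dist_eq_norm, dist_comm, sphKernel]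
  push_cast
  rfl

end PlaneWaves

/-! ### The photon field -/

section SineRatio

/-- The entire function `k ↦ k sinc (k r)`. -/
noncomputable def sineRatio (r : ℝ) (k : ℂ) : ℂ := if r = 0 then k else Complex.sin (k * r) / r

theorem sineRatio_ofReal (r k : ℝ) : sineRatio r k = k * Real.sinc (k * r) := by
  unfold sineRatio
  split_ifs with hr
  · rw [hr, mul_zero, Real.sinc_zero, Complex.ofReal_one, mul_one]
  · rcases eq_or_ne k 0 with rfl | hk
    · simp
    · have hk0 : (k : ℂ) ≠ 0 := Complex.ofReal_ne_zero.2 hk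
      rw [Real.sinc_of_ne_zero (mul_ne_zero hk hr)]
      push_cast
      field_simp

@[fun_prop]
theorem differentiable_sineRatio (r : ℝ) : Differentiable ℂ (sineRatio r) := by
  unfold sineRatio
  split_ifs
  · exact differentiable_id
  · fun_prop

theorem norm_sin_le_exp_norm (z : ℂ) : ‖Complex.sin z‖ ≤ Real.exp ‖z‖ := by
  have hneg : ‖Complex.exp (-z * I)‖ ≤ Real.exp ‖z‖ := by
    simpa using Complex.norm_exp_le_exp_norm (-z * I)
  have hpos : ‖Complex.exp (z * I)‖ ≤ Real.exp ‖z‖ := by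
    simpa using Complex.norm_exp_le_exp_norm (z * I)
  rw [Complex.sin, norm_div, norm_mul, Complex.norm_I, mul_one, Complex.norm_ofNat,
    div_le_iff₀ two_pos]
  linarith [norm_sub_le (Complex.exp (-z * I)) (Complex.exp (z * I))]

theorem exists_norm_sineRatio_le (r : ℝ) :
    ∃ C D : ℝ, 0 ≤ C ∧ ∀ k, ‖sineRatio r k‖ ≤ C * Real.exp (D * ‖k‖) := by
  rcases eq_or_ne r 0 with rfl | hr
  · refine ⟨1, 1, zero_le_one, fun k => ?_⟩
    rw [sineRatio, if_pos rfl, one_mul, one_mul]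
    linarith [Real.add_one_le_exp ‖k‖]
  · refine ⟨|r|⁻¹, |r|, by positivity, fun k => ?_⟩
    rw [sineRatio, if_neg hr, norm_div, Complex.norm_real, Real.norm_eq_abs, div_eq_inv_mul]
    gcongr
    simpa [mul_comm] using norm_sin_le_exp_norm (k * r)

end SineRatio

section Gaussian

theorem sq_norm_div_two_le_re_sq {k : ℂ} (hk : |k.arg| ≤ π / 6) : ‖k‖ ^ 2 / 2 ≤ (k ^ 2).re := by
  have hcos : √3 / 2 ≤ Real.cos k.arg := by
    rw [← Real.cos_abs, ← Real.cos_pi_div_six]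
    exact Real.cos_le_cos_of_nonneg_of_le_pi (abs_nonneg _) (by linarith [Real.pi_pos]) hk
  have hre : ‖k‖ * (√3 / 2) ≤ k.re := by
    rw [← Complex.norm_mul_cos_arg]
    gcongr
  have hsq : (‖k‖ * (√3 / 2)) ^ 2 ≤ k.re ^ 2 := by gcongr
  rw [mul_pow, div_pow, Real.sq_sqrt zero_le_three] at hsq
  have hnorm : ‖k‖ ^ 2 = k.re ^ 2 + k.im ^ 2 := by
    rw [Complex.sq_norm, Complex.normSq_apply, sq, sq]
  rw [sq k, Complex.mul_re]
  linarith

theorem exp_neg_mul_sq_mul_exp_le {a : ℝ} (ha : 0 < a) (D t : ℝ) :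
    Real.exp (-(a * t ^ 2)) * Real.exp (D * t) ≤
      Real.exp ((D + 1) ^ 2 / (4 * a)) * Real.exp (-t) := by
  rw [← Real.exp_add, ← Real.exp_add, Real.exp_le_exp, ← sub_nonneg]
  have hsq : (D + 1) ^ 2 / (4 * a) + -t - (-(a * t ^ 2) + D * t) =
      (D + 1 - 2 * a * t) ^ 2 / (4 * a) := by
    field_simp
    ring
  rw [hsq]
  positivity

theorem sectorDecay_mul_gaussian_mul_sineRatio {R : ℝ} (hR : R ≠ 0) (r : ℝ) :
    SectorDecay fun k => k * (Complex.exp (-(k ^ 2 * R ^ 2)) * sineRatio r k) := by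
  obtain ⟨C, D, hC, hsine⟩ := exists_norm_sineRatio_le r
  refine ⟨by fun_prop, C * Real.exp ((D + 1) ^ 2 / (4 * (R ^ 2 / 2))), fun k hk => ?_⟩
  have hgauss : ‖Complex.exp (-(k ^ 2 * R ^ 2))‖ ≤ Real.exp (-(R ^ 2 / 2 * ‖k‖ ^ 2)) := by
    rw [Complex.norm_exp, Real.exp_le_exp, ← Complex.ofReal_pow, Complex.neg_re,
      Complex.re_mul_ofReal, neg_le_neg_iff]
    linarith [mul_le_mul_of_nonneg_right (sq_norm_div_two_le_re_sq hk) (sq_nonneg R)]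
  calc ‖k * (Complex.exp (-(k ^ 2 * R ^ 2)) * sineRatio r k)‖
      ≤ ‖k‖ * (Real.exp (-(R ^ 2 / 2 * ‖k‖ ^ 2)) * (C * Real.exp (D * ‖k‖))) := by
        rw [norm_mul, norm_mul]
        gcongr
        exact hsine k
    _ = C * ‖k‖ * (Real.exp (-(R ^ 2 / 2 * ‖k‖ ^ 2)) * Real.exp (D * ‖k‖)) := by ring
    _ ≤ C * ‖k‖ * (Real.exp ((D + 1) ^ 2 / (4 * (R ^ 2 / 2))) * Real.exp (-‖k‖)) := by
        gcongr C * ‖k‖ * ?_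
        exact exp_neg_mul_sq_mul_exp_le (by positivity) D ‖k‖
    _ = C * Real.exp ((D + 1) ^ 2 / (4 * (R ^ 2 / 2))) * (‖k‖ * Real.exp (-‖k‖)) := by ring

end Gaussian

section PhotonDensity

variable {ι : Type*}

/-- The analytic continuation in `k` of the matrix `γ k² e^{-k²R²} f(k, |x_j - x_l|)`. -/
noncomputable def gaussianDensity (γ R : ℝ) (x : ι → Space) (k : ℂ) : Matrix ι ι ℂ :=
  Matrix.of fun j l => (γ * (4 * π) : ℝ) *
    (k * (Complex.exp (-(k ^ 2 * R ^ 2)) * sineRatio (dist (x j) (x l)) k))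

theorem gaussianDensity_ofReal (γ R : ℝ) (x : ι → Space) (k : ℝ) :
    gaussianDensity γ R x k = (γ * k ^ 2 * Real.exp (-(k ^ 2 * R ^ 2))) •
      Matrix.of fun j l => (sphKernel k (dist (x j) (x l)) : ℂ) := by
  ext j l
  simp only [gaussianDensity, Matrix.of_apply, Matrix.smul_apply, Complex.real_smul,
    sineRatio_ofReal, sphKernel]
  push_cast
  ring

theorem isSpectralDensity_gaussianDensity [Finite ι] {γ R : ℝ} (hγ : 0 < γ) (hR : R ≠ 0)
    {x : ι → Space} (hx : Function.Injective x) : IsSpectralDensity (gaussianDensity γ R x) where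
  sectorDecay j l := (sectorDecay_mul_gaussian_mul_sineRatio hR _).const_mul _
  posDef k hk := by
    rw [gaussianDensity_ofReal]
    exact (posDef_sphKernel hx hk).smul (by positivity)

/-- The spectral density of the photon field in the frequency variable `ω = c k`; measuring lengths
in units of `c` makes the speed of light equal to `1`. -/
noncomputable def photonDensity (c g R : ℝ) (x : ι → Space) : ℂ → Matrix ι ι ℂ :=
  gaussianDensity (coupling g / c ^ 3) (R / c) fun j => c⁻¹ • x j

variable {c g R : ℝ} {x : ι → Space}

theorem isSpectralDensity_photonDensity [Finite ι] (hc : 0 < c) (hg : g ≠ 0) (hR : R ≠ 0)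
    (hx : Function.Injective x) : IsSpectralDensity (photonDensity c g R x) :=
  isSpectralDensity_gaussianDensity (by unfold coupling; positivity) (div_ne_zero hR hc.ne')
    ((smul_right_injective _ (inv_ne_zero hc.ne')).comp hx)

theorem photonDensity_mul_apply (hc : 0 < c) (k : ℝ) (j l : ι) :
    photonDensity c g R x (c * k : ℝ) j l = coupling g / c *
      (k ^ 2 * Real.exp (-(k ^ 2 * R ^ 2)) * sphKernel k (dist (x j) (x l)) : ℝ) := by
  have hc0 : (c : ℂ) ≠ 0 := Complex.ofReal_ne_zero.2 hc.ne'
  have hdist : c * k * dist (c⁻¹ • x j) (c⁻¹ • x l) = k * dist (x j) (x l) := by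
    rw [dist_smul₀, Real.norm_of_nonneg (inv_nonneg.2 hc.le)]
    field_simp
  have hgauss : (c * k) ^ 2 * (R / c) ^ 2 = k ^ 2 * R ^ 2 := by field_simp
  rw [photonDensity, gaussianDensity_ofReal, Matrix.smul_apply, Matrix.of_apply, sphKernel, hdist,
    hgauss, ← sphKernel, Complex.real_smul]
  push_cast
  field_simp

theorem integral_photonDensity_mul (hc : 0 < c) (j l : ι) (F : ℝ → ℂ) :
    ∫ ω in Ioi (0 : ℝ), photonDensity c g R x ω j l * F ω =
      coupling g * ∫ k in Ioi (0 : ℝ),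
        (k ^ 2 * Real.exp (-(k ^ 2 * R ^ 2)) * sphKernel k (dist (x j) (x l)) : ℝ) * F (c * k) := by
  have hc0 : (c : ℂ) ≠ 0 := Complex.ofReal_ne_zero.2 hc.ne'
  have hscale := integral_comp_mul_left_Ioi
    (fun ω : ℝ => photonDensity c g R x ω j l * F ω) 0 hc
  rw [mul_zero, eq_inv_smul_iff₀ hc.ne', Complex.real_smul] at hscale
  simp only [photonDensity_mul_apply hc, mul_assoc, integral_const_mul] at hscale ⊢
  rw [← hscale, ← mul_assoc, mul_div_cancel₀ _ hc0]

end PhotonDensity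

/-! ### The atom-photon system -/

theorem inv_neg_of_isUnit_det {n α : Type*} [Fintype n] [DecidableEq n] [CommRing α]
    {A : Matrix n n α} (hA : IsUnit A.det) : (-A)⁻¹ = -A⁻¹ :=
  Matrix.inv_eq_right_inv (by rw [neg_mul_neg, Matrix.mul_nonsing_inv A hA])

section AtomPhotonSystem

variable {c Ω g R : ℝ} {N : ℕ} {x : Fin N → Space}

theorem EMat_eq_stieltjes (hc : 0 < c) (y : ℂ) :
    EMat c g R x y =
      Matrix.of fun j l => stieltjes (fun k => photonDensity c g R x k j l) (-y) := by
  ext j l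
  simp only [EMat, Matrix.of_apply, stieltjes, div_eq_mul_inv]
  rw [integral_photonDensity_mul hc j l fun ω => ((ω : ℂ) - -y)⁻¹]
  push_cast
  simp only [sub_neg_eq_add, add_comm y, mul_right_comm]

theorem resolv_eq_inv_feshbach (hc : 0 < c) :
    resolv c Ω g R x = fun y => (feshbach Ω (photonDensity c g R x) (-y))⁻¹ := by
  ext1 y
  rw [resolv, feshbach, EMat_eq_stieltjes hc, sub_neg_eq_add, add_comm y]

theorem smul_one_sub_EMat_zero (hc : 0 < c) :
    (Ω : ℂ) • (1 : Matrix (Fin N) (Fin N) ℂ) - EMat c g R x 0 =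
      feshbach Ω (photonDensity c g R x) 0 := by
  rw [feshbach, EMat_eq_stieltjes hc, sub_zero, neg_zero]

theorem coupling_ne_zero (hg : g ≠ 0) : (coupling g : ℂ) ≠ 0 := by
  rw [Complex.ofReal_ne_zero, coupling]
  positivity

theorem Gam_eq_stieltjes (hc : 0 < c) (hg : g ≠ 0) (z : ℂ) (j l : Fin N) :
    I * c * Gam c R x (-I * z) j l =
      c / coupling g * stieltjes (fun k => photonDensity c g R x k j l) z := by
  have hc0 : (c : ℂ) ≠ 0 := Complex.ofReal_ne_zero.2 hc.ne'
  have hg0 := coupling_ne_zero hg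
  simp only [stieltjes, div_eq_mul_inv _ (_ - z)]
  rw [integral_photonDensity_mul hc j l fun ω => ((ω : ℂ) - z)⁻¹, ← mul_assoc,
    div_mul_cancel₀ _ hg0, Gam, Matrix.of_apply, ← mul_assoc,
    mul_one_div_cancel (mul_ne_zero Complex.I_ne_zero hc0), one_mul, ← integral_const_mul]
  refine setIntegral_congr_fun measurableSet_Ioi fun k _ => ?_
  have hden : -I * z / (I * c) + k = (c * k - z) / c := by
    field_simp
    ring
  simp only [hden]
  push_cast
  rw [div_div_eq_mul_div]
  ring

theorem tendsto_Gam_add (h : IsSpectralDensity (photonDensity c g R x)) (hc : 0 < c) (hg : g ≠ 0)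
    (y : ℝ) (j l : Fin N) :
    Tendsto (fun ε : ℝ => I * c * Gam c R x (-I * y + ε) j l) (𝓝[>] 0)
      (𝓝 (c / coupling g * rotatedStieltjes (fun k => photonDensity c g R x k j l) y)) := by
  refine (((h.sectorDecay j l).tendsto_stieltjes_add_mul_I y).const_mul _).congr fun ε => ?_
  rw [← Gam_eq_stieltjes hc hg]
  -- The substitution `s = -iz` takes `z = y + iε` to `s = -iy + ε`.
  congr 3
  linear_combination -(ε : ℂ) * Complex.I_sq

theorem tendsto_Gam_sub (h : IsSpectralDensity (photonDensity c g R x)) (hc : 0 < c) (hg : g ≠ 0)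
    (y : ℝ) (j l : Fin N) :
    Tendsto (fun ε : ℝ => I * c * Gam c R x (-I * y - ε) j l) (𝓝[>] 0)
      (𝓝 (c / coupling g * conj (rotatedStieltjes (fun k => photonDensity c g R x k l j) y))) := by
  refine (((Complex.continuous_conj.tendsto _).comp
    ((h.sectorDecay l j).tendsto_stieltjes_add_mul_I y)).const_mul _).congr fun ε => ?_
  rw [Function.comp_apply, ← h.stieltjes_conj_apply, ← Gam_eq_stieltjes hc hg]
  congr 3
  simp only [map_add, map_mul, Complex.conj_ofReal, Complex.conj_I]
  linear_combination (ε : ℂ) * Complex.I_sq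

theorem DMinus_eq_neg_feshbachUpper (h : IsSpectralDensity (photonDensity c g R x)) (hc : 0 < c)
    (hg : g ≠ 0) (y : ℝ) :
    DMinus c Ω g R x y = -feshbachUpper Ω (photonDensity c g R x) y := by
  have hc0 : (c : ℂ) ≠ 0 := Complex.ofReal_ne_zero.2 hc.ne'
  have hg0 := coupling_ne_zero hg
  ext j l
  simp only [DMinus, AMinus, feshbachUpper, Matrix.add_apply, Matrix.smul_apply, Matrix.of_apply,
    Matrix.neg_apply, Matrix.sub_apply, (tendsto_Gam_add h hc hg y j l).limUnder_eq, smul_eq_mul]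
  field_simp
  ring

theorem DPlus_eq_neg_conjTranspose_feshbachUpper (h : IsSpectralDensity (photonDensity c g R x))
    (hc : 0 < c) (hg : g ≠ 0) (y : ℝ) :
    DPlus c Ω g R x y = -(feshbachUpper Ω (photonDensity c g R x) y)ᴴ := by
  have hc0 : (c : ℂ) ≠ 0 := Complex.ofReal_ne_zero.2 hc.ne'
  have hg0 := coupling_ne_zero hg
  rw [feshbachUpper, Matrix.conjTranspose_sub, Matrix.conjTranspose_smul,
    Matrix.conjTranspose_one]
  ext j l
  simp only [DPlus, APlus, Matrix.add_apply, Matrix.smul_apply, Matrix.of_apply, Matrix.neg_apply,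
    Matrix.sub_apply, (tendsto_Gam_sub h hc hg y j l).limUnder_eq, smul_eq_mul, star_sub,
    Matrix.conjTranspose_apply, Complex.star_def, Complex.conj_ofReal]
  field_simp
  ring

theorem isUnit_DPlus (h : IsSpectralDensity (photonDensity c g R x)) (hc : 0 < c) (hg : g ≠ 0)
    {y : ℝ} (hy : 0 < y) : IsUnit (DPlus c Ω g R x y) := by
  rw [DPlus_eq_neg_conjTranspose_feshbachUpper h hc hg, IsUnit.neg_iff,
    Matrix.isUnit_iff_isUnit_det, Matrix.det_conjTranspose]
  exact (h.det_feshbachUpper_ne_zero hy).isUnit.star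

theorem isUnit_DMinus (h : IsSpectralDensity (photonDensity c g R x)) (hc : 0 < c) (hg : g ≠ 0)
    {y : ℝ} (hy : 0 < y) : IsUnit (DMinus c Ω g R x y) := by
  rw [DMinus_eq_neg_feshbachUpper h hc hg, IsUnit.neg_iff, Matrix.isUnit_iff_isUnit_det]
  exact (h.det_feshbachUpper_ne_zero hy).isUnit

theorem HPlus_sub_HMinus_eq_jump (h : IsSpectralDensity (photonDensity c g R x)) (hc : 0 < c)
    (hg : g ≠ 0) {y : ℝ} (hy : 0 < y) :
    HPlus c Ω g R x y - HMinus c Ω g R x y = jump Ω (photonDensity c g R x) y := by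
  have hdet := h.det_feshbachUpper_ne_zero (Ω := Ω) hy
  have hdet_star : (feshbachUpper Ω (photonDensity c g R x) y)ᴴ.det ≠ 0 := by
    rwa [Matrix.det_conjTranspose, star_ne_zero]
  rw [HPlus, HMinus, DPlus_eq_neg_conjTranspose_feshbachUpper h hc hg,
    DMinus_eq_neg_feshbachUpper h hc hg, inv_neg_of_isUnit_det hdet.isUnit,
    inv_neg_of_isUnit_det hdet_star.isUnit, jump, Matrix.conjTranspose_nonsing_inv]
  abel

theorem matrixResidue_resolv (h : IsSpectralDensity (photonDensity c g R x)) (hc : 0 < c)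
    {p : ℝ} (hp : 0 < p) :
    matrixResidue (resolv c Ω g R x) p = feshbachResidue Ω (photonDensity c g R x) p := by
  ext j l
  rw [resolv_eq_inv_feshbach hc]
  exact (tendsto_circleIntegral_of_tendsto_sub_mul
    (h.meromorphicAt_inv_feshbach_neg_apply (Complex.ofReal_mem_slitPlane.2 hp) j l)
    (h.tendsto_feshbachResidue_apply hp j l)).limUnder_eq

theorem oscillatoryIntegral_photonDensity (hc : 0 < c) (t : ℝ) (j l : Fin N) :
    oscillatoryIntegral Ω (fun ω => photonDensity c g R x ω j l) t =
      coupling g * (Complex.exp (I * Ω * t) * ∫ k in Ioi (0 : ℝ),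
        (k : ℂ) ^ 2 * Complex.exp (-I * c * k * t - (k : ℂ) ^ 2 * (R : ℂ) ^ 2) *
          (sphKernel k (dist (x j) (x l)) : ℂ)) := by
  simp only [oscillatoryIntegral, smul_eq_mul, mul_comm (Complex.exp (-(I * _ * _)))]
  rw [integral_photonDensity_mul hc j l fun ω => Complex.exp (-(I * ω * t)), mul_left_comm]
  congr! 4 with k
  push_cast
  rw [sub_eq_add_neg, Complex.exp_add]
  ring_nf

theorem IsSolution.hasDerivAt_memoryKernel {β : ℝ → Fin N → ℂ} (hβ : IsSolution c Ω g R x β)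
    (h : IsSpectralDensity (photonDensity c g R x)) (hc : 0 < c) {t : ℝ} (ht : 0 < t) :
    HasDerivAt β (-∫ τ in (0 : ℝ)..t, memoryKernel Ω (photonDensity c g R x) (t - τ) (β τ)) t := by
  have hcont : ContinuousOn β (uIcc 0 t) :=
    hβ.continuousOn.mono (uIcc_of_le ht.le ▸ Icc_subset_Ici_self)
  have hosc : ∀ j l, Continuous (oscillatoryIntegral Ω fun ω => photonDensity c g R x ω j l) :=
    fun j l => continuous_oscillatoryIntegral Ω (h.sectorDecay j l).integrableOn
  have hK := h.continuous_memoryKernel (Ω := Ω)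
  have hint : IntervalIntegrable
      (fun τ => memoryKernel Ω (photonDensity c g R x) (t - τ) (β τ)) volume 0 t :=
    ContinuousOn.intervalIntegrable (by fun_prop)
  have hint_apply : ∀ j l, IntervalIntegrable
      (fun τ => oscillatoryIntegral Ω (fun ω => photonDensity c g R x ω j l) (t - τ) * β τ l)
      volume 0 t := fun j l => by
    have := hosc j l
    exact ContinuousOn.intervalIntegrable (by fun_prop)
  refine hasDerivAt_pi.2 fun j => (hβ.hasDerivAt t ht j).congr_deriv ?_
  have happly := ContinuousLinearMap.intervalIntegral_comp_comm
    (ContinuousLinearMap.proj (R := ℂ) (φ := fun _ : Fin N => ℂ) j) hint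
  simp only [ContinuousLinearMap.proj_apply, memoryKernel_apply] at happly
  rw [Pi.neg_apply, ← happly, intervalIntegral.integral_finsetSum fun l _ => hint_apply j l,
    neg_mul, Finset.mul_sum]
  simp only [oscillatoryIntegral_photonDensity hc, Complex.ofReal_sub, mul_assoc,
    intervalIntegral.integral_const_mul]
  congr! 5 with l
  rw [mul_comm, mul_assoc]
theorem setOf_isMatrixPole_resolv (h : IsSpectralDensity (photonDensity c g R x)) (hc : 0 < c) :
    {p : ℂ | p ∈ Complex.slitPlane ∧ IsMatrixPole (resolv c Ω g R x) p} =
      (fun p : ℝ => (p : ℂ)) '' bindingEnergies Ω (photonDensity c g R x) := by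
  ext y
  rw [resolv_eq_inv_feshbach hc]
  refine ⟨fun ⟨hy, hpole⟩ => (h.exists_meromorphicOrderAt_inv_feshbach_neg_iff hy).1 hpole, ?_⟩
  rintro ⟨p, hp, rfl⟩
  have hslit : (p : ℂ) ∈ Complex.slitPlane := Complex.ofReal_mem_slitPlane.2 hp.1
  exact ⟨hslit, (h.exists_meromorphicOrderAt_inv_feshbach_neg_iff hslit).2 ⟨p, hp, rfl⟩⟩

theorem exp_smul_HPlus_sub_HMinus_mulVec (h : IsSpectralDensity (photonDensity c g R x))
    (hc : 0 < c) (hg : g ≠ 0) (t : ℝ) (v : Fin N → ℂ) :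
    EqOn (fun y : ℝ => Complex.exp (-I * y * t) • (HPlus c Ω g R x y - HMinus c Ω g R x y) *ᵥ v)
      (fun y : ℝ => Complex.exp (-(I * y * t)) • jump Ω (photonDensity c g R x) y *ᵥ v)
      (Ioi 0) := fun y hy => by
  simp only [HPlus_sub_HMinus_eq_jump h hc hg hy, neg_mul]

theorem integrableOn_exp_smul_HPlus_sub_HMinus_mulVec
    (h : IsSpectralDensity (photonDensity c g R x)) (hc : 0 < c) (hg : g ≠ 0)
    (h0 : ((Ω : ℂ) • (1 : Matrix (Fin N) (Fin N) ℂ) - EMat c g R x 0).det ≠ 0)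
    (t : ℝ) (v : Fin N → ℂ) :
    IntegrableOn (fun y : ℝ =>
      Complex.exp (-I * y * t) • (HPlus c Ω g R x y - HMinus c Ω g R x y) *ᵥ v) (Ioi 0) := by
  rw [smul_one_sub_EMat_zero hc] at h0
  rw [integrableOn_congr_fun (exp_smul_HPlus_sub_HMinus_mulVec h hc hg t v) measurableSet_Ioi]
  exact integrableOn_exp_neg_I_smul (h.integrableOn_jump_mulVec h0 v) t

theorem evolution_photonDensity (h : IsSpectralDensity (photonDensity c g R x)) (hc : 0 < c)
    (hg : g ≠ 0) {P : Finset ℝ} (hP : ∀ p ∈ P, 0 < p) (v : Fin N → ℂ) (t : ℝ) :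
    evolution Ω (photonDensity c g R x) P v t =
      (Complex.exp (I * Ω * t) / (2 * π * I)) •
        (∫ y in Ioi (0 : ℝ),
          Complex.exp (-I * y * t) • (HPlus c Ω g R x y - HMinus c Ω g R x y) *ᵥ v) +
      ∑ p ∈ P, Complex.exp (I * (p + Ω) * t) • matrixResidue (resolv c Ω g R x) p *ᵥ v := by
  rw [evolution, oscillatoryIntegral, smul_smul, ← div_eq_inv_mul,
    setIntegral_congr_fun measurableSet_Ioi (exp_smul_HPlus_sub_HMinus_mulVec h hc hg t v)]
  congr 1
  refine Finset.sum_congr rfl fun p hp => ?_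
  rw [matrixResidue_resolv h hc (hP p hp), Complex.ofReal_add]

end AtomPhotonSystem

end AtomPhoton

open AtomPhoton in
theorem mainTheorem2_general (c Ω g R : ℝ) (hc : 0 < c) (hg : g ≠ 0) (hR : R ≠ 0)
    (N : ℕ) (x : Fin N → EuclideanSpace ℝ (Fin 3)) (hx : Function.Injective x) :
    (∀ y ∈ Complex.slitPlane, ∀ j l : Fin N,
      MeromorphicAt (fun z => resolv c Ω g R x z j l) y) ∧
    (∀ y : ℝ, 0 < y → ∀ j l : Fin N,
      Tendsto (fun ε : ℝ => Complex.I * c * Gam c R x (-Complex.I * y - ε) j l)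
        (𝓝[>] 0) (𝓝 (APlus c R x y j l)) ∧
      Tendsto (fun ε : ℝ => Complex.I * c * Gam c R x (-Complex.I * y + ε) j l)
        (𝓝[>] 0) (𝓝 (AMinus c R x y j l))) ∧
    (∀ y : ℝ, 0 < y → IsUnit (DPlus c Ω g R x y) ∧ IsUnit (DMinus c Ω g R x y)) ∧
    ∃ P : Finset ℝ,
      {p : ℂ | p ∈ Complex.slitPlane ∧ IsMatrixPole (resolv c Ω g R x) p} =
        (fun p : ℝ => (p : ℂ)) '' P ∧
      (∀ p ∈ P, 0 < p) ∧
      P.card ≤ N ∧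
      (((Ω : ℂ) • (1 : Matrix (Fin N) (Fin N) ℂ) - EMat c g R x 0).det ≠ 0 →
        ∀ β : ℝ → Fin N → ℂ, IsSolution c Ω g R x β →
          ∀ t : ℝ, 0 ≤ t →
            IntegrableOn (fun y : ℝ => Complex.exp (-Complex.I * y * t) •
              (HPlus c Ω g R x y - HMinus c Ω g R x y).mulVec (β 0)) (Ioi 0) ∧
            β t =
              (Complex.exp (Complex.I * Ω * t) / (2 * Real.pi * Complex.I)) •
                (∫ y in Ioi (0 : ℝ), Complex.exp (-Complex.I * y * t) •
                  (HPlus c Ω g R x y - HMinus c Ω g R x y).mulVec (β 0)) +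
              ∑ p ∈ P, Complex.exp (Complex.I * (p + Ω) * t) •
                (matrixResidue (resolv c Ω g R x) p).mulVec (β 0)) := by
  have h : IsSpectralDensity (photonDensity c g R x) := isSpectralDensity_photonDensity hc hg hR hx
  have hfin := h.finite_bindingEnergies (Ω := Ω)
  have hpos : ∀ p ∈ hfin.toFinset, 0 < p := fun p hp => (hfin.mem_toFinset.1 hp).1
  refine ⟨fun y hy j l => ?_, fun y _ j l => ?_,
    fun y hy => ⟨isUnit_DPlus h hc hg hy, isUnit_DMinus h hc hg hy⟩,
    hfin.toFinset, ?_, hpos, ?_, fun h0 β hβ t ht => ⟨?_, ?_⟩⟩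
  · rw [resolv_eq_inv_feshbach hc]
    exact h.meromorphicAt_inv_feshbach_neg_apply hy j l
  · exact ⟨tendsto_nhds_limUnder ⟨_, tendsto_Gam_sub h hc hg y j l⟩,
      tendsto_nhds_limUnder ⟨_, tendsto_Gam_add h hc hg y j l⟩⟩
  · rw [setOf_isMatrixPole_resolv h hc, hfin.coe_toFinset]
  · simpa using h.card_le_of_subset_bindingEnergies hfin.coe_toFinset.le
  · exact integrableOn_exp_smul_HPlus_sub_HMinus_mulVec h hc hg h0 t (β 0)
  · rw [smul_one_sub_EMat_zero hc] at h0
    exact (h.eq_evolution hfin.coe_toFinset h0 hβ.continuousOn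
      (fun t ht => hβ.hasDerivAt_memoryKernel h hc ht) ht).trans
      (evolution_photonDensity h hc hg hpos (β 0) t)

theorem mainTheorem2 (c Ω g R : ℝ) (hc : 0 < c) (hΩ : 0 < Ω) (hg : 0 < g) (hR : 0 < R)
    (N : ℕ) (x : Fin N → EuclideanSpace ℝ (Fin 3)) (hx : Function.Injective x) :
    -- `(y + Ω - E(y))⁻¹` is meromorphic on the complement of `(-∞, 0]`
    (∀ y ∈ Complex.slitPlane, ∀ j l : Fin N,
      MeromorphicAt (fun z => AtomPhoton.resolv c Ω g R x z j l) y) ∧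
    -- the limits that define `A⁺(y)` and `A⁻(y)` exist
    (∀ y : ℝ, 0 < y → ∀ j l : Fin N,
      Tendsto (fun ε : ℝ => Complex.I * c * AtomPhoton.Gam c R x (-Complex.I * y - ε) j l)
        (𝓝[>] 0) (𝓝 (AtomPhoton.APlus c R x y j l)) ∧
      Tendsto (fun ε : ℝ => Complex.I * c * AtomPhoton.Gam c R x (-Complex.I * y + ε) j l)
        (𝓝[>] 0) (𝓝 (AtomPhoton.AMinus c R x y j l))) ∧
    -- the matrices inverted in `H⁺(y)` and `H⁻(y)` are invertible
    (∀ y : ℝ, 0 < y →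
      IsUnit (AtomPhoton.DPlus c Ω g R x y) ∧ IsUnit (AtomPhoton.DMinus c Ω g R x y)) ∧
    -- the set of poles is a set of at most `N` positive reals
    ∃ P : Finset ℝ,
      {p : ℂ | p ∈ Complex.slitPlane ∧
        AtomPhoton.IsMatrixPole (AtomPhoton.resolv c Ω g R x) p} = (fun p : ℝ => (p : ℂ)) '' P ∧
      (∀ p ∈ P, 0 < p) ∧
      P.card ≤ N ∧
      -- the representation of the solution, away from the threshold `det (Ω - E(0)) = 0`
      (((Ω : ℂ) • (1 : Matrix (Fin N) (Fin N) ℂ) - AtomPhoton.EMat c g R x 0).det ≠ 0 →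
        ∀ β : ℝ → Fin N → ℂ, AtomPhoton.IsSolution c Ω g R x β →
          ∀ t : ℝ, 0 ≤ t →
            IntegrableOn (fun y : ℝ => Complex.exp (-Complex.I * y * t) •
              (AtomPhoton.HPlus c Ω g R x y - AtomPhoton.HMinus c Ω g R x y).mulVec (β 0))
              (Ioi 0) ∧
            β t =
              (Complex.exp (Complex.I * Ω * t) / (2 * Real.pi * Complex.I)) •
                (∫ y in Ioi (0 : ℝ), Complex.exp (-Complex.I * y * t) •
                  (AtomPhoton.HPlus c Ω g R x y - AtomPhoton.HMinus c Ω g R x y).mulVec (β 0)) +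
              ∑ p ∈ P, Complex.exp (Complex.I * (p + Ω) * t) •
                (AtomPhoton.matrixResidue (AtomPhoton.resolv c Ω g R x) p).mulVec (β 0)) :=
  mainTheorem2_general c Ω g R hc hg.ne' hR.ne' N x hx
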